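/- Let $M$ be either a smooth variety (a smooth, separated scheme of finite type, not necessarily irreducible) over an algebraically closed field $\mathbb{k}$ of characteristic zero, or, for $\mathbb{k}=\mathbb{C}$, a complex analytic manifold. Let $X\subset M$ be a reduced hypersurface and let $Z$ be a connected component of the singular locus $\mathrm{Sing}(X)$ (complete or not), taken with its reduced structure. Write $I_Z\subset\mathcal{O}_M$ for its ideal sheaf and $\mathcal{O}_Z=\mathcal{O}_M/I_Z$. Suppose that * $Z$ is a locally complete intersection in $M$ of codimension $k$, i.e. locally along $Z$ the ideal $I_Z$ is generated by a regular sequence $g_1,\dots,g_k$; * the generic multiplicity of $X$ along $Z$ is $p$, i.e. $X$ has multiplicity $p$ at all points of a dense open subset of $Z$; * the generic transversal type of $X$ along $Z$ is ordinary, i.e. for all $x$ in a dense open subset of $Z$ there are a local equation $f$ of $X$ at $x$, generators $g_1,\dots,g_k$ of $I_{Z,x}$ and $a_m\in\mathcal{O}_{M,x}$ with $$f=\sum_{m_1+\dots+m_k=p}a_{m_1,\dots,m_k}\,g_1^{m_1}\cdots g_k^{m_k}\qquad(*)$$ such that $\{\sum_m a_m(x)\,y_1^{m_1}\cdots y_k^{m_k}=0\}\subset\mathbb{P}^{k-1}$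 is a smooth hypersurface. The transversal discriminant $\Delta^\perp\subset Z$ is the pullback to $Z$ of the classical discriminant (the reduced closed subvariety of those forms of degree $p$ in $k$ variables over $\mathbb{k}$ that do not define a smooth hypersurface in $\mathbb{P}^{k-1}$): the stalk of its ideal sheaf at $x\in Z$ is generated by the elements $\mathfrak{D}\big((a_m|_Z)_m\big)\in\mathcal{O}_{Z,x}$, where $\mathfrak{D}$ runs over the polynomials in the coefficients that vanish on the classical discriminant, and $(a_m)$ runs over the coefficients of all expansions $(*)$ at $x$. Then $\Delta^\perp$ is an effective Cartier divisor on $Z$, and its class $[\Delta^\perp]=[\mathcal{O}_Z(\Delta^\perp)]$ in the Picard group of $Z$ is $$[\Delta^\perp]=(p-1)^{k-1}\Big(k\,[X]-p\,[\det\mathcal{N}_{Z/M}]\Big)\in\mathrm{Pic}(Z),$$ where $[X]$ is the class of $\mathcal{O}_M(X)|_Z$ and $\mathcal{N}_{Z/M}=(I_Z/I_Z^2)^\vee$ is the normal bundle of $Z$ in $M$. -/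

import Mathlib

open CategoryTheory TopologicalSpace Opposite AlgebraicGeometry
open scoped Manifold ContDiff

universe u v

noncomputable section

namespace TransDisc

/-! ### Closed subsets of a locally ringed space with their reduced structure -/

section Ideals

variable (M : LocallyRingedSpace.{u})

/-- The stalk at `x` of the ideal sheaf of the subset `Y`: germs at `x` of functions which vanish at
every point of `Y` (near `x`). -/
def idealAt (Y : Set M) (x : M) : Ideal (M.presheaf.stalk x) where
  carrier := {s | ∃ (U : Opens M) (hx : x ∈ U) (t : M.presheaf.obj (op U)),
    M.presheaf.germ U x hx t = s ∧
      ∀ (y : M) (hy : y ∈ U), y ∈ Y →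
        M.presheaf.germ U y hy t ∈ IsLocalRing.maximalIdeal (M.presheaf.stalk y)}
  zero_mem' := ⟨⊤, trivial, 0, map_zero _, fun y hy _ => by simp⟩
  add_mem' := by
    rintro _ _ ⟨U, hU, s, rfl, hs⟩ ⟨V, hV, t, rfl, ht⟩
    refine ⟨U ⊓ V, Opens.mem_inf.2 ⟨hU, hV⟩, M.presheaf.map (homOfLE inf_le_left).op s +
      M.presheaf.map (homOfLE inf_le_right).op t, ?_, ?_⟩
    · rw [map_add, TopCat.Presheaf.germ_res_apply, TopCat.Presheaf.germ_res_apply]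
    · intro y hy hyY
      rw [map_add, TopCat.Presheaf.germ_res_apply, TopCat.Presheaf.germ_res_apply]
      exact Ideal.add_mem _ (hs y hy.1 hyY) (ht y hy.2 hyY)
  smul_mem' := by
    rintro c _ ⟨V, hV, t, rfl, ht⟩
    obtain ⟨U, hU, s, rfl⟩ := M.presheaf.exists_germ_eq c
    refine ⟨U ⊓ V, Opens.mem_inf.2 ⟨hU, hV⟩, M.presheaf.map (homOfLE inf_le_left).op s *
      M.presheaf.map (homOfLE inf_le_right).op t, ?_, ?_⟩
    · rw [map_mul, TopCat.Presheaf.germ_res_apply, TopCat.Presheaf.germ_res_apply, smul_eq_mul]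
    · intro y hy hyY
      rw [map_mul, TopCat.Presheaf.germ_res_apply, TopCat.Presheaf.germ_res_apply]
      exact Ideal.mul_mem_left _ _ (ht y hy.2 hyY)

/-- The stalk `𝒪_{Z,x} = 𝒪_{M,x} / I_{Z,x}` of the structure sheaf of the reduced subspace `Z`. -/
abbrev Stalk (Z : Set M) (x : M) : Type u := M.presheaf.stalk x ⧸ idealAt M Z x

/-- `X` (with its reduced structure) is a hypersurface in `M`: a closed subset whose ideal sheaf is
locally generated by one equation, which is not a zero divisor. -/
def IsHypersurface (X : Set M) : Prop :=
  IsClosed X ∧ ∀ x : M, ∃ (U : Opens M) (_ : x ∈ U) (f : M.presheaf.obj (op U)),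
    ∀ (y : M) (hy : y ∈ U), Ideal.span {M.presheaf.germ U y hy f} = idealAt M X y ∧
      M.presheaf.germ U y hy f ∈ nonZeroDivisors (M.presheaf.stalk y)

/-- The singular locus of a hypersurface `X` in a smooth space `M`: the points of `X` at which the
differential of the local equation (its class in the cotangent space `𝔪 / 𝔪²` of `M`) vanishes. -/
def singularLocus (X : Set M) : Set M :=
  {x | x ∈ X ∧ idealAt M X x ≤ IsLocalRing.maximalIdeal (M.presheaf.stalk x) ^ 2}

/-- `Z` (with its reduced structure) is a locally complete intersection of codimension `k` in `M`:
its ideal sheaf is locally generated by `k` functions whose germs at the points of `Z` form a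
regular sequence. -/
def IsLCI (Z : Set M) (k : ℕ) : Prop :=
  ∀ x ∈ Z, ∃ (U : Opens M) (_ : x ∈ U) (g : Fin k → M.presheaf.obj (op U)),
    ∀ (y : M) (hy : y ∈ U),
      Ideal.span (Set.range fun i => M.presheaf.germ U y hy (g i)) = idealAt M Z y ∧
      (y ∈ Z → RingTheory.Sequence.IsWeaklyRegular (M.presheaf.stalk y)
        (List.ofFn fun i => M.presheaf.germ U y hy (g i)))

/-- `X` has multiplicity `p` at `x`: the equation of `X` at `x` lies in `𝔪 ^ p` and not in
`𝔪 ^ (p + 1)`. -/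
def HasMultiplicity (X : Set M) (x : M) (p : ℕ) : Prop :=
  idealAt M X x ≤ IsLocalRing.maximalIdeal (M.presheaf.stalk x) ^ p ∧
    ¬ idealAt M X x ≤ IsLocalRing.maximalIdeal (M.presheaf.stalk x) ^ (p + 1)

/-- The property `P` holds at the generic points of `Z`, i.e. on a dense open subset of `Z`. -/
def Generically (Z : Set M) (P : M → Prop) : Prop :=
  ∃ U : Opens M, Z ⊆ closure (Z ∩ U) ∧ ∀ x ∈ Z, x ∈ U → P x

end Ideals

/-! ### The classical discriminant -/

section Discriminant

/-- A form over a field `κ` in `k` variables defines a smooth hypersurface in `ℙ^{k-1}`: over the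
algebraic closure, the form and its partial derivatives have no common zero other than the
origin. -/
def IsSmoothForm {κ : Type v} [Field κ] {k : ℕ} (F : MvPolynomial (Fin k) κ) : Prop :=
  ∀ y : Fin k → AlgebraicClosure κ, y ≠ 0 →
    ¬ (MvPolynomial.aeval y F = 0 ∧ ∀ i, MvPolynomial.aeval y (MvPolynomial.pderiv i F) = 0)

/-- The exponents of the monomials of degree `p` in `k` variables. -/
abbrev Exponent (k p : ℕ) : Type := {m : Fin k →₀ ℕ // m.degree = p}

/-- The vector of coefficients of a form of degree `p`. -/
def coeffs {R : Type v} [CommRing R] {k : ℕ} (p : ℕ) (F : MvPolynomial (Fin k) R) :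
    Exponent k p → R := fun m => F.coeff m.1

/-- The ideal of the classical discriminant: the polynomials in the coefficients of forms of degree
`p` in `k` variables which vanish at all forms that define a singular hypersurface
(or no hypersurface) in `ℙ^{k-1}`. -/
def discriminantIdeal (K : Type v) [Field K] (k p : ℕ) : Ideal (MvPolynomial (Exponent k p) K) :=
  MvPolynomial.vanishingIdeal K
    (coeffs p '' {F : MvPolynomial (Fin k) K | F.IsHomogeneous p ∧ ¬ IsSmoothForm F})

end Discriminant

/-! ### The transversal type and its discriminant -/

section TransversalType

variable (M : LocallyRingedSpace.{u})

/-- At the point `x`, the germs `g 0, …, g (k-1)` generate the ideal of `Z`, the germ `f` generates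
the ideal of `X`, and `f = ∑_{|m| = p} a_m g^m`, where `F = ∑_{|m| = p} a_m y^m` is a form of
degree `p` with coefficients in `𝒪_{M,x}`. -/
structure IsExpansion (X Z : Set M) {k : ℕ} (p : ℕ) (x : M) (f : M.presheaf.stalk x)
    (g : Fin k → M.presheaf.stalk x) (F : MvPolynomial (Fin k) (M.presheaf.stalk x)) : Prop where
  span_f : Ideal.span {f} = idealAt M X x
  span_g : Ideal.span (Set.range g) = idealAt M Z x
  homogeneous : F.IsHomogeneous p
  expansion : f = MvPolynomial.eval g F

/-- The transversal type of `X` along `Z` at `x` is ordinary: the projectivised virtual normal cone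
`{∑_{|m| = p} a_m(x) y^m = 0} ⊆ ℙ^{k-1}` is a smooth hypersurface. -/
def IsOrdinaryAt (X Z : Set M) (k p : ℕ) (x : M) : Prop :=
  ∃ (f : M.presheaf.stalk x) (g : Fin k → M.presheaf.stalk x)
    (F : MvPolynomial (Fin k) (M.presheaf.stalk x)),
    IsExpansion M X Z p x f g F ∧
      IsSmoothForm (MvPolynomial.map (IsLocalRing.residue (M.presheaf.stalk x)) F)

/-- For a locally ringed space over a field `K`, the structure map `K → 𝒪_{Z,x}`. -/
def toStalk {K : Type v} [Field K] (ι : K →+* M.presheaf.obj (op ⊤)) (Z : Set M) (x : M) :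
    K →+* Stalk M Z x :=
  (Ideal.Quotient.mk (idealAt M Z x)).comp ((M.presheaf.germ ⊤ x trivial).hom.comp ι)

/-- The stalks of the ideal sheaf of the transversal discriminant `Δ^⊥ ⊆ Z`, the pullback of the
classical discriminant: the ideal of `𝒪_{Z,x}` generated by the values `𝔇(a_m|_Z)`, for the
polynomials `𝔇` in the ideal of the classical discriminant and the coefficients `a_m` of the
expansions `f = ∑_{|m| = p} a_m g^m`. -/
def transversalDiscriminant {K : Type v} [Field K] (ι : K →+* M.presheaf.obj (op ⊤))
    (X Z : Set M) (k p : ℕ) (x : M) : Ideal (Stalk M Z x) :=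
  Ideal.span {d | ∃ (f : M.presheaf.stalk x) (g : Fin k → M.presheaf.stalk x)
    (F : MvPolynomial (Fin k) (M.presheaf.stalk x)),
    IsExpansion M X Z p x f g F ∧
      ∃ D ∈ discriminantIdeal K k p,
        d = MvPolynomial.eval₂ (toStalk M ι Z x)
          (fun m => Ideal.Quotient.mk (idealAt M Z x) (coeffs p F m)) D}

end TransversalType

/-! ### The Picard group of `Z` -/

section Picard

variable (M : LocallyRingedSpace.{u}) (Z : Set M)

/-- A family of germs is a section of `𝒪_Z` over `Z ∩ U`: it is locally induced by functions
on open subsets of `M`. -/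
def IsSection (U : Opens M) (s : ∀ z : Z, Stalk M Z z) : Prop :=
  ∀ z : Z, z.1 ∈ U → ∃ (V : Opens M) (_ : z.1 ∈ V) (t : M.presheaf.obj (op V)),
    ∀ (w : Z) (hw : w.1 ∈ V), w.1 ∈ U → s w = Ideal.Quotient.mk _ (M.presheaf.germ V w.1 hw t)

/-- A family of units is a section of `𝒪_Z^×` over `Z ∩ U`. -/
def IsUnitSection (U : Opens M) (s : ∀ z : Z, (Stalk M Z z)ˣ) : Prop :=
  IsSection M Z U (fun z => (s z : Stalk M Z z)) ∧
    IsSection M Z U (fun z => ((s z)⁻¹ : (Stalk M Z z)ˣ))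

variable {M Z}

lemma IsSection.mono {U V : Opens M} (h : U ≤ V) {s : ∀ z : Z, Stalk M Z z}
    (hs : IsSection M Z V s) : IsSection M Z U s := by
  intro z hz
  obtain ⟨W, hzW, t, ht⟩ := hs z (h hz)
  exact ⟨W, hzW, t, fun w hw hwU => ht w hw (h hwU)⟩

lemma IsSection.congr {U : Opens M} {s s' : ∀ z : Z, Stalk M Z z}
    (hs : IsSection M Z U s) (h : ∀ z : Z, z.1 ∈ U → s z = s' z) : IsSection M Z U s' := by
  intro z hz
  obtain ⟨W, hzW, t, ht⟩ := hs z hz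
  exact ⟨W, hzW, t, fun w hw hwU => (h w hwU).symm.trans (ht w hw hwU)⟩

lemma IsSection.one (U : Opens M) : IsSection M Z U (fun _ => 1) :=
  fun _ _ => ⟨⊤, trivial, 1, fun w hw _ => by simp⟩

lemma IsSection.mul {U : Opens M} {s s' : ∀ z : Z, Stalk M Z z}
    (hs : IsSection M Z U s) (hs' : IsSection M Z U s') :
    IsSection M Z U (fun z => s z * s' z) := by
  intro z hz
  obtain ⟨W, hzW, t, ht⟩ := hs z hz
  obtain ⟨W', hzW', t', ht'⟩ := hs' z hz
  refine ⟨W ⊓ W', ⟨hzW, hzW'⟩, M.presheaf.map (homOfLE inf_le_left).op t *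
      M.presheaf.map (homOfLE inf_le_right).op t', fun w hw hwU => ?_⟩
  rw [map_mul, TopCat.Presheaf.germ_res_apply, TopCat.Presheaf.germ_res_apply, map_mul,
    ← ht w hw.1 hwU, ← ht' w hw.2 hwU]

lemma IsUnitSection.mono {U V : Opens M} (h : U ≤ V) {s : ∀ z : Z, (Stalk M Z z)ˣ}
    (hs : IsUnitSection M Z V s) : IsUnitSection M Z U s :=
  ⟨hs.1.mono h, hs.2.mono h⟩

lemma IsUnitSection.one (U : Opens M) : IsUnitSection M Z U (fun _ => 1) :=
  ⟨by simpa using IsSection.one U, by simpa using IsSection.one U⟩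

lemma IsUnitSection.mul {U : Opens M} {s s' : ∀ z : Z, (Stalk M Z z)ˣ}
    (hs : IsUnitSection M Z U s) (hs' : IsUnitSection M Z U s') :
    IsUnitSection M Z U (fun z => s z * s' z) :=
  ⟨by simpa using hs.1.mul hs'.1, by simpa [mul_comm] using hs.2.mul hs'.2⟩

lemma IsUnitSection.inv {U : Opens M} {s : ∀ z : Z, (Stalk M Z z)ˣ}
    (hs : IsUnitSection M Z U s) : IsUnitSection M Z U (fun z => (s z)⁻¹) :=
  ⟨hs.2, by simpa using hs.1⟩

variable (M Z)

/-- A line bundle on `Z` given by transition functions: a neighbourhood `U x` of every point `x` of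
`Z`, and functions `u x y ∈ 𝒪_Z^×(U x ∩ U y)` with `u x y * u y w = u x w`. (The values of `u x y`
outside `U x ∩ U y` play no role.) The local frames `e x` of the line bundle are related by
`e x = u x y * e y`. -/
structure Cocycle where
  U : Z → Opens M
  mem : ∀ x : Z, x.1 ∈ U x
  u : Z → Z → ∀ z : Z, (Stalk M Z z)ˣ
  isUnitSection : ∀ x y, IsUnitSection M Z (U x ⊓ U y) (u x y)
  cocycle : ∀ x y w z : Z, z.1 ∈ U x → z.1 ∈ U y → z.1 ∈ U w → u x y z * u y w z = u x w z

variable {M Z}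

/-- Isomorphism of line bundles given by transition functions, on a common refinement of the
coverings. -/
def Cocycle.Iso (c c' : Cocycle M Z) : Prop :=
  ∃ (W : Z → Opens M) (l : Z → ∀ z : Z, (Stalk M Z z)ˣ),
    (∀ x : Z, x.1 ∈ W x ∧ W x ≤ c.U x ∧ W x ≤ c'.U x ∧ IsUnitSection M Z (W x) (l x)) ∧
    ∀ x y z : Z, z.1 ∈ W x → z.1 ∈ W y → l x z * c.u x y z = c'.u x y z * l y z

variable (M Z)

instance Cocycle.setoid : Setoid (Cocycle M Z) where
  r := Cocycle.Iso
  iseqv :=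
    { refl := fun c => ⟨c.U, fun _ _ => 1,
        fun x => ⟨c.mem x, le_rfl, le_rfl, IsUnitSection.one _⟩, by simp⟩
      symm := by
        rintro c c' ⟨W, l, h, e⟩
        refine ⟨W, fun x z => (l x z)⁻¹,
          fun x => ⟨(h x).1, (h x).2.2.1, (h x).2.1, (h x).2.2.2.inv⟩, ?_⟩
        intro x y z hx hy
        have := e x y z hx hy
        rw [inv_mul_eq_iff_eq_mul, ← mul_assoc, this, mul_assoc, mul_inv_cancel, mul_one]
      trans := by
        rintro c c' c'' ⟨W, l, h, e⟩ ⟨W', l', h', e'⟩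
        refine ⟨fun x => W x ⊓ W' x, fun x z => l' x z * l x z, fun x =>
          ⟨⟨(h x).1, (h' x).1⟩, inf_le_left.trans (h x).2.1, inf_le_right.trans (h' x).2.2.1,
            ((h' x).2.2.2.mono inf_le_right).mul ((h x).2.2.2.mono inf_le_left)⟩, ?_⟩
        intro x y z hx hy
        rw [mul_assoc, e x y z hx.1 hy.1, ← mul_assoc, e' x y z hx.2 hy.2, mul_assoc] }

/-- The Picard group of `Z`: isomorphism classes of line bundles on `Z`, written additively. -/
def Pic : Type u := Quotient (Cocycle.setoid M Z)

variable {M Z}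

/-- The trivial line bundle. -/
def Cocycle.one : Cocycle M Z where
  U _ := ⊤
  mem _ := trivial
  u _ _ _ := 1
  isUnitSection _ _ := IsUnitSection.one _
  cocycle _ _ _ _ _ _ _ := by simp

/-- The tensor product of line bundles. -/
def Cocycle.mul (c c' : Cocycle M Z) : Cocycle M Z where
  U x := c.U x ⊓ c'.U x
  mem x := ⟨c.mem x, c'.mem x⟩
  u x y z := c.u x y z * c'.u x y z
  isUnitSection x y :=
    ((c.isUnitSection x y).mono (inf_le_inf inf_le_left inf_le_left)).mul
      ((c'.isUnitSection x y).mono (inf_le_inf inf_le_right inf_le_right))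
  cocycle x y w z hx hy hw := by
    rw [← c.cocycle x y w z hx.1 hy.1 hw.1, ← c'.cocycle x y w z hx.2 hy.2 hw.2]
    exact mul_mul_mul_comm _ _ _ _

/-- The dual line bundle. -/
def Cocycle.inv (c : Cocycle M Z) : Cocycle M Z where
  U := c.U
  mem := c.mem
  u x y z := (c.u x y z)⁻¹
  isUnitSection x y := (c.isUnitSection x y).inv
  cocycle x y w z hx hy hw := by
    rw [← c.cocycle x y w z hx hy hw, mul_inv]

lemma Cocycle.iso_of_eq (c c' : Cocycle M Z)
    (h : ∀ x y z : Z, z.1 ∈ c.U x → z.1 ∈ c.U y → z.1 ∈ c'.U x → z.1 ∈ c'.U y →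
      c.u x y z = c'.u x y z) : Cocycle.Iso c c' :=
  ⟨fun x => c.U x ⊓ c'.U x, fun _ _ => 1, fun x => ⟨⟨c.mem x, c'.mem x⟩, inf_le_left,
    inf_le_right, IsUnitSection.one _⟩,
    fun x y z hx hy => by rw [one_mul, mul_one, h x y z hx.1 hy.1 hx.2 hy.2]⟩

instance Pic.zero : Zero (Pic M Z) := ⟨Quotient.mk _ Cocycle.one⟩

instance Pic.add : Add (Pic M Z) where
  add := Quotient.map₂ Cocycle.mul (by
    rintro a a' ⟨W, l, h, e⟩ b b' ⟨W', l', h', e'⟩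
    refine ⟨fun x => W x ⊓ W' x, fun x z => l x z * l' x z, fun x =>
      ⟨⟨(h x).1, (h' x).1⟩, inf_le_inf (h x).2.1 (h' x).2.1, inf_le_inf (h x).2.2.1 (h' x).2.2.1,
        ((h x).2.2.2.mono inf_le_left).mul ((h' x).2.2.2.mono inf_le_right)⟩, ?_⟩
    intro x y z hx hy
    change l x z * l' x z * (a.u x y z * b.u x y z) = a'.u x y z * b'.u x y z * (l y z * l' y z)
    rw [mul_mul_mul_comm, e x y z hx.1 hy.1, e' x y z hx.2 hy.2, mul_mul_mul_comm])

instance Pic.neg : Neg (Pic M Z) where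
  neg := Quotient.map Cocycle.inv (by
    rintro a a' ⟨W, l, h, e⟩
    refine ⟨W, fun x z => (l x z)⁻¹, fun x =>
      ⟨(h x).1, (h x).2.1, (h x).2.2.1, (h x).2.2.2.inv⟩, ?_⟩
    intro x y z hx hy
    have := e x y z hx hy
    change (l x z)⁻¹ * (a.u x y z)⁻¹ = (a'.u x y z)⁻¹ * (l y z)⁻¹
    rw [← mul_inv, this, mul_inv])

instance Pic.addCommGroup : AddCommGroup (Pic M Z) where
  nsmul := nsmulRec
  zsmul := zsmulRec
  add_assoc := by
    rintro ⟨a⟩ ⟨b⟩ ⟨c⟩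
    exact Quotient.sound (Cocycle.iso_of_eq _ _ fun x y z _ _ _ _ => mul_assoc _ _ _)
  zero_add := by
    rintro ⟨a⟩
    exact Quotient.sound (Cocycle.iso_of_eq _ _ fun x y z _ _ _ _ => one_mul _)
  add_zero := by
    rintro ⟨a⟩
    exact Quotient.sound (Cocycle.iso_of_eq _ _ fun x y z _ _ _ _ => mul_one _)
  neg_add_cancel := by
    rintro ⟨a⟩
    exact Quotient.sound (Cocycle.iso_of_eq _ _ fun x y z _ _ _ _ => inv_mul_cancel _)
  add_comm := by
    rintro ⟨a⟩ ⟨b⟩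
    exact Quotient.sound (Cocycle.iso_of_eq _ _ fun x y z _ _ _ _ => mul_comm _ _)

variable (M Z)

/-- A line bundle on `Z` presented by its local frames (its `𝒪_Z^×`-torsor of frames): the germs of
frames at the points of `Z`, the ratio `e / e' ∈ 𝒪_{Z,z}^×` of two germs of frames, and
the families of germs that form a frame over `Z ∩ U`. -/
structure FrameBundle where
  Frame : Z → Type u
  ratio : ∀ z : Z, Frame z → Frame z → (Stalk M Z z)ˣ
  ratio_mul : ∀ z (a b c : Frame z), ratio z a b * ratio z b c = ratio z a c
  IsFrame : ∀ U : Opens M, (∀ z : Z, z.1 ∈ U → Frame z) → Prop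
  isSection_ratio : ∀ (U V : Opens M) (φ ψ), IsFrame U φ → IsFrame V ψ →
    ∀ s : ∀ z : Z, (Stalk M Z z)ˣ,
      (∀ (z : Z) (hU : z.1 ∈ U) (hV : z.1 ∈ V), s z = ratio z (φ z hU) (ψ z hV)) →
        IsSection M Z (U ⊓ V) (fun z => (s z : Stalk M Z z))
  exists_frame : ∀ x : Z, ∃ U : Opens M, x.1 ∈ U ∧ ∃ φ, IsFrame U φ

variable {M Z}

/-- The extension by `1` of the ratio of two local frames. -/
def FrameBundle.ratioExt (L : FrameBundle M Z) {U V : Opens M}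
    (φ : ∀ z : Z, z.1 ∈ U → L.Frame z) (ψ : ∀ z : Z, z.1 ∈ V → L.Frame z) (z : Z) :
    (Stalk M Z z)ˣ :=
  open Classical in
  if h : z.1 ∈ U ∧ z.1 ∈ V then L.ratio z (φ z h.1) (ψ z h.2) else 1

lemma FrameBundle.ratioExt_eq (L : FrameBundle M Z) {U V : Opens M}
    (φ : ∀ z : Z, z.1 ∈ U → L.Frame z) (ψ : ∀ z : Z, z.1 ∈ V → L.Frame z) (z : Z)
    (hU : z.1 ∈ U) (hV : z.1 ∈ V) : L.ratioExt φ ψ z = L.ratio z (φ z hU) (ψ z hV) := by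
  rw [FrameBundle.ratioExt, dif_pos ⟨hU, hV⟩]

lemma FrameBundle.ratio_inv (L : FrameBundle M Z) (z : Z) (a b : L.Frame z) :
    (L.ratio z a b)⁻¹ = L.ratio z b a := by
  have h1 : L.ratio z b b = 1 := by simpa using L.ratio_mul z b b b
  have h2 := L.ratio_mul z b a b
  rw [h1] at h2
  exact inv_eq_of_mul_eq_one_left h2

lemma FrameBundle.isUnitSection_ratioExt (L : FrameBundle M Z) {U V : Opens M}
    {φ : ∀ z : Z, z.1 ∈ U → L.Frame z} {ψ : ∀ z : Z, z.1 ∈ V → L.Frame z}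
    (hφ : L.IsFrame U φ) (hψ : L.IsFrame V ψ) :
    IsUnitSection M Z (U ⊓ V) (L.ratioExt φ ψ) := by
  refine ⟨L.isSection_ratio U V φ ψ hφ hψ _ fun z hU hV => L.ratioExt_eq φ ψ z hU hV, ?_⟩
  refine (L.isSection_ratio V U ψ φ hψ hφ _ fun z hV hU => ?_).mono (le_of_eq (inf_comm _ _))
  rw [L.ratioExt_eq φ ψ z hU hV, L.ratio_inv]

/-- The transition functions `φ x / φ y` of a system of local frames. -/
def FrameBundle.cocycle (L : FrameBundle M Z) (U : Z → Opens M) (mem : ∀ x : Z, x.1 ∈ U x)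
    (φ : ∀ x z : Z, z.1 ∈ U x → L.Frame z) (hφ : ∀ x, L.IsFrame (U x) (φ x)) : Cocycle M Z where
  U := U
  mem := mem
  u x y := L.ratioExt (φ x) (φ y)
  isUnitSection x y := L.isUnitSection_ratioExt (hφ x) (hφ y)
  cocycle x y w z hx hy hw := by
    rw [L.ratioExt_eq _ _ z hx hy, L.ratioExt_eq _ _ z hy hw, L.ratioExt_eq _ _ z hx hw,
      L.ratio_mul]

/-- The class of a line bundle in the Picard group. -/
def FrameBundle.toPic (L : FrameBundle M Z) : Pic M Z :=
  Quotient.mk _ (L.cocycle (fun x => (L.exists_frame x).choose)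
    (fun x => (L.exists_frame x).choose_spec.1)
    (fun x => (L.exists_frame x).choose_spec.2.choose)
    (fun x => (L.exists_frame x).choose_spec.2.choose_spec))

/-- The class does not depend on the chosen local frames. -/
lemma FrameBundle.toPic_eq (L : FrameBundle M Z) (U : Z → Opens M) (mem : ∀ x : Z, x.1 ∈ U x)
    (φ : ∀ x z : Z, z.1 ∈ U x → L.Frame z) (hφ : ∀ x, L.IsFrame (U x) (φ x)) :
    L.toPic = Quotient.mk _ (L.cocycle U mem φ hφ) := by
  refine Quotient.sound ⟨fun x => U x ⊓ (L.exists_frame x).choose,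
    fun x => L.ratioExt (φ x) (L.exists_frame x).choose_spec.2.choose,
    fun x => ⟨⟨mem x, (L.exists_frame x).choose_spec.1⟩, inf_le_right, inf_le_left,
      L.isUnitSection_ratioExt (hφ x) (L.exists_frame x).choose_spec.2.choose_spec⟩, ?_⟩
  intro x y z hx hy
  change L.ratioExt _ _ z * L.ratioExt _ _ z = L.ratioExt _ _ z * L.ratioExt _ _ z
  rw [L.ratioExt_eq _ _ z hx.1 hx.2, L.ratioExt_eq _ _ z hx.2 hy.2, L.ratioExt_eq _ _ z hx.1 hy.1,
    L.ratioExt_eq _ _ z hy.1 hy.2, L.ratio_mul, L.ratio_mul]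

end Picard

/-! ### Algebra of local generators -/

section Generators

variable {R : Type v} [CommRing R]

lemma exists_unit_ratio {a b : R} (ha : a ∈ nonZeroDivisors R)
    (h : Ideal.span {a} = Ideal.span {b}) : ∃ u : Rˣ, a = u * b := by
  obtain ⟨c, hc⟩ := Ideal.mem_span_singleton'.1 (h ▸ Ideal.mem_span_singleton_self a)
  obtain ⟨d, hd⟩ := Ideal.mem_span_singleton'.1 (h.symm ▸ Ideal.mem_span_singleton_self b)
  have h1 : c * d = 1 := by
    have : (c * d - 1) * a = 0 := by
      rw [sub_mul, mul_assoc, hd, hc, one_mul, sub_self]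
    exact sub_eq_zero.1 ((mem_nonZeroDivisors_iff.1 ha).2 _ this)
  exact ⟨Units.mkOfMulEqOne c d h1, hc.symm⟩

lemma eq_of_mul_eq {a u v : R} (ha : a ∈ nonZeroDivisors R) (h : u * a = v * a) : u = v := by
  have : (u - v) * a = 0 := by rw [sub_mul, h, sub_self]
  exact sub_eq_zero.1 ((mem_nonZeroDivisors_iff.1 ha).2 _ this)

lemma mem_span_of_relation {k : ℕ} {g : Fin k → R}
    (hg : RingTheory.Sequence.IsWeaklyRegular R (List.ofFn g)) {c : Fin k → R}
    (hc : ∑ i, c i * g i = 0) (i : Fin k) : c i ∈ Ideal.span (Set.range g) := by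
  induction k with
  | zero => exact i.elim0
  | succ n ih =>
    set J := Ideal.span (Set.range fun j : Fin n => g j.castSucc) with hJ
    have hlist : Ideal.ofList (List.ofFn fun j : Fin n => g j.castSucc) = J := by
      rw [hJ, Ideal.ofList]
      congr 1
      ext r
      simp [List.mem_ofFn]
    rw [List.ofFn_succ_last, RingTheory.Sequence.isWeaklyRegular_append_iff,
      RingTheory.Sequence.isWeaklyRegular_singleton_iff, hlist, smul_eq_mul, Ideal.mul_top] at hg
    have hJle : J ≤ Ideal.span (Set.range g) := Ideal.span_mono (by
      rintro _ ⟨j, rfl⟩; exact ⟨j.castSucc, rfl⟩)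
    rw [Fin.sum_univ_castSucc] at hc
    have hlast : c (Fin.last n) ∈ J := by
      refine mem_of_isSMulRegular_quotient_of_smul_mem hg.2 ?_
      rw [smul_eq_mul, mul_comm, ← neg_eq_of_add_eq_zero_right hc]
      exact J.neg_mem (Ideal.sum_mem _ fun j _ =>
        J.mul_mem_left _ (Ideal.subset_span ⟨j, rfl⟩))
    obtain ⟨b, hb⟩ := (Ideal.mem_span_range_iff_exists_fun).1 hlast
    have hrel : ∑ j : Fin n, (c j.castSucc + b j * g (Fin.last n)) * g j.castSucc = 0 := by
      rw [← hc, ← hb, Finset.sum_mul, ← Finset.sum_add_distrib]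
      exact Finset.sum_congr rfl fun j _ => by ring
    refine Fin.lastCases (hJle hlast) (fun j => ?_) i
    have h1 := hJle (ih hg.1 hrel j)
    have h2 : b j * g (Fin.last n) ∈ Ideal.span (Set.range g) :=
      Ideal.mul_mem_left _ _ (Ideal.subset_span ⟨_, rfl⟩)
    simpa using Ideal.sub_mem _ h1 h2

/-- The tuples `g` and `g'` are related by a matrix with determinant `a` modulo `I`. -/
def DetRel {k : ℕ} (I : Ideal R) (g g' : Fin k → R) (a : R ⧸ I) : Prop :=
  ∃ A : Matrix (Fin k) (Fin k) R, g = A.mulVec g' ∧ Ideal.Quotient.mk I A.det = a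

variable {k : ℕ} {I : Ideal R} {g g' g'' : Fin k → R}

lemma DetRel.refl : DetRel I g g 1 := ⟨1, by simp, by simp⟩

lemma DetRel.mul {a b : R ⧸ I} (h : DetRel I g g' a) (h' : DetRel I g' g'' b) :
    DetRel I g g'' (a * b) := by
  obtain ⟨A, rfl, rfl⟩ := h
  obtain ⟨B, rfl, rfl⟩ := h'
  exact ⟨A * B, by rw [Matrix.mulVec_mulVec], by rw [Matrix.det_mul, map_mul]⟩

lemma DetRel.unique (hI : Ideal.span (Set.range g') = I)
    (hg : RingTheory.Sequence.IsWeaklyRegular R (List.ofFn g')) {a b : R ⧸ I}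
    (h : DetRel I g g' a) (h' : DetRel I g g' b) : a = b := by
  obtain ⟨A, rfl, rfl⟩ := h
  obtain ⟨B, hB, rfl⟩ := h'
  rw [RingHom.map_det, RingHom.map_det]
  congr 1
  ext i j
  simp only [RingHom.mapMatrix_apply, Matrix.map_apply]
  rw [Ideal.Quotient.eq, ← hI]
  refine mem_span_of_relation hg (c := fun j => A i j - B i j) ?_ j
  have := congrFun hB i
  simp only [Matrix.mulVec, dotProduct] at this
  simp only [sub_mul, Finset.sum_sub_distrib, this, sub_self]

lemma DetRel.exists (hI : Ideal.span (Set.range g) = I) (hI' : Ideal.span (Set.range g') = I) :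
    ∃ a, DetRel I g g' a := by
  have : ∀ i, ∃ c : Fin k → R, ∑ j, c j * g' j = g i := fun i => by
    have : g i ∈ Ideal.span (Set.range g') := by
      rw [hI', ← hI]; exact Ideal.subset_span ⟨i, rfl⟩
    simpa using (Ideal.mem_span_range_iff_exists_fun).1 this
  choose A hA using this
  exact ⟨_, Matrix.of A, by ext i; simp [Matrix.mulVec, dotProduct, hA], rfl⟩

lemma DetRel.exists_unit (hI : Ideal.span (Set.range g) = I) (hI' : Ideal.span (Set.range g') = I)
    (hg : RingTheory.Sequence.IsWeaklyRegular R (List.ofFn g)) :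
    ∃ u : (R ⧸ I)ˣ, DetRel I g g' u := by
  obtain ⟨a, ha⟩ := DetRel.exists hI hI'
  obtain ⟨b, hb⟩ := DetRel.exists hI' hI
  exact ⟨Units.mkOfMulEqOne a b (DetRel.unique hI hg (ha.mul hb) DetRel.refl), ha⟩

end Generators

section Spread

variable {M : LocallyRingedSpace.{u}} {Z : Set M}

lemma germ_eq_near {U V : Opens M} {z : M} (hU : z ∈ U) (hV : z ∈ V) (s : M.presheaf.obj (op U))
    (t : M.presheaf.obj (op V)) (h : M.presheaf.germ U z hU s = M.presheaf.germ V z hV t) :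
    ∃ W : Opens M, z ∈ W ∧ ∀ (w : M) (_ : w ∈ W) (h1 : w ∈ U) (h2 : w ∈ V),
      M.presheaf.germ U w h1 s = M.presheaf.germ V w h2 t := by
  obtain ⟨W, hW, i, j, e⟩ := M.presheaf.germ_eq z hU hV s t h
  refine ⟨W, hW, fun w hw h1 h2 => ?_⟩
  rw [← TopCat.Presheaf.germ_res_apply M.presheaf i w hw,
    ← TopCat.Presheaf.germ_res_apply M.presheaf j w hw, e]

lemma mem_idealAt_near {U : Opens M} {z : M} (hU : z ∈ U) (s : M.presheaf.obj (op U))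
    (h : M.presheaf.germ U z hU s ∈ idealAt M Z z) :
    ∃ W : Opens M, z ∈ W ∧ ∀ (w : M) (_ : w ∈ W) (h1 : w ∈ U),
      M.presheaf.germ U w h1 s ∈ idealAt M Z w := by
  obtain ⟨V, hV, t, e, ht⟩ := h
  obtain ⟨W, hW, e'⟩ := germ_eq_near hV hU t s e
  exact ⟨W ⊓ V, Opens.mem_inf.2 ⟨hW, hV⟩, fun w hw h1 =>
    ⟨V, hw.2, t, e' w hw.1 hw.2 h1, ht⟩⟩

lemma mem_inf_univ {k : ℕ} {W : Fin k → Opens M} {z : M} (h : ∀ i, z ∈ W i) :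
    z ∈ Finset.univ.inf W := by
  have : z ∈ ((Finset.univ.inf W : Opens M) : Set M) := by
    rw [Opens.coe_finset_inf, Finset.inf_set_eq_iInter]
    simpa using h
  exact this

end Spread

/-! ### The line bundles `𝒪_M(X)|_Z`, `det N_{Z/M}` and `𝒪_Z(D)` -/

section Bundles

variable (M : LocallyRingedSpace.{u}) (Z : Set M)

/-- The restriction to `Z` of the ideal sheaf `I_X = 𝒪_M(-X)` of a hypersurface `X`: its frames are
the local equations of `X`. -/
def idealBundle (X : Set M) (hX : IsHypersurface M X) : FrameBundle M Z where
  Frame z := {f : M.presheaf.stalk z.1 // Ideal.span {f} = idealAt M X z ∧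
    f ∈ nonZeroDivisors (M.presheaf.stalk z.1)}
  ratio z a b := Units.map (Ideal.Quotient.mk (idealAt M Z z)).toMonoidHom
    (exists_unit_ratio a.2.2 (a.2.1.trans b.2.1.symm)).choose
  ratio_mul z a b c := by
    rw [← map_mul]
    congr 1
    ext
    have h1 := (exists_unit_ratio a.2.2 (a.2.1.trans b.2.1.symm)).choose_spec
    have h2 := (exists_unit_ratio b.2.2 (b.2.1.trans c.2.1.symm)).choose_spec
    have h3 := (exists_unit_ratio a.2.2 (a.2.1.trans c.2.1.symm)).choose_spec
    refine eq_of_mul_eq c.2.2 ?_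
    rw [← h3, Units.val_mul, mul_assoc, ← h2, ← h1]
  IsFrame U φ := ∃ f : M.presheaf.obj (op U), ∀ (z : Z) (hz : z.1 ∈ U),
    (φ z hz).1 = M.presheaf.germ U z.1 hz f
  isSection_ratio := by
    rintro U V φ ψ ⟨f, hf⟩ ⟨f', hf'⟩ s hs z ⟨hU, hV⟩
    have h1 := (exists_unit_ratio (φ z hU).2.2 ((φ z hU).2.1.trans (ψ z hV).2.1.symm)).choose_spec
    set u := (exists_unit_ratio (φ z hU).2.2 ((φ z hU).2.1.trans (ψ z hV).2.1.symm)).choose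
    obtain ⟨W, hW, t, ht⟩ := M.presheaf.exists_germ_eq (u : M.presheaf.stalk z.1)
    rw [hf, hf', ← ht] at h1
    have hWV : z.1 ∈ W ⊓ V := Opens.mem_inf.2 ⟨hW, hV⟩
    obtain ⟨N, hN, e⟩ := germ_eq_near hU hWV f (M.presheaf.map (homOfLE inf_le_left).op t *
      M.presheaf.map (homOfLE inf_le_right).op f') (by
        rw [map_mul, TopCat.Presheaf.germ_res_apply, TopCat.Presheaf.germ_res_apply, h1])
    refine ⟨N ⊓ W, Opens.mem_inf.2 ⟨hN, hW⟩, M.presheaf.map (homOfLE inf_le_right).op t,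
      fun w hw hwUV => ?_⟩
    change ((s w : (Stalk M Z w)ˣ) : Stalk M Z w) = _
    rw [hs w hwUV.1 hwUV.2, TopCat.Presheaf.germ_res_apply]
    have h2 := (exists_unit_ratio (φ w hwUV.1).2.2
      ((φ w hwUV.1).2.1.trans (ψ w hwUV.2).2.1.symm)).choose_spec
    change Ideal.Quotient.mk _ _ = _
    congr 1
    refine eq_of_mul_eq (ψ w hwUV.2).2.2 ?_
    have h3 := e w hw.1 hwUV.1 (Opens.mem_inf.2 ⟨hw.2, hwUV.2⟩)
    rw [map_mul, TopCat.Presheaf.germ_res_apply, TopCat.Presheaf.germ_res_apply, ← hf, ← hf'] at h3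
    exact h2.symm.trans h3
  exists_frame x := by
    obtain ⟨U, hU, f, hf⟩ := hX.2 x
    exact ⟨U, hU, fun z hz => ⟨M.presheaf.germ U z.1 hz f, hf z.1 hz⟩, f, fun z hz => rfl⟩

/-- The class `[X] ∈ Pic(Z)` of `𝒪_M(X)|_Z`, the dual of `𝒪_M(-X)|_Z`. -/
def hypersurfaceClass (X : Set M) (hX : IsHypersurface M X) : Pic M Z :=
  -(idealBundle M Z X hX).toPic

/-- The determinant of the conormal bundle `I_Z / I_Z²`: the frame `g 0 ∧ ⋯ ∧ g (k-1)` given by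
local generators `g` of `I_Z` is `det A` times the frame given by local generators `g'` if
`g = A g'`. -/
def conormalDetBundle (k : ℕ) (hZ : IsLCI M Z k) : FrameBundle M Z where
  Frame z := {g : Fin k → M.presheaf.stalk z.1 // Ideal.span (Set.range g) = idealAt M Z z ∧
    RingTheory.Sequence.IsWeaklyRegular (M.presheaf.stalk z.1) (List.ofFn g)}
  ratio z a b := (DetRel.exists_unit a.2.1 b.2.1 a.2.2).choose
  ratio_mul z a b c := by
    ext
    exact DetRel.unique c.2.1 c.2.2
      ((DetRel.exists_unit a.2.1 b.2.1 a.2.2).choose_spec.mul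
        (DetRel.exists_unit b.2.1 c.2.1 b.2.2).choose_spec)
      (DetRel.exists_unit a.2.1 c.2.1 a.2.2).choose_spec
  IsFrame U φ := ∃ g : Fin k → M.presheaf.obj (op U), ∀ (z : Z) (hz : z.1 ∈ U),
    (φ z hz).1 = fun i => M.presheaf.germ U z.1 hz (g i)
  isSection_ratio := by
    rintro U V φ ψ ⟨g, hg⟩ ⟨g', hg'⟩ s hs z ⟨hU, hV⟩
    obtain ⟨A, hA, -⟩ := (DetRel.exists_unit (φ z hU).2.1 (ψ z hV).2.1 (φ z hU).2.2).choose_spec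
    have hrep : ∀ i j, ∃ (W : Opens M) (hW : z.1 ∈ W) (t : M.presheaf.obj (op W)),
        M.presheaf.germ W z.1 hW t = A i j := fun i j => M.presheaf.exists_germ_eq (A i j)
    choose W₁ hW₁ t₁ ht₁ using hrep
    let W : Opens M := (Finset.univ.inf fun i => Finset.univ.inf fun j => W₁ i j) ⊓ V
    have hWle : ∀ i j, W ≤ W₁ i j := fun i j => inf_le_left.trans
      ((Finset.inf_le (Finset.mem_univ i)).trans (Finset.inf_le (Finset.mem_univ j)))
    have hWV : W ≤ V := inf_le_right
    have hW : z.1 ∈ W := by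
      exact Opens.mem_inf.2 ⟨mem_inf_univ fun i => mem_inf_univ fun j => hW₁ i j, hV⟩
    let t : Fin k → Fin k → M.presheaf.obj (op W) := fun i j => M.presheaf.map (homOfLE (hWle i j)).op (t₁ i j)
    have htA : ∀ i j, M.presheaf.germ W z.1 hW (t i j) = A i j := fun i j => by
      rw [← ht₁ i j]; exact TopCat.Presheaf.germ_res_apply _ _ _ _ _
    clear_value t
    have hnear : ∀ i, ∃ N : Opens M, z.1 ∈ N ∧ ∀ (w : M) (_ : w ∈ N) (h1 : w ∈ U) (h2 : w ∈ W),
        M.presheaf.germ U w h1 (g i) =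
          M.presheaf.germ W w h2 (∑ j, t i j * M.presheaf.map (homOfLE hWV).op (g' j)) := by
      intro i
      refine germ_eq_near hU hW _ _ ?_
      rw [hg, hg'] at hA
      refine (congrFun hA i).trans ?_
      change (∑ j, A i j * M.presheaf.germ V z.1 hV (g' j)) = _
      rw [map_sum]
      refine Finset.sum_congr rfl fun j _ => ?_
      rw [map_mul, TopCat.Presheaf.germ_res_apply, htA]
    choose N hN e using hnear
    have hNW : z.1 ∈ Finset.univ.inf N ⊓ W := Opens.mem_inf.2 ⟨mem_inf_univ hN, hW⟩
    refine ⟨Finset.univ.inf N ⊓ W, hNW, M.presheaf.map (homOfLE inf_le_right).op (Matrix.of t).det,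
      fun w hw hwUV => ?_⟩
    have hwN : ∀ i, w.1 ∈ N i := fun i => (Finset.inf_le (Finset.mem_univ i) : _ ≤ N i) hw.1
    change ((s w : (Stalk M Z w)ˣ) : Stalk M Z w) = _
    rw [hs w hwUV.1 hwUV.2, TopCat.Presheaf.germ_res_apply]
    refine DetRel.unique (ψ w hwUV.2).2.1 (ψ w hwUV.2).2.2 (DetRel.exists_unit (φ w hwUV.1).2.1
      (ψ w hwUV.2).2.1 (φ w hwUV.1).2.2).choose_spec
      ⟨(Matrix.of t).map (M.presheaf.germ W w.1 hw.2).hom, ?_, ?_⟩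
    · rw [hg, hg']
      ext i
      rw [e i w (hwN i) hwUV.1 hw.2, map_sum]
      refine Finset.sum_congr rfl fun j _ => ?_
      rw [map_mul, TopCat.Presheaf.germ_res_apply]
      rfl
    · exact congrArg _ (RingHom.map_det (M.presheaf.germ W w.1 hw.2).hom (Matrix.of t)).symm
  exists_frame x := by
    obtain ⟨U, hU, g, hg⟩ := hZ x x.2
    exact ⟨U, hU, fun z hz => ⟨fun i => M.presheaf.germ U z.1 hz (g i), (hg z.1 hz).1,
      (hg z.1 hz).2 z.2⟩, g, fun z hz => rfl⟩

/-- The class `[det N_{Z/M}] ∈ Pic(Z)` of the determinant of the normal bundle, the dual of the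
determinant of the conormal bundle. -/
def normalDetClass (k : ℕ) (hZ : IsLCI M Z k) : Pic M Z :=
  -(conormalDetBundle M Z k hZ).toPic

variable {M Z}

/-- The ideals `J z ⊆ 𝒪_{Z,z}` are the stalks of the ideal sheaf of an effective Cartier divisor on
`Z`: locally they are generated by one function, which is not a zero divisor. -/
def IsEffectiveCartier (J : ∀ z : Z, Ideal (Stalk M Z z)) : Prop :=
  ∀ x : Z, ∃ U : Opens M, x.1 ∈ U ∧ ∃ d : ∀ z : Z, Stalk M Z z, IsSection M Z U d ∧
    ∀ z : Z, z.1 ∈ U → Ideal.span {d z} = J z ∧ d z ∈ nonZeroDivisors (Stalk M Z z)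

/-- The ideal sheaf `𝒪_Z(-D)` of an effective Cartier divisor `D` on `Z`: its frames are the local
equations of `D`. -/
def divisorBundle (J : ∀ z : Z, Ideal (Stalk M Z z)) (hJ : IsEffectiveCartier J) :
    FrameBundle M Z where
  Frame z := {d : Stalk M Z z // Ideal.span {d} = J z ∧ d ∈ nonZeroDivisors (Stalk M Z z)}
  ratio z a b := (exists_unit_ratio a.2.2 (a.2.1.trans b.2.1.symm)).choose
  ratio_mul z a b c := by
    ext
    have h1 := (exists_unit_ratio a.2.2 (a.2.1.trans b.2.1.symm)).choose_spec
    have h2 := (exists_unit_ratio b.2.2 (b.2.1.trans c.2.1.symm)).choose_spec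
    have h3 := (exists_unit_ratio a.2.2 (a.2.1.trans c.2.1.symm)).choose_spec
    refine eq_of_mul_eq c.2.2 ?_
    rw [← h3, Units.val_mul, mul_assoc, ← h2, ← h1]
  IsFrame U φ := ∃ d : ∀ z : Z, Stalk M Z z, IsSection M Z U d ∧
    ∀ (z : Z) (hz : z.1 ∈ U), (φ z hz).1 = d z
  isSection_ratio := by
    rintro U V φ ψ ⟨d, hd, hφ⟩ ⟨d', hd', hψ⟩ s hs z ⟨hU, hV⟩
    have h1 := (exists_unit_ratio (φ z hU).2.2 ((φ z hU).2.1.trans (ψ z hV).2.1.symm)).choose_spec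
    set u := (exists_unit_ratio (φ z hU).2.2 ((φ z hU).2.1.trans (ψ z hV).2.1.symm)).choose
    obtain ⟨a, ha⟩ := Ideal.Quotient.mk_surjective (u : Stalk M Z z)
    obtain ⟨W, hW, t, ht⟩ := M.presheaf.exists_germ_eq a
    obtain ⟨A, hA, r, hr⟩ := hd z hU
    obtain ⟨B, hB, r', hr'⟩ := hd' z hV
    rw [hφ, hψ, hr z hA hU, hr' z hB hV, ← ha, ← ht, ← map_mul, Ideal.Quotient.eq] at h1
    let N : Opens M := A ⊓ (W ⊓ B)
    have hN : z.1 ∈ N := Opens.mem_inf.2 ⟨hA, Opens.mem_inf.2 ⟨hW, hB⟩⟩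
    have iA : N ≤ A := inf_le_left
    have iW : N ≤ W := inf_le_right.trans inf_le_left
    have iB : N ≤ B := inf_le_right.trans inf_le_right
    obtain ⟨P, hP, e⟩ := mem_idealAt_near (Z := Z) hN (M.presheaf.map (homOfLE iA).op r -
      M.presheaf.map (homOfLE iW).op t * M.presheaf.map (homOfLE iB).op r') (by
        rw [map_sub, map_mul, TopCat.Presheaf.germ_res_apply, TopCat.Presheaf.germ_res_apply,
          TopCat.Presheaf.germ_res_apply]
        exact h1)
    refine ⟨P ⊓ N, Opens.mem_inf.2 ⟨hP, hN⟩, M.presheaf.map (homOfLE (inf_le_right.trans iW)).op t,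
      fun w hw hwUV => ?_⟩
    change ((s w : (Stalk M Z w)ˣ) : Stalk M Z w) = _
    rw [hs w hwUV.1 hwUV.2, TopCat.Presheaf.germ_res_apply]
    have h2 := (exists_unit_ratio (φ w hwUV.1).2.2
      ((φ w hwUV.1).2.1.trans (ψ w hwUV.2).2.1.symm)).choose_spec
    refine eq_of_mul_eq (ψ w hwUV.2).2.2 (h2.symm.trans ?_)
    have h3 := e w hw.1 hw.2
    rw [map_sub, map_mul, TopCat.Presheaf.germ_res_apply, TopCat.Presheaf.germ_res_apply,
      TopCat.Presheaf.germ_res_apply, ← Ideal.Quotient.eq, map_mul, ← hr w (iA hw.2) hwUV.1,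
      ← hr' w (iB hw.2) hwUV.2, ← hφ, ← hψ] at h3
    exact h3
  exists_frame x := by
    obtain ⟨U, hU, d, hd, h⟩ := hJ x
    exact ⟨U, hU, fun z hz => ⟨d z, h z hz⟩, d, hd, fun z hz => rfl⟩

/-- The class `[D] ∈ Pic(Z)` of `𝒪_Z(D)`, for an effective Cartier divisor `D` on `Z`. -/
def divisorClass (J : ∀ z : Z, Ideal (Stalk M Z z)) (hJ : IsEffectiveCartier J) : Pic M Z :=
  -(divisorBundle J hJ).toPic

end Bundles

/-! ### The two kinds of ambient spaces -/

section Ambient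

/-- The constants `K → Γ(S, 𝒪_S)` of a scheme over a field `K`. -/
def schemeConst {K : Type u} [Field K] {S : Scheme.{u}} (s : S ⟶ Spec (.of K)) :
    K →+* S.toLocallyRingedSpace.presheaf.obj (op ⊤) :=
  ((Scheme.ΓSpecIso (.of K)).inv ≫ s.appTop).hom

/-- A complex manifold as a locally ringed space, with the sheaf of holomorphic (that is, complex
`C^∞`) functions. -/
abbrev manifoldSpace (E : Type v) [NormedAddCommGroup E] [NormedSpace ℂ E]
    (N : Type) [TopologicalSpace N] [ChartedSpace E N] : LocallyRingedSpace.{0} :=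
  ChartedSpace.locallyRingedSpace 𝓘(ℂ, E) N

/-- The constants `ℂ → Γ(N, 𝒪_N)` of a complex manifold. -/
def manifoldConst (E : Type v) [NormedAddCommGroup E] [NormedSpace ℂ E]
    (N : Type) [TopologicalSpace N] [ChartedSpace E N] :
    ℂ →+* (manifoldSpace E N).presheaf.obj (op ⊤) :=
  (ContMDiffMap.C : ℂ →+* C^∞⟮𝓘(ℂ, E), (⊤ : Opens N); 𝓘(ℂ, ℂ), ℂ⟯)

end Ambient

/-- The standing hypotheses: `X ⊆ M` is a hypersurface, `Z` is a connected component of its singular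
locus and a locally complete intersection of codimension `k`, the generic multiplicity of `X` along
`Z` is `p`, and the generic transversal type of `X` along `Z` is ordinary. -/
structure Setting (M : LocallyRingedSpace.{u}) (X Z : Set M) (k p : ℕ) : Prop where
  hypersurface : IsHypersurface M X
  component : ∃ z ∈ singularLocus M X, Z = connectedComponentIn (singularLocus M X) z
  lci : IsLCI M Z k
  multiplicity : Generically M Z fun x => HasMultiplicity M X x p
  ordinary : Generically M Z fun x => IsOrdinaryAt M X Z k p x

end TransDisc

end

noncomputable section

namespace TransDisc

open MvPolynomial

/-! ### Forms and linear substitutions -/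

section Forms

variable {R S : Type*} [CommRing R] [CommRing S] {k p : ℕ}

/-! Near a point of `Z` write `f = F(g)` with `F = ∑ a_m y^m`, and let `D` generate the ideal of the
classical discriminant. Then `Δ^⊥` has the local equation `D(a|_Z)`, and its class records how this
function depends on `f` and `g`. If `f = u f'` and `g = A g'`, quasi-regularity of `g'` gives `F ∘ A
≡ u F'` modulo `I_Z`. As `D` has degree `k (p-1)^(k-1)` and is a relative invariant of weight `p
(p-1)^(k-1)`, it follows on `Z` that `det A ^ (p (p-1)^(k-1)) * D(F) = u ^ (k (p-1)^(k-1)) * D(F')`.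
This relates the transition functions of `𝒪(-Δ^⊥)`, the conormal determinant and `𝒪(-X)|_Z`;
dualising gives the formula (`IsDiscriminant.compare`, `IsLocalExpansion.ratio_eq`,
`Setting.divisorBundle_toPic_add`).

Existence and degree of `D` are proved by elimination. Singular forms with a singular point in the
chart `y i₀ = 1` are parametrised by an affine space, so the discriminant ideal is the kernel of
`discParam`, hence prime. A nonzero element must involve the coefficient of `X i₀ ^ p`, because the
generic Hessian is invertible (`eq_zero_of_discParam_eq_zero`); with Gauss's lemma this makes the
ideal principal (`exists_isDiscriminant`).

For the weight, the torus acts on `D` by a character, and `D` does not vanish at the Fermat form, so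
the weight in the `i`-th variable is `p` times the exponent of the coefficient of `X i ^ p` in one
monomial of `D`. That exponent is at most `(p-1)^(k-1)` by a dimension count
(`exists_mem_discriminantIdeal`), and at least that by a family with `(p-1)^(k-1)` distinct critical
values (`IsDiscriminant.pow_le_natDegree`). Summing over the variables gives the degree. Diagonal
matrices and transvections then give the covariance under all matrices
(`IsDiscriminant.substAct_eq`), which becomes an identity over every `K`-algebra.

On `Z`, an expansion exists at every point and not only generically: by quasi-regularity the
coefficients of an expansion of too low a degree vanish generically on `Z`, hence on the reduced `Z`
(`idealAt_le_pow`). The discriminant is a unit at ordinary points, since `D` is nonzero at smooth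
forms over any extension field, and these points are dense, so `D(a|_Z)` is not a zero divisor. -/

instance Exponent.finite (k p : ℕ) : Finite (Exponent k p) := by
  have : ((Finset.univ : Finset (Fin k)).finsuppAntidiag p : Set (Fin k →₀ ℕ)) =
      {m | m.degree = p} := by
    ext m
    simp [Finset.mem_finsuppAntidiag, Finsupp.degree_eq_sum]
  have h : {m : Fin k →₀ ℕ | m.degree = p}.Finite := this ▸ Finset.finite_toSet _
  exact h.to_subtype

instance Exponent.fintype (k p : ℕ) : Fintype (Exponent k p) := Fintype.ofFinite _

/-- The form of degree `p` with given coefficients. -/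
def form (c : Exponent k p → R) : MvPolynomial (Fin k) R := ∑ m, monomial m.1 (c m)

lemma isHomogeneous_form (c : Exponent k p → R) : (form c).IsHomogeneous p :=
  IsHomogeneous.sum _ _ _ fun m _ => isHomogeneous_monomial _ m.2

@[simp]
lemma coeffs_form (c : Exponent k p → R) : coeffs p (form c) = c := by
  classical
  ext m
  simp only [coeffs, form, coeff_sum, coeff_monomial]
  simp [Subtype.val_inj]

lemma form_coeffs {F : MvPolynomial (Fin k) R} (hF : F.IsHomogeneous p) :
    form (coeffs p F) = F := by
  ext m
  by_cases hm : m.degree = p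
  · exact congrFun (coeffs_form (coeffs p F)) ⟨m, hm⟩
  · rw [hF.coeff_eq_zero hm, (isHomogeneous_form _).coeff_eq_zero hm]

lemma coeffs_injective {F G : MvPolynomial (Fin k) R} (hF : F.IsHomogeneous p)
    (hG : G.IsHomogeneous p) (h : coeffs p F = coeffs p G) : F = G := by
  rw [← form_coeffs hF, h, form_coeffs hG]

lemma coeffs_map (φ : R →+* S) (F : MvPolynomial (Fin k) R) (m : Exponent k p) :
    coeffs p (map φ F) m = φ (coeffs p F m) := coeff_map _ _ _

lemma map_form (φ : R →+* S) (c : Exponent k p → R) :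
    map φ (form c) = form fun m => φ (c m) := by
  simp [form]

/-- The linear substitution `F ↦ F ∘ A`. -/
def linSubst (A : Matrix (Fin k) (Fin k) R) :
    MvPolynomial (Fin k) R →ₐ[R] MvPolynomial (Fin k) R :=
  aeval fun i => ∑ j, C (A i j) * X j

lemma eval_linSubst (A : Matrix (Fin k) (Fin k) R) (F : MvPolynomial (Fin k) R) (y : Fin k → R) :
    eval y (linSubst A F) = eval (A.mulVec y) F := by
  change ((aeval y : _ →ₐ[R] R).comp (aeval fun i => ∑ j, C (A i j) * X j)) F =
    (aeval (A.mulVec y) : _ →ₐ[R] R) F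
  congr 1
  ext1 i
  simp [Matrix.mulVec, dotProduct]

lemma isHomogeneous_linSubst {F : MvPolynomial (Fin k) R} (hF : F.IsHomogeneous p)
    (A : Matrix (Fin k) (Fin k) R) : (linSubst A F).IsHomogeneous p := by
  have := hF.aeval (S := R) (n := 1) (fun i => ∑ j, C (A i j) * X j) fun i =>
    IsHomogeneous.sum _ _ _ fun j _ => isHomogeneous_C_mul_X _ _
  rwa [one_mul] at this

lemma linSubst_linSubst (A B : Matrix (Fin k) (Fin k) R) (F : MvPolynomial (Fin k) R) :
    linSubst A (linSubst B F) = linSubst (B * A) F := by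
  change ((linSubst A).comp (linSubst B)) F = _
  congr 1
  ext1 i
  simp only [linSubst, AlgHom.comp_apply, aeval_X, map_sum, map_mul, algHom_C, algebraMap_eq]
  simp only [Matrix.mul_apply, map_sum, map_mul, Finset.mul_sum, Finset.sum_mul]
  rw [Finset.sum_comm]
  simp only [mul_assoc]

lemma linSubst_one (F : MvPolynomial (Fin k) R) : linSubst 1 F = F := by
  have : linSubst (1 : Matrix (Fin k) (Fin k) R) = AlgHom.id R _ := by
    ext1 i
    simp [linSubst, Matrix.one_apply]
  rw [this]; rfl

lemma map_linSubst (φ : R →+* S) (A : Matrix (Fin k) (Fin k) R) (F : MvPolynomial (Fin k) R) :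
    map φ (linSubst A F) = linSubst (A.map φ) (map φ F) := by
  induction F using MvPolynomial.induction_on with
  | C a => simp [linSubst]
  | add F G hF hG => simp [hF, hG]
  | mul_X F i hF =>
    rw [map_mul, map_mul, hF, map_mul, map_mul, map_X]
    simp [linSubst]

/-- The index type is arbitrary because the lemma serves both for scaling the variables of a form
and for the induced scaling of its coefficients as variables of `D`. -/
lemma coeff_aeval_C_mul_X {σ : Type*} [Fintype σ] (b : σ → R) (F : MvPolynomial σ R)
    (m : σ →₀ ℕ) :
    coeff m (aeval (fun i => C (b i) * X i : σ → MvPolynomial σ R) F) =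
      (∏ i, b i ^ m i) * coeff m F := by
  classical
  induction F using MvPolynomial.induction_on' with
  | monomial n a =>
    rw [aeval_monomial]
    have : (n.prod fun i e => (C (b i) * X i : MvPolynomial σ R) ^ e) =
        monomial n (∏ i, b i ^ n i) := by
      rw [monomial_eq, Finsupp.prod_fintype _ _ (by simp), Finsupp.prod_fintype _ _ (by simp)]
      rw [map_prod, ← Finset.prod_mul_distrib]
      exact Finset.prod_congr rfl fun i _ => by rw [mul_pow, map_pow]
    rw [this, algebraMap_eq, C_mul_monomial, coeff_monomial, coeff_monomial]
    split_ifs with h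
    · rw [h, mul_comm]
    · simp
  | add F G hF hG => rw [map_add, coeff_add, hF, hG, coeff_add, mul_add]

lemma coeff_linSubst_diagonal (b : Fin k → R) (F : MvPolynomial (Fin k) R) (m : Fin k →₀ ℕ) :
    coeff m (linSubst (Matrix.diagonal b) F) = (∏ i, b i ^ m i) * coeff m F := by
  rw [← coeff_aeval_C_mul_X, linSubst]
  congr 3
  funext i
  rw [Finset.sum_eq_single i (fun j _ hj => by simp [Matrix.diagonal_apply_ne' _ hj])
    (by simp), Matrix.diagonal_apply_eq]

/-- The chain rule. -/
lemma derivation_aeval {σ : Type*} [Fintype σ] [Algebra R S] (d : Derivation R S S) (f : σ → S)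
    (F : MvPolynomial σ R) : d (aeval f F) = ∑ i, aeval f (pderiv i F) * d (f i) := by
  classical
  induction F using MvPolynomial.induction_on with
  | C a => simp
  | add F G hF hG => simp [hF, hG, add_mul, Finset.sum_add_distrib]
  | mul_X F i hF =>
    simp only [map_mul, aeval_X, Derivation.leibniz, hF, smul_eq_mul, pderiv_X, map_add,
      add_mul, Finset.sum_add_distrib, Finset.mul_sum]
    congr 1
    · rw [Finset.sum_eq_single i (fun j _ hj => by simp [hj.symm]) (by simp)]
      simp
    · exact Finset.sum_congr rfl fun j _ => by ring

lemma pderiv_linSubst (A : Matrix (Fin k) (Fin k) R) (F : MvPolynomial (Fin k) R) (j : Fin k) :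
    pderiv j (linSubst A F) = ∑ i, linSubst A (pderiv i F) * C (A i j) := by
  classical
  rw [linSubst, derivation_aeval]
  refine Finset.sum_congr rfl fun i _ => ?_
  congr 1
  simp [pderiv_X, Pi.single_apply, Finset.sum_ite_eq']

/-- The form `F` and its partial derivatives vanish at `y`. -/
def IsSingularAt (F : MvPolynomial (Fin k) R) (y : Fin k → R) : Prop :=
  eval y F = 0 ∧ ∀ i, eval y (pderiv i F) = 0

lemma IsSingularAt.linSubst {A : Matrix (Fin k) (Fin k) R} {F : MvPolynomial (Fin k) R}
    {y : Fin k → R} (h : IsSingularAt F (A.mulVec y)) : IsSingularAt (linSubst A F) y := by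
  refine ⟨by rw [eval_linSubst, h.1], fun j => ?_⟩
  rw [pderiv_linSubst, map_sum]
  refine Finset.sum_eq_zero fun i _ => ?_
  rw [map_mul, eval_linSubst, h.2 i, zero_mul]

lemma IsSingularAt.map {F : MvPolynomial (Fin k) R} {y : Fin k → R} (h : IsSingularAt F y)
    (φ : R →+* S) : IsSingularAt (map φ F) (fun i => φ (y i)) := by
  have key : ∀ G : MvPolynomial (Fin k) R, eval (fun i => φ (y i)) (MvPolynomial.map φ G) =
      φ (eval y G) := fun G => by
    rw [MvPolynomial.eval_map]
    exact (eval₂_comp φ y G).symm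
  refine ⟨by rw [key, h.1, map_zero], fun i => by rw [pderiv_map, key, h.2, map_zero]⟩

/-- Over an algebraically closed field the passage to `AlgebraicClosure K` adds no new points. -/
lemma not_isSmoothForm_iff {K : Type*} [Field K] [IsAlgClosed K] {F : MvPolynomial (Fin k) K} :
    ¬ IsSmoothForm F ↔ ∃ y : Fin k → K, y ≠ 0 ∧ IsSingularAt F y := by
  have key : ∀ (y : Fin k → K) (G : MvPolynomial (Fin k) K),
      aeval (fun i => algebraMap K (AlgebraicClosure K) (y i)) G = 0 ↔ eval y G = 0 := fun y G => by
    rw [← map_eq_zero (algebraMap K (AlgebraicClosure K)), eval₂_comp]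
    rfl
  have hz : ∀ y : Fin k → K, (fun i => algebraMap K (AlgebraicClosure K) (y i)) = 0 ↔ y = 0 :=
    fun y => by simp [_root_.funext_iff]
  simp only [IsSmoothForm, IsSingularAt, not_forall, not_not, exists_prop]
  constructor
  · rintro ⟨y, hy, h⟩
    choose z hz' using fun i =>
      (IsAlgClosed.algebraMap_bijective_of_isIntegral (k := K) (K := AlgebraicClosure K)).2 (y i)
    obtain rfl : (fun i => algebraMap K (AlgebraicClosure K) (z i)) = y := funext hz'
    rw [Ne, hz] at hy
    simp only [key] at h
    exact ⟨z, hy, h⟩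
  · rintro ⟨y, hy, h⟩
    refine ⟨fun i => algebraMap K (AlgebraicClosure K) (y i), by rwa [Ne, hz], ?_⟩
    simpa only [key] using h

lemma mem_discriminantIdeal_iff {K : Type*} [Field K] [IsAlgClosed K]
    {D : MvPolynomial (Exponent k p) K} :
    D ∈ discriminantIdeal K k p ↔ ∀ F : MvPolynomial (Fin k) K, F.IsHomogeneous p →
      ∀ y : Fin k → K, y ≠ 0 → IsSingularAt F y → eval (coeffs p F) D = 0 := by
  rw [discriminantIdeal, mem_vanishingIdeal_iff]
  constructor
  · intro h F hF y hy hs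
    exact h _ ⟨F, ⟨hF, not_isSmoothForm_iff.2 ⟨y, hy, hs⟩⟩, rfl⟩
  · rintro h _ ⟨F, ⟨hF, hs⟩, rfl⟩
    obtain ⟨y, hy, hs⟩ := not_isSmoothForm_iff.1 hs
    exact h F hF y hy hs

end Forms

/-! ### The parametrisation of the classical discriminant -/

section Parametrisation

variable {R S : Type*} [CommRing R] [CommRing S] {k p : ℕ}

/-- The form which differs from `F` only in the coefficients of `X i₀ ^ (p - 1) * X j`, and is
singular at the point `y` (with `y i₀ = 1`). -/
def singularize (i₀ : Fin k) (p : ℕ) (y : Fin k → R) (F : MvPolynomial (Fin k) R) :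
    MvPolynomial (Fin k) R :=
  F - C (eval y F) * X i₀ ^ p -
    ∑ j, C (eval y (pderiv j F)) * ((X j - C (y j) * X i₀) * X i₀ ^ (p - 1))

lemma isHomogeneous_singularize {F : MvPolynomial (Fin k) R} (hF : F.IsHomogeneous p) (hp : 1 ≤ p)
    (i₀ : Fin k) (y : Fin k → R) : (singularize i₀ p y F).IsHomogeneous p := by
  refine (hF.sub (isHomogeneous_C_mul_X_pow _ _ _)).sub (IsHomogeneous.sum _ _ _ fun j _ => ?_)
  refine IsHomogeneous.C_mul ?_ _
  have := ((isHomogeneous_X R j).sub (isHomogeneous_C_mul_X (y j) i₀)).mul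
    (isHomogeneous_X_pow (R := R) i₀ (p - 1))
  rwa [Nat.add_sub_cancel' hp] at this

lemma sum_mul_eval_pderiv {F : MvPolynomial (Fin k) R} (hF : F.IsHomogeneous p) (y : Fin k → R) :
    ∑ j, y j * eval y (pderiv j F) = p * eval y F := by
  have := congrArg (eval y) hF.sum_X_mul_pderiv
  simpa using this

/-- In the chart `X i₀ = 1`, `singularize` subtracts the first-order Taylor polynomial at `y`. The
derivative in the remaining direction `i₀` then vanishes by Euler's formula. -/
lemma isSingularAt_singularize {F : MvPolynomial (Fin k) R} (hF : F.IsHomogeneous p) {i₀ : Fin k}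
    {y : Fin k → R} (hy : y i₀ = 1) : IsSingularAt (singularize i₀ p y F) y := by
  classical
  refine ⟨by simp [singularize, hy], fun i => ?_⟩
  have h := sum_mul_eval_pderiv hF y
  simp only [singularize, map_sub, map_sum, pderiv_mul, pderiv_C, Derivation.leibniz_pow,
    pderiv_X, map_mul, map_add, eval_C, eval_X, map_pow, hy, one_pow, smul_eq_mul, mul_one,
    sub_self, zero_mul, add_zero, nsmul_eq_mul, map_natCast]
  simp only [mul_sub, Pi.single_apply, apply_ite (eval y), map_one,
    map_zero, mul_ite, mul_one, mul_zero]
  by_cases hi : i₀ = i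
  · subst hi
    simp only [zero_add, if_true, Finset.sum_sub_distrib, Finset.sum_ite_eq', Finset.mem_univ]
    rw [mul_comm _ (p : R), ← h]
    simp only [mul_comm]
    ring
  · simp [hi]

/-- The summand `j = i₀` contains the factor `X i₀ - C (y i₀) * X i₀ = 0`, so the derivative in
direction `i₀` plays no role. -/
lemma singularize_eq_self {F : MvPolynomial (Fin k) R} {i₀ : Fin k} {y : Fin k → R}
    (hy : y i₀ = 1) (h : eval y F = 0) (h' : ∀ j, j ≠ i₀ → eval y (pderiv j F) = 0) :
    singularize i₀ p y F = F := by
  rw [singularize, h, map_zero, zero_mul, sub_zero, Finset.sum_eq_zero, sub_zero]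
  intro j _
  by_cases hj : j = i₀
  · simp [hj, hy]
  · rw [h' j hj, map_zero, zero_mul]

lemma map_singularize (φ : R →+* S) (i₀ : Fin k) (y : Fin k → R) (F : MvPolynomial (Fin k) R) :
    map φ (singularize i₀ p y F) = singularize i₀ p (fun i => φ (y i)) (map φ F) := by
  have key : ∀ G : MvPolynomial (Fin k) R, φ (eval y G) =
      eval (fun i => φ (y i)) (MvPolynomial.map φ G) := fun G => by
    rw [MvPolynomial.eval_map]
    exact eval₂_comp φ y G
  simp only [singularize, map_sub, map_sum, map_mul, map_C, map_pow, map_X, key, pderiv_map]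

lemma linSubst_diagonal_const {F : MvPolynomial (Fin k) R} (hF : F.IsHomogeneous p)
    (a : R) : linSubst (Matrix.diagonal fun _ => a) F = C (a ^ p) * F := by
  ext m
  rw [coeff_linSubst_diagonal, coeff_C_mul]
  by_cases hm : m.degree = p
  · rw [Finset.prod_pow_eq_pow_sum, ← Finsupp.degree_eq_sum, hm]
  · rw [hF.coeff_eq_zero hm, mul_zero, mul_zero]

lemma eval_smul_of_isHomogeneous {F : MvPolynomial (Fin k) R} (hF : F.IsHomogeneous p)
    (a : R) (y : Fin k → R) : eval (a • y) F = a ^ p * eval y F := by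
  have h := eval_linSubst (Matrix.diagonal fun _ => a) F y
  rw [linSubst_diagonal_const hF, map_mul, eval_C] at h
  rw [h]
  congr 2
  funext i
  simp [Matrix.mulVec_diagonal]

lemma IsSingularAt.smul {F : MvPolynomial (Fin k) R} (hF : F.IsHomogeneous p)
    {y : Fin k → R} (h : IsSingularAt F y) (a : R) : IsSingularAt F (a • y) := by
  refine ⟨by rw [eval_smul_of_isHomogeneous hF, h.1, mul_zero], fun i => ?_⟩
  rw [eval_smul_of_isHomogeneous hF.pderiv, h.2, mul_zero]

lemma transvection_mulVec (i j : Fin k) (c : R) (y : Fin k → R) :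
    (Matrix.transvection i j c).mulVec y = y + Pi.single i (c * y j) := by
  rw [Matrix.transvection, Matrix.add_mulVec, Matrix.one_mulVec, Matrix.single_mulVec]
  rfl

lemma transvection_map (φ : R →+* S) (i j : Fin k) (c : R) :
    (Matrix.transvection i j c).map φ = Matrix.transvection i j (φ c) := by
  rw [Matrix.transvection, Matrix.map_add _ (map_add φ), Matrix.map_one _ (map_zero φ) (map_one φ),
    Matrix.map_single]
  rfl

variable {K : Type v} [Field K]

lemma algHom_aeval_coeffs [Algebra K R] [Algebra K S] (φ : R →ₐ[K] S)
    (F : MvPolynomial (Fin k) R) (D : MvPolynomial (Exponent k p) K) :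
    φ (aeval (coeffs p F) D) = aeval (coeffs p (map (φ : R →+* S) F)) D := by
  rw [← AlgHom.comp_apply, comp_aeval]
  congr 2

/-- One chart suffices. If the singular point lies on `y i₀ = 0` and `y j ≠ 0`, the shear with
parameter `c ≠ 0` moves it into the chart; the value of `D` on the sheared form is a polynomial in
`c` that vanishes for all `c ≠ 0`, hence also at `c = 0`. -/
lemma mem_discriminantIdeal_iff_chart [IsAlgClosed K] (i₀ : Fin k)
    {D : MvPolynomial (Exponent k p) K} :
    D ∈ discriminantIdeal K k p ↔ ∀ F : MvPolynomial (Fin k) K, F.IsHomogeneous p →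
      ∀ y : Fin k → K, y i₀ = 1 → IsSingularAt F y → eval (coeffs p F) D = 0 := by
  rw [mem_discriminantIdeal_iff]
  refine ⟨fun h F hF y hy => h F hF y fun h0 => by simp [h0] at hy, fun h F hF y hy hs => ?_⟩
  have h1 : ∀ F : MvPolynomial (Fin k) K, F.IsHomogeneous p →
      ∀ y : Fin k → K, y i₀ ≠ 0 → IsSingularAt F y → eval (coeffs p F) D = 0 :=
    fun F hF y hy hs => h F hF ((y i₀)⁻¹ • y) (by simp [hy]) (hs.smul hF _)
  by_cases hy0 : y i₀ = 0
  swap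
  · exact h1 F hF y hy0 hs
  obtain ⟨j, hj⟩ := Function.ne_iff.1 hy
  have hj0 : j ≠ i₀ := by rintro rfl; exact hj hy0
  set q : Polynomial K := aeval (coeffs p (linSubst (Matrix.transvection i₀ j Polynomial.X)
    (map Polynomial.C F))) D with hq
  have hev : ∀ c : K, q.eval c = eval (coeffs p (linSubst (Matrix.transvection i₀ j c) F)) D := by
    intro c
    have := algHom_aeval_coeffs (Polynomial.aeval c : Polynomial K →ₐ[K] K)
      (linSubst (Matrix.transvection i₀ j Polynomial.X) (map Polynomial.C F)) D
    rw [← hq, map_linSubst, MvPolynomial.map_map] at this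
    have e1 : (Matrix.transvection i₀ j (Polynomial.X : Polynomial K)).map
        ((Polynomial.aeval c : Polynomial K →ₐ[K] K) : Polynomial K →+* K) =
        Matrix.transvection i₀ j c := by
      rw [transvection_map]
      simp
    have e2 : ((Polynomial.aeval c : Polynomial K →ₐ[K] K) : Polynomial K →+* K).comp
        Polynomial.C = RingHom.id K := by
      ext; simp
    rw [e1, e2, MvPolynomial.map_id] at this
    exact this
  have hzero : q = 0 := by
    refine Polynomial.eq_zero_of_infinite_isRoot q (Set.Infinite.mono (s := {0}ᶜ) ?_
      (Set.Finite.infinite_compl (Set.finite_singleton 0)))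
    intro c hc
    have hc : c ≠ 0 := hc
    rw [Set.mem_ofPred_eq, Polynomial.IsRoot.def, hev]
    refine h1 _ (isHomogeneous_linSubst hF _) (y + Pi.single i₀ (-c * y j)) ?_
      (IsSingularAt.linSubst ?_)
    · simpa [hy0] using ⟨hc, hj⟩
    · rw [transvection_mulVec]
      convert hs using 1
      funext i
      by_cases hi : i = i₀
      · subst hi; simp [hj0]
      · simp [hi]
  have := hev 0
  rw [hzero, Polynomial.eval_zero, Matrix.transvection_zero, linSubst_one] at this
  exact this.symm

variable (k p K) in
/-- The coordinate ring of the space of pairs of a form and a point. -/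
abbrev FormPoint : Type v := MvPolynomial (Exponent k p ⊕ Fin k) K

variable (p K) in
def genericPoint (i₀ : Fin k) : Fin k → FormPoint k p K :=
  Function.update (fun i => X (Sum.inr i)) i₀ 1

variable (k p K) in
def genericForm : MvPolynomial (Fin k) (FormPoint k p K) := form fun m => X (Sum.inl m)

variable (p K) in
/-- The parametrisation of the discriminant by the pairs of a form and a point. -/
def discParam (i₀ : Fin k) : MvPolynomial (Exponent k p) K →ₐ[K] FormPoint k p K :=
  aeval (coeffs p (singularize i₀ p (genericPoint p K i₀) (genericForm k p K)))

lemma aeval_discParam [Algebra K S] (i₀ : Fin k) (c : Exponent k p → S) (y : Fin k → S)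
    (D : MvPolynomial (Exponent k p) K) :
    aeval (Sum.elim c y) (discParam p K i₀ D) =
      aeval (coeffs p (singularize i₀ p (Function.update y i₀ 1) (form c))) D := by
  rw [discParam, algHom_aeval_coeffs, map_singularize, genericForm, map_form]
  congr 4
  · funext i
    by_cases hi : i = i₀
    · subst hi; simp [genericPoint]
    · simp [genericPoint, hi]
  · congr 1; funext m; simp

variable [IsAlgClosed K]

/-- The specialisations of `discParam` are exactly the forms singular at a point of the chart:
`singularize` always produces such a form and fixes those that are already singular at `y`. Over the
infinite field `K`, vanishing at all specialisations means vanishing as a polynomial. -/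
lemma mem_discriminantIdeal_iff_discParam (hp : 1 ≤ p) (i₀ : Fin k)
    {D : MvPolynomial (Exponent k p) K} :
    D ∈ discriminantIdeal K k p ↔ discParam p K i₀ D = 0 := by
  rw [mem_discriminantIdeal_iff_chart i₀]
  constructor
  · intro h
    refine MvPolynomial.funext fun x => ?_
    have hx := aeval_discParam i₀ (x ∘ Sum.inl) (x ∘ Sum.inr) D
    rw [Sum.elim_comp_inl_inr] at hx
    refine Eq.trans (hx.trans ?_) (map_zero (eval x)).symm
    exact h _ (isHomogeneous_singularize (isHomogeneous_form _) hp _ _) _ (by simp)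
      (isSingularAt_singularize (isHomogeneous_form _) (by simp))
  · intro h F hF y hy hs
    have := aeval_discParam i₀ (coeffs p F) y D
    rw [h, map_zero, form_coeffs hF, ← hy, Function.update_eq_self,
      singularize_eq_self hy hs.1 fun j _ => hs.2 j] at this
    exact this.symm

/-- The elements of the ideal of the discriminant vanish at the singular forms over any
`K`-algebra. -/
lemma aeval_eq_zero_of_singular [Algebra K S] (hp : 1 ≤ p) {D : MvPolynomial (Exponent k p) K}
    (hD : D ∈ discriminantIdeal K k p) {F : MvPolynomial (Fin k) S} (hF : F.IsHomogeneous p)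
    {i₀ : Fin k} {y : Fin k → S} (hy : y i₀ = 1) (h : eval y F = 0)
    (h' : ∀ j, j ≠ i₀ → eval y (pderiv j F) = 0) : aeval (coeffs p F) D = 0 := by
  have := aeval_discParam i₀ (coeffs p F) y D
  rwa [(mem_discriminantIdeal_iff_discParam hp i₀).1 hD, map_zero, form_coeffs hF,
    ← hy, Function.update_eq_self, singularize_eq_self hy h h', eq_comm] at this

lemma isPrime_discriminantIdeal (hp : 1 ≤ p) (i₀ : Fin k) : (discriminantIdeal K k p).IsPrime := by
  have : discriminantIdeal K k p = RingHom.ker (discParam p K i₀) := by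
    ext D
    rw [mem_discriminantIdeal_iff_discParam hp i₀, RingHom.mem_ker]
  rw [this]
  exact RingHom.ker_isPrime _

end Parametrisation

/-! ### Elements of the discriminant ideal involve the coefficient of a pure power -/

section Elimination

variable {S : Type*} [CommRing S] {k p : ℕ} {K : Type v} [Field K]

/-- The exponent of `X i₀ ^ (p - 1) * X j`. -/
def axisExponent (hp : 1 ≤ p) (i₀ j : Fin k) : Exponent k p :=
  ⟨Finsupp.single j 1 + Finsupp.single i₀ (p - 1), by
    rw [map_add, Finsupp.degree_single, Finsupp.degree_single, Nat.add_sub_cancel' hp]⟩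

lemma axisExponent_injective (hp : 1 ≤ p) (i₀ : Fin k) :
    Function.Injective (axisExponent hp i₀) := by
  intro i j h
  have := add_right_cancel (Subtype.ext_iff.1 h)
  exact Finsupp.single_left_injective one_ne_zero this

lemma axisExponent_self (hp : 1 ≤ p) (i₀ : Fin k) :
    (axisExponent hp i₀ i₀).1 = Finsupp.single i₀ p := by
  change Finsupp.single i₀ 1 + Finsupp.single i₀ (p - 1) = _
  rw [← Finsupp.single_add, Nat.add_sub_cancel' hp]

variable (p K) in
/-- The value at the generic point of the derivatives of the generic form. -/
def genericDeriv (i₀ j : Fin k) : FormPoint k p K :=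
  eval (genericPoint p K i₀) (pderiv j (genericForm k p K))

/-- All corrections made by `singularize` to the other monomials are single derivatives at the
monomials `X i₀ ^ (p - 1) * X j`; the mixed contributions are collected in the excluded coefficient
of `X i₀ ^ p`. -/
lemma discParam_X (hp : 1 ≤ p) (i₀ : Fin k) {m : Exponent k p} (hm : m ≠ axisExponent hp i₀ i₀) :
    discParam p K i₀ (X m) =
      X (Sum.inl m) - ∑ j, if axisExponent hp i₀ j = m then genericDeriv p K i₀ j else 0 := by
  have h0 : ∀ c : FormPoint k p K, coeff m.1 (C c * X i₀ ^ p) = 0 := fun c => by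
    classical
    rw [coeff_C_mul, coeff_X_pow, if_neg, mul_zero]
    rw [← axisExponent_self hp i₀]
    exact fun h => hm (Subtype.ext h.symm)
  rw [discParam, aeval_X, coeffs, singularize, coeff_sub, coeff_sub, h0, sub_zero, coeff_sum]
  congr 1
  · exact congrFun (coeffs_form _) m
  · refine Finset.sum_congr rfl fun j _ => ?_
    have h1 : ((X j - C (genericPoint p K i₀ j) * X i₀) * X i₀ ^ (p - 1) :
        MvPolynomial (Fin k) (FormPoint k p K)) =
        monomial (axisExponent hp i₀ j).1 1 - C (genericPoint p K i₀ j) * X i₀ ^ p := by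
      have h2 : (X i₀ ^ p : MvPolynomial (Fin k) (FormPoint k p K)) = X i₀ * X i₀ ^ (p - 1) := by
        rw [← pow_succ', Nat.sub_add_cancel hp]
      rw [h2, sub_mul, mul_assoc, axisExponent, X_pow_eq_monomial, X, X, monomial_mul, mul_one]
    classical
    rw [h1, coeff_C_mul, coeff_sub, h0, sub_zero, coeff_monomial, mul_ite, mul_one, mul_zero]
    simp only [Subtype.val_inj]
    rfl

lemma derivation_eval [Algebra K S] (d : Derivation K S S) (y : Fin k → S)
    (G : MvPolynomial (Fin k) S) (hG : ∀ m, d (coeff m G) = 0) :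
    d (eval y G) = ∑ i, eval y (pderiv i G) * d (y i) := by
  have key : ∀ (m : Fin k →₀ ℕ) (c : S), d c = 0 → d (eval y (monomial m c)) =
      ∑ i, eval y (pderiv i (monomial m c)) * d (y i) := fun m c hc => by
    have h1 : monomial m c = C c * map (algebraMap K S) (monomial m 1) := by
      rw [map_monomial, C_mul_monomial, map_one, mul_one]
    have h2 : ∀ F : MvPolynomial (Fin k) K, eval y (map (algebraMap K S) F) = aeval y F :=
      fun F => by rw [MvPolynomial.eval_map]; rfl
    simp only [h1, map_mul, pderiv_C_mul, eval_C, pderiv_map, h2]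
    rw [Derivation.leibniz, hc, smul_zero, add_zero, derivation_aeval, smul_eq_mul, Finset.mul_sum]
    exact Finset.sum_congr rfl fun i _ => (mul_assoc _ _ _).symm
  rw [G.as_sum, map_sum, map_sum]
  simp only [map_sum, Finset.sum_mul]
  rw [Finset.sum_comm]
  exact Finset.sum_congr rfl fun m _ => key m _ (hG m)

/-- The coefficients of the generic form are constants for the derivation in the coordinate `i` of
the point, and only that coordinate of the point varies, so the chain rule leaves one second
derivative. -/
lemma pderiv_genericDeriv {i₀ i : Fin k} (hi : i ≠ i₀) (j : Fin k) :
    pderiv (Sum.inr i) (genericDeriv p K i₀ j) =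
      eval (genericPoint p K i₀) (pderiv i (pderiv j (genericForm k p K))) := by
  classical
  rw [genericDeriv, derivation_eval]
  · rw [Finset.sum_eq_single i]
    · simp [genericPoint, hi]
    · intro l _ hl
      by_cases hl0 : l = i₀
      · subst hl0; simp [genericPoint]
      · simp [genericPoint, hl0, pderiv_X, hl]
    · simp
  · intro m
    rw [coeff_pderiv, Derivation.leibniz]
    have : pderiv (Sum.inr i) ((m j : FormPoint k p K) + 1) = 0 := by
      rw [map_add, Derivation.map_natCast, Derivation.map_one_eq_zero, add_zero]
    rw [this, smul_zero, zero_add]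
    by_cases hm : (m + Finsupp.single j 1).degree = p
    · have h1 := congrFun (coeffs_form (k := k) (p := p)
        fun m => (X (Sum.inl m) : FormPoint k p K)) ⟨_, hm⟩
      rw [coeffs] at h1
      rw [genericForm, h1, pderiv_X_of_ne (by simp), smul_zero]
    · rw [genericForm, (isHomogeneous_form _).coeff_eq_zero hm, map_zero, smul_zero]

lemma aeval_eval_pderiv_pderiv_genericForm [Algebra K S] {F : MvPolynomial (Fin k) S}
    (hF : F.IsHomogeneous p) (y : Fin k → S) (i₀ i j : Fin k) :
    aeval (Sum.elim (coeffs p F) y)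
      (eval (genericPoint p K i₀) (pderiv i (pderiv j (genericForm k p K)))) =
      eval (Function.update y i₀ 1) (pderiv i (pderiv j F)) := by
  let φ : FormPoint k p K →+* S := (aeval (Sum.elim (coeffs p F) y) : FormPoint k p K →ₐ[K] S)
  change φ _ = _
  have hF' : F = map φ (genericForm k p K) := by
    rw [genericForm, map_form]
    conv_lhs => rw [← form_coeffs hF]
    congr 1; funext m; simp [φ]
  rw [eval₂_comp, hF', pderiv_map, pderiv_map, MvPolynomial.eval_map]
  congr 1
  funext l
  by_cases hl : l = i₀
  · subst hl; simp [genericPoint]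
  · simp [genericPoint, hl, φ]

variable (p K) in
/-- The Hessian of the generic form at the generic point, in the chart `X i₀ = 1`. -/
def genericHessian (i₀ : Fin k) : Matrix {i // i ≠ i₀} {i // i ≠ i₀} (FormPoint k p K) :=
  Matrix.of fun i j => eval (genericPoint p K i₀) (pderiv i.1 (pderiv j.1 (genericForm k p K)))

lemma det_genericHessian_ne_zero [CharZero K] (hp : 2 ≤ p) (i₀ : Fin k) :
    (genericHessian p K i₀).det ≠ 0 := by
  classical
  intro h
  -- A nondegenerate quadric in the chart `X i₀ = 1`: at the point whose other coordinates are `0`,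
  -- its Hessian is twice the identity.
  set F : MvPolynomial (Fin k) K := (∑ l, X l ^ 2) * X i₀ ^ (p - 2) with hFdef
  have hF : F.IsHomogeneous p := by
    have := (IsHomogeneous.sum Finset.univ (fun l => (X l : MvPolynomial (Fin k) K) ^ 2) 2
      fun l _ => isHomogeneous_X_pow l 2).mul (isHomogeneous_X_pow (R := K) i₀ (p - 2))
    rwa [Nat.add_sub_cancel' hp] at this
  let φ : FormPoint k p K →+* K :=
    (aeval (Sum.elim (coeffs p F) 0) : FormPoint k p K →ₐ[K] K)
  have h1 : φ.mapMatrix (genericHessian p K i₀) = Matrix.diagonal fun _ => 2 := by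
    ext ⟨i, hi⟩ ⟨j, hj⟩
    rw [RingHom.mapMatrix_apply, Matrix.map_apply, genericHessian, Matrix.of_apply]
    refine (aeval_eval_pderiv_pderiv_genericForm hF 0 i₀ i j).trans ?_
    have h2 : pderiv j F = C 2 * X j * X i₀ ^ (p - 2) := by
      rw [hFdef, pderiv_mul, map_sum, Finset.sum_eq_single j]
      · rw [pderiv_pow, pderiv_pow, pderiv_X_self, pderiv_X_of_ne (Ne.symm hj)]
        simp only [Nat.add_one_sub_one, pow_one, mul_one, mul_zero, add_zero]
        rfl
      · intro l _ hl
        rw [pderiv_pow, pderiv_X_of_ne hl, mul_zero]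
      · simp
    rw [h2, pderiv_mul, pderiv_C_mul, pderiv_pow, pderiv_X_of_ne (Ne.symm hi), pderiv_X]
    by_cases hij : i = j
    · subst hij; simp
    · simp [hij, Ne.symm hij]
  have h2 := congrArg φ h
  rw [map_zero, RingHom.map_det, h1, Matrix.det_diagonal, Finset.prod_const] at h2
  exact pow_ne_zero _ two_ne_zero h2

/-- A relation between the coefficients of the singular forms involves the coefficient of
`X i₀ ^ p`. -/
lemma eq_zero_of_discParam_eq_zero [CharZero K] (hp : 2 ≤ p) (i₀ : Fin k)
    {D : MvPolynomial (Exponent k p) K} (hD : discParam p K i₀ D = 0)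
    (h0 : D.degreeOf (axisExponent (one_le_two.trans hp) i₀ i₀) = 0) : D = 0 := by
  have hp1 : 1 ≤ p := one_le_two.trans hp
  classical
  have h0' : ∀ d, coeff d D ≠ 0 → d (axisExponent hp1 i₀ i₀) = 0 := fun d hd =>
    Nat.le_zero.1 ((degreeOf_le_iff.1 h0.le) d (mem_support_iff.2 hd))
  -- Induction on a bound for the degree of `D`, which drops under differentiation.
  obtain ⟨n, hn⟩ : ∃ n, ∀ d, coeff d D ≠ 0 → d.degree < n :=
    ⟨D.totalDegree + 1, fun d hd => Nat.lt_succ_of_le (le_totalDegree (mem_support_iff.2 hd))⟩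
  clear h0
  induction n generalizing D with
  | zero =>
    ext d
    by_contra hd
    exact Nat.not_lt_zero _ (hn d hd)
  | succ n ih =>
    have hpd : ∀ (m : Exponent k p) d, coeff d (pderiv m D) ≠ 0 →
        coeff (d + Finsupp.single m 1) D ≠ 0 := fun m d hd h => hd (by rw [coeff_pderiv, h, zero_mul])
    have hm0 : pderiv (axisExponent hp1 i₀ i₀) D = 0 := by
      ext d
      by_contra hd
      simpa using h0' _ (hpd _ d hd)
    -- Differentiating `discParam p K i₀ D = 0` in the coordinate `i` of the point yields a linear
    -- system with the Hessian as matrix. The complicated coefficient of `X i₀ ^ p` contributes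
    -- nothing because `D` does not involve it.
    have hrel : ∀ i : {i // i ≠ i₀}, ∑ j : {j // j ≠ i₀}, genericHessian p K i₀ i j *
        discParam p K i₀ (pderiv (axisExponent hp1 i₀ j) D) = 0 := by
      rintro ⟨i, hi⟩
      have h1 := congrArg (pderiv (Sum.inr i)) hD
      rw [discParam, derivation_aeval, ← discParam, map_zero] at h1
      have h2 : ∀ m : Exponent k p, discParam p K i₀ (pderiv m D) * pderiv (Sum.inr i)
          (coeffs p (singularize i₀ p (genericPoint p K i₀) (genericForm k p K)) m) =
          - ∑ j, if axisExponent hp1 i₀ j = m then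
            pderiv (Sum.inr i) (genericDeriv p K i₀ j) * discParam p K i₀ (pderiv m D) else 0 := by
        intro m
        by_cases hm : m = axisExponent hp1 i₀ i₀
        · subst hm
          rw [hm0]
          simp
        · have h3 := discParam_X (K := K) hp1 i₀ hm
          rw [discParam, aeval_X] at h3
          rw [h3, map_sub, pderiv_X_of_ne (by simp), zero_sub, map_sum, mul_neg, Finset.mul_sum]
          congr 1
          refine Finset.sum_congr rfl fun j _ => ?_
          rw [apply_ite (pderiv (Sum.inr i)), map_zero, mul_ite, mul_zero, mul_comm]
      simp only [h2] at h1
      rw [Finset.sum_neg_distrib, neg_eq_zero, Finset.sum_comm] at h1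
      simp only [Finset.sum_ite_eq, Finset.mem_univ, if_true, pderiv_genericDeriv hi] at h1
      rw [Fintype.sum_eq_add_sum_subtype_ne _ i₀, hm0, map_zero, mul_zero, zero_add] at h1
      exact h1
    -- The Hessian has nonzero determinant over a domain, so the derivatives of `D` lie in the
    -- kernel of `discParam` and the induction hypothesis applies to them.
    have hz : ∀ j : {j // j ≠ i₀}, pderiv (axisExponent hp1 i₀ j) D = 0 := by
      have h1 : (genericHessian p K i₀).mulVec
          (fun j => discParam p K i₀ (pderiv (axisExponent hp1 i₀ j) D)) = 0 := _root_.funext hrel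
      have h2 := Matrix.eq_zero_of_mulVec_eq_zero (det_genericHessian_ne_zero hp i₀) h1
      intro j
      refine ih (congrFun h2 j) (fun d hd => ?_) (fun d hd => ?_)
      · have := h0' _ (hpd _ d hd)
        rw [Finsupp.add_apply] at this
        exact (add_eq_zero.1 this).1
      · simpa using hn _ (hpd _ d hd)
    -- In characteristic zero, vanishing derivatives mean that `D` involves none of the coefficients
    -- altered by `singularize`; on such `D`, `discParam` is just the inclusion of variables.
    have hz' : ∀ d, coeff d D ≠ 0 → ∀ j, d (axisExponent hp1 i₀ j) = 0 := by
      intro d hd j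
      by_contra hdj
      by_cases hj : j = i₀
      · subst hj; exact hdj (h0' d hd)
      have h1 := congrArg (coeff (d - Finsupp.single (axisExponent hp1 i₀ j) 1)) (hz ⟨j, hj⟩)
      have h2 : d - Finsupp.single (axisExponent hp1 i₀ j) 1 +
          Finsupp.single (axisExponent hp1 i₀ j) 1 = d :=
        tsub_add_cancel_of_le (Finsupp.single_le_iff.2 (Nat.one_le_iff_ne_zero.2 hdj))
      rw [coeff_pderiv, h2, coeff_zero, mul_eq_zero] at h1
      exact h1.elim hd (Nat.cast_add_one_ne_zero _)
    have h1 : discParam p K i₀ D = rename Sum.inl D := by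
      rw [rename_eq_aeval, discParam, aeval_def, eval₂_eq', aeval_def, eval₂_eq']
      refine Finset.sum_congr rfl fun d hd => ?_
      congr 1
      refine Finset.prod_congr rfl fun m _ => ?_
      by_cases hm : ∃ j, axisExponent hp1 i₀ j = m
      · obtain ⟨j, rfl⟩ := hm
        rw [hz' d (mem_support_iff.1 hd) j, pow_zero, pow_zero]
      · push Not at hm
        have h3 := discParam_X (K := K) hp1 i₀ (hm i₀).symm
        rw [discParam, aeval_X] at h3
        rw [h3, Finset.sum_eq_zero fun j _ => if_neg (hm j), sub_zero]
        rfl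
    rw [hD, eq_comm, map_eq_zero_iff _ (rename_injective _ Sum.inl_injective)] at h1
    exact h1

end Elimination

/-! ### Prime ideals which are not contracted from a subring -/

section Principal

/-- `Q` contains a prime element `D`, of positive degree, which by Gauss's lemma stays irreducible
over the fraction field. If `D` did not divide some `E` in `Q`, a Bézout relation with denominators
cleared would put a nonzero constant into `Q`. -/
lemma eq_span_of_comap_C_eq_bot {R : Type*} [CommRing R] [IsDomain R]
    [UniqueFactorizationMonoid R] (Q : Ideal (Polynomial R)) [Q.IsPrime] (hQ : Q ≠ ⊥)
    (h : ∀ c, Polynomial.C c ∈ Q → c = 0) : ∃ D, Q = Ideal.span {D} := by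
  obtain ⟨D, hD, hDp⟩ := Ideal.IsPrime.exists_mem_prime_of_ne_bot ‹Q.IsPrime› hQ
  have hdeg : D.natDegree ≠ 0 := fun h0 => by
    obtain ⟨c, rfl⟩ := Polynomial.natDegree_eq_zero.1 h0
    exact hDp.ne_zero (by rw [h c hD, map_zero])
  have hprim : D.IsPrimitive := hDp.irreducible.isPrimitive hdeg
  have hirr := (hprim.irreducible_iff_irreducible_map_fraction_map (K := FractionRing R)).1
    hDp.irreducible
  refine ⟨D, le_antisymm (fun E hE => ?_) ((Ideal.span_singleton_le_iff_mem _).2 hD)⟩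
  rw [Ideal.mem_span_singleton]
  refine hprim.dvd_of_fraction_map_dvd_fraction_map (K := FractionRing R) ?_
  by_contra hnd
  obtain ⟨u, w, huw⟩ := (hirr.coprime_iff_not_dvd).2 hnd
  obtain ⟨b, hb, hb'⟩ := IsLocalization.integerNormalization_spec (nonZeroDivisors R) u
  obtain ⟨c, hc, hc'⟩ := IsLocalization.integerNormalization_spec (nonZeroDivisors R) w
  have key : Polynomial.C c * IsLocalization.integerNormalization (nonZeroDivisors R) u * D +
      Polynomial.C b * IsLocalization.integerNormalization (nonZeroDivisors R) w * E =
      Polynomial.C (b * c) := by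
    apply Polynomial.map_injective (algebraMap R (FractionRing R)) (IsFractionRing.injective _ _)
    simp only [Polynomial.map_add, Polynomial.map_mul, hb', hc', Polynomial.map_C, map_mul]
    rw [Algebra.smul_def b, Algebra.smul_def c]
    change Polynomial.C (algebraMap R (FractionRing R) c) *
      (Polynomial.C (algebraMap R (FractionRing R) b) * u) * _ +
      Polynomial.C (algebraMap R (FractionRing R) b) *
      (Polynomial.C (algebraMap R (FractionRing R) c) * w) * _ = _
    linear_combination Polynomial.C (algebraMap R (FractionRing R) b) *
      Polynomial.C (algebraMap R (FractionRing R) c) * huw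
  have h0 := h (b * c) (key ▸ Q.add_mem (Q.mul_mem_left _ hD) (Q.mul_mem_left _ hE))
  exact nonZeroDivisors.ne_zero (mul_mem hb hc) h0

lemma eq_span_of_degreeOf {K : Type*} [Field K] {σ : Type*} (t : σ)
    (Q : Ideal (MvPolynomial σ K)) [Q.IsPrime] (hQ : Q ≠ ⊥)
    (h : ∀ c ∈ Q, c.degreeOf t = 0 → c = 0) : ∃ D, Q = Ideal.span {D} := by
  classical
  let e : MvPolynomial σ K ≃+* Polynomial (MvPolynomial {m // m ≠ t} K) :=
    ((renameEquiv K (Equiv.optionSubtypeNe t).symm).trans (optionEquivLeft K _)).toRingEquiv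
  have hprime : (Q.comap e.symm.toRingHom).IsPrime := Ideal.comap_isPrime _ _
  obtain ⟨D, hD⟩ := eq_span_of_comap_C_eq_bot (Q.comap e.symm.toRingHom)
    (fun h0 => hQ (by
      rw [eq_bot_iff]
      intro x hx
      have : e x ∈ Q.comap e.symm.toRingHom := by simpa using hx
      rw [h0, Ideal.mem_bot, map_eq_zero_iff _ e.injective] at this
      exact this))
    (fun c hc => by
      have h1 := h _ hc (by
        rw [degreeOf_eq_natDegree]
        change (e (e.symm _)).natDegree = 0
        rw [RingEquiv.apply_symm_apply, Polynomial.natDegree_C])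
      have h2 : e.symm (Polynomial.C c) = 0 := h1
      rwa [map_eq_zero_iff _ e.symm.injective, Polynomial.C_eq_zero] at h2)
  refine ⟨e.symm D, ?_⟩
  ext x
  have : x ∈ Q ↔ e x ∈ Q.comap e.symm.toRingHom := by simp
  rw [this, hD, Ideal.mem_span_singleton, Ideal.mem_span_singleton]
  rw [← map_dvd_iff e.symm, RingEquiv.symm_apply_apply]

end Principal

/-! ### The degree of the discriminant is bounded by counting monomials -/

section Counting

variable {k p : ℕ} {K : Type v} [Field K]

lemma card_exponent (r n : ℕ) : Fintype.card (Exponent (r + 1) n) = (n + r).choose r := by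
  have h := Finset.card_finsuppAntidiag_nat_eq_choose (s := (Finset.univ : Finset (Fin (r + 1)))) n
  rw [Finset.card_univ, Fintype.card_fin] at h
  have h2 : r + 1 + n - 1 = n + r := by omega
  rw [h2, Nat.choose_symm_add] at h
  rw [← Nat.card_eq_fintype_card, ← h, ← Nat.card_eq_finsetCard]
  refine Nat.card_congr (Equiv.subtypeEquivRight fun m => ?_)
  simp [Finset.mem_finsuppAntidiag, Finsupp.degree_eq_sum]

lemma exists_card_lt (hp : 2 ≤ p) (hk : 0 < k) : ∃ J,
    Fintype.card (Exponent k ((p - 1) * J + p * (p - 1) ^ (k - 1))) <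
      ((p - 1) ^ (k - 1) + 1) * Fintype.card (Exponent k J) := by
  obtain ⟨r, rfl⟩ : ∃ r, k = r + 1 := ⟨k - 1, by omega⟩
  obtain ⟨q, hq, rfl⟩ : ∃ q, 0 < q ∧ p = q + 1 := ⟨p - 1, by omega, by omega⟩
  simp only [Nat.add_sub_cancel, card_exponent]
  -- With `k = r + 1` and `p = q + 1`, the two sides grow like `q ^ r * J ^ r` and `(q ^ r + 1) * J
  -- ^ r`, up to the common factor `1 / r!`. The constant `c` exceeds the lower-order terms, so for
  -- `J = c * N` it can be factored out of both sides.
  set c := (q + 1) * q ^ r + r + 1 with hc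
  obtain ⟨N, hN⟩ : ∃ N : ℕ, 0 < N ∧ (q * N + 1) ^ r < (q ^ r + 1) * N ^ r := by
    have h1 : Filter.Tendsto (fun N : ℕ => ((q : ℝ) + 1 / (N : ℝ)) ^ r) Filter.atTop
        (nhds (((q : ℝ) + 0) ^ r)) :=
      (tendsto_const_nhds.add tendsto_one_div_atTop_nhds_zero_nat).pow r
    have h2 : ((q : ℝ) + 0) ^ r < (q : ℝ) ^ r + 1 := by rw [add_zero]; exact lt_add_one _
    obtain ⟨N, hN, hN0⟩ := ((h1.eventually_lt_const h2).and (Filter.eventually_gt_atTop 0)).exists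
    refine ⟨N, hN0, ?_⟩
    have hN' : (0 : ℝ) < N := Nat.cast_pos.2 hN0
    have h3 : ((q : ℝ) + 1 / (N : ℝ)) = (q * N + 1) / N := by field_simp
    rw [h3, div_pow, div_lt_iff₀ (by positivity)] at hN
    exact_mod_cast hN
  refine ⟨c * N, ?_⟩
  have hr := Nat.factorial_pos r
  rw [← Nat.mul_lt_mul_left hr]
  have h1 : ∀ n, r.factorial * (n + r).choose r = (n + 1).ascFactorial r := fun n =>
    (Nat.ascFactorial_eq_factorial_mul_choose n r).symm
  rw [h1, mul_left_comm r.factorial, h1]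
  calc _ ≤ (q * (c * N) + (q + 1) * q ^ r + r) ^ r := Nat.ascFactorial_le_pow_add _ _
    _ ≤ (c * (q * N + 1)) ^ r := Nat.pow_le_pow_left (by rw [hc]; nlinarith) _
    _ = c ^ r * (q * N + 1) ^ r := mul_pow _ _ _
    _ < c ^ r * ((q ^ r + 1) * N ^ r) := Nat.mul_lt_mul_of_pos_left hN.2 (by positivity)
    _ = (q ^ r + 1) * (c * N) ^ r := by rw [mul_pow]; ring
    _ ≤ (q ^ r + 1) * (c * N + 1) ^ r := by gcongr; exact Nat.le_succ _
    _ ≤ _ := Nat.mul_le_mul_left _ (Nat.pow_succ_le_ascFactorial _ _)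

end Counting

/-! ### Upper bound: a relation of low degree in the coefficient of a pure power -/

section Relation

variable {k p : ℕ} {K : Type v} [Field K]

/-- There are more forms than monomials, and over a nontrivial commutative ring no free module
embeds linearly into one of smaller finite rank. -/
lemma exists_linear_relation {B : Type*} [CommRing B] [Nontrivial B] {ι : Type*} [Fintype ι]
    {n : ℕ} (G : ι → MvPolynomial (Fin k) B) (hG : ∀ i, (G i).IsHomogeneous n)
    (h : Fintype.card (Exponent k n) < Fintype.card ι) :
    ∃ b : ι → B, b ≠ 0 ∧ ∑ i, C (b i) * G i = 0 := by
  have hni : ¬ Function.Injective (Fintype.linearCombination B fun i => coeffs n (G i)) :=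
    fun hi => absurd (card_le_of_injective B _ hi) (not_le.2 h)
  rw [← LinearMap.ker_eq_bot] at hni
  obtain ⟨b, hb, hb0⟩ := Submodule.exists_mem_ne_zero_of_ne_bot hni
  refine ⟨b, hb0, ?_⟩
  refine coeffs_injective (IsHomogeneous.sum _ _ _ fun i _ => (hG i).C_mul _)
    (isHomogeneous_zero _ _ n) ?_
  rw [LinearMap.mem_ker, Fintype.linearCombination_apply] at hb
  funext m
  have := congrFun hb m
  simpa [coeffs, coeff_sum] using this

/-- The exponents which are not divisible by `X i₀ ^ (p - 1)`. -/
abbrev RestExponent (hp : 1 ≤ p) (i₀ : Fin k) : Type :=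
  {m : Exponent k p // ¬ ∃ j, axisExponent hp i₀ j = m}

/-- The generic form without monomials divisible by `X i₀ ^ (p - 1)`. -/
def restForm {B : Type*} [CommRing B] (hp : 1 ≤ p) (i₀ : Fin k) (c : RestExponent hp i₀ → B) :
    MvPolynomial (Fin k) B :=
  open Classical in
  form fun m => if h : ∃ j, axisExponent hp i₀ j = m then 0 else c ⟨m, h⟩

lemma isHomogeneous_restForm {B : Type*} [CommRing B] (hp : 1 ≤ p) (i₀ : Fin k)
    (c : RestExponent hp i₀ → B) : (restForm hp i₀ c).IsHomogeneous p := isHomogeneous_form _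

lemma map_restForm {B B' : Type*} [CommRing B] [CommRing B'] (φ : B →+* B') (hp : 1 ≤ p)
    (i₀ : Fin k) (c : RestExponent hp i₀ → B) :
    map φ (restForm hp i₀ c) = restForm hp i₀ fun m => φ (c m) := by
  classical
  rw [restForm, restForm, map_form]
  congr 1
  funext m
  rw [apply_dite φ]
  simp

lemma eq_restForm_add {F : MvPolynomial (Fin k) K} (hF : F.IsHomogeneous p) (hp : 1 ≤ p)
    (i₀ : Fin k) : F = restForm hp i₀ (fun m => coeffs p F m.1) +
      ∑ j, C (coeffs p F (axisExponent hp i₀ j)) * (X j * X i₀ ^ (p - 1)) := by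
  classical
  have hX : ∀ j, X j * X i₀ ^ (p - 1) =
      (monomial (axisExponent hp i₀ j).1 1 : MvPolynomial (Fin k) K) := fun j => by
    rw [axisExponent, X_pow_eq_monomial, X, monomial_mul, mul_one]
  simp only [hX]
  refine coeffs_injective hF ((isHomogeneous_restForm _ _ _).add
    (IsHomogeneous.sum _ _ _ fun j _ => (isHomogeneous_monomial _ (axisExponent hp i₀ j).2).C_mul _)) ?_
  funext m
  have h1 : coeffs p (restForm hp i₀ fun m => coeffs p F m.1) m =
      if ∃ j, axisExponent hp i₀ j = m then 0 else coeffs p F m := by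
    rw [restForm, coeffs_form]; split_ifs <;> rfl
  change _ = coeff m.1 (_ + _)
  rw [coeff_add]
  change _ = coeffs p _ m + _
  rw [h1, coeff_sum]
  simp only [coeff_C_mul, coeff_monomial, Subtype.val_inj, mul_ite, mul_one, mul_zero]
  by_cases h : ∃ j, axisExponent hp i₀ j = m
  · obtain ⟨j, rfl⟩ := h
    rw [if_pos ⟨j, rfl⟩, zero_add]
    simp [(axisExponent_injective hp i₀).eq_iff]
  · rw [if_neg h, Finset.sum_eq_zero, add_zero]
    exact fun j _ => if_neg fun hj => h ⟨j, hj⟩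

/-- At a singular form, the coefficients of the monomials divisible by `X i₀ ^ (p - 1)` are
determined by the other ones and the singular point. -/
lemma coeffs_axisExponent_of_isSingularAt {F : MvPolynomial (Fin k) K} (hF : F.IsHomogeneous p)
    (hp : 1 ≤ p) {i₀ : Fin k} {y : Fin k → K} (hy : y i₀ = 1) (h : IsSingularAt F y) :
    (∀ j, j ≠ i₀ → coeffs p F (axisExponent hp i₀ j) =
      - eval y (pderiv j (restForm hp i₀ fun m => coeffs p F m.1))) ∧
    coeffs p F (axisExponent hp i₀ i₀) =
      - eval y (restForm hp i₀ fun m => coeffs p F m.1) +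
        ∑ j : {j // j ≠ i₀}, eval y (pderiv j.1 (restForm hp i₀ fun m => coeffs p F m.1)) * y j := by
  classical
  set H := restForm hp i₀ fun m => coeffs p F m.1
  have e := eq_restForm_add hF hp i₀
  have h1 : ∀ j, j ≠ i₀ → coeffs p F (axisExponent hp i₀ j) = - eval y (pderiv j H) := by
    intro j hj
    have h2 := h.2 j
    rw [e, map_add, map_add, map_sum, map_sum, Finset.sum_eq_single j] at h2
    · rw [pderiv_C_mul, pderiv_mul, pderiv_pow, pderiv_X_self, pderiv_X_of_ne (Ne.symm hj)] at h2
      simp only [mul_zero, add_zero, one_mul, map_mul, map_pow, eval_C, eval_X, hy, one_pow,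
        mul_one] at h2
      linear_combination h2
    · intro l _ hl
      rw [pderiv_C_mul, pderiv_mul, pderiv_pow, pderiv_X_of_ne hl, pderiv_X_of_ne (Ne.symm hj)]
      simp
    · simp
  refine ⟨h1, ?_⟩
  have h2 := h.1
  rw [e, map_add, map_sum, Fintype.sum_eq_add_sum_subtype_ne _ i₀] at h2
  have h3 : ∑ j : {j // j ≠ i₀}, eval y (C (coeffs p F (axisExponent hp i₀ j.1)) *
      (X j.1 * X i₀ ^ (p - 1))) = - ∑ j : {j // j ≠ i₀}, eval y (pderiv j.1 H) * y j := by
    rw [← Finset.sum_neg_distrib]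
    refine Finset.sum_congr rfl fun j _ => ?_
    rw [h1 j j.2]
    simp [hy]
  rw [h3] at h2
  simp only [map_mul, eval_C, eval_X, map_pow, hy, one_pow, mul_one] at h2
  linear_combination h2

/-- There is a relation between the coefficients of the singular forms of degree at most
`(p - 1) ^ (k - 1)` in the coefficient of `X i₀ ^ p`. -/
lemma exists_mem_discriminantIdeal [IsAlgClosed K] (hp : 2 ≤ p) (i₀ : Fin k) :
    ∃ D ∈ discriminantIdeal K k p, D ≠ 0 ∧
      D.degreeOf (axisExponent (one_le_two.trans hp) i₀ i₀) ≤ (p - 1) ^ (k - 1) := by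
  classical
  have hp1 : 1 ≤ p := one_le_two.trans hp
  obtain ⟨J, hJ⟩ := exists_card_lt hp i₀.pos
  set e := (p - 1) ^ (k - 1)
  let B := MvPolynomial (RestExponent hp1 i₀) K
  let H : MvPolynomial (Fin k) B := restForm hp1 i₀ X
  have hH : H.IsHomogeneous p := isHomogeneous_restForm _ _ _
  -- At a singular form, with the point normalised by `y i₀ = 1`, `w j` takes the value of the
  -- coefficient of `X i₀ ^ (p - 1) * X j` for `j ≠ i₀`, and `T` below that of the coefficient of `X
  -- i₀ ^ p`. The factor `w i₀` takes the value `1` and only serves to homogenise.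
  let w : Fin k → MvPolynomial (Fin k) B := fun j => if j = i₀ then X i₀ ^ (p - 1) else - pderiv j H
  have hw : ∀ j, (w j).IsHomogeneous (p - 1) := fun j => by
    by_cases hj : j = i₀
    · simp only [w, if_pos hj]; exact isHomogeneous_X_pow _ _
    · simp only [w, if_neg hj]; exact hH.pderiv.neg
  let T : MvPolynomial (Fin k) B := - H + ∑ j : {j // j ≠ i₀}, pderiv j.1 H * X j.1
  have hT : T.IsHomogeneous p := by
    refine hH.neg.add (IsHomogeneous.sum _ _ _ fun j _ => ?_)
    have := (hH.pderiv (i := j.1)).mul (isHomogeneous_X B j.1)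
    rwa [Nat.sub_add_cancel hp1] at this
  let ι := Fin (e + 1) × Exponent k J
  -- The powers of `X i₀` bring all products to the same degree, so that `exists_card_lt` forces a
  -- linear relation over `B`. Setting `y i₀ = 1` turns it into a relation between the coefficients
  -- of singular forms.
  let G : ι → MvPolynomial (Fin k) B := fun s =>
    (∏ j, w j ^ s.2.1 j) * (T ^ (s.1 : ℕ) * X i₀ ^ (p * (e - s.1)))
  have hG : ∀ s, (G s).IsHomogeneous ((p - 1) * J + p * e) := fun s => by
    have h1 := IsHomogeneous.prod Finset.univ (fun j => w j ^ s.2.1 j)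
      (fun j => (p - 1) * s.2.1 j) fun j _ => (hw j).pow _
    have h2 := h1.mul ((hT.pow s.1).mul (isHomogeneous_X_pow (R := B) i₀ (p * (e - s.1))))
    have h3 : ∑ j, (p - 1) * s.2.1 j = (p - 1) * J := by
      rw [← Finset.mul_sum, ← Finsupp.degree_eq_sum, s.2.2]
    rwa [h3, ← mul_add, Nat.add_sub_cancel' (Nat.lt_succ_iff.1 s.1.2)] at h2
  obtain ⟨b, hb0, hb⟩ := exists_linear_relation G hG (by
    rw [Fintype.card_prod, Fintype.card_fin]; exact hJ)
  let mon : ι → MvPolynomial (Exponent k p) K := fun s =>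
    (∏ j : {j // j ≠ i₀}, X (axisExponent hp1 i₀ j) ^ s.2.1 j) * X (axisExponent hp1 i₀ i₀) ^ (s.1 : ℕ)
  refine ⟨∑ s, rename Subtype.val (b s) * mon s, ?_, ?_, ?_⟩
  · rw [mem_discriminantIdeal_iff_chart i₀]
    intro F hF y hy hs
    obtain ⟨h1, h2⟩ := coeffs_axisExponent_of_isSingularAt hF hp1 hy hs
    let φ : B →+* K := eval fun m => coeffs p F m.1
    have hφ : ∀ Q : MvPolynomial (Fin k) B, eval₂ φ y Q = eval y (map φ Q) := fun Q =>
      (MvPolynomial.eval_map _ _ _).symm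
    have hHφ : map φ H = restForm hp1 i₀ fun m => coeffs p F m.1 := by
      rw [map_restForm]; congr 1; funext m; exact eval_X _
    have h3 := congrArg (eval₂ φ y) hb
    rw [eval₂_zero, eval₂_sum] at h3
    rw [map_sum, ← h3]
    refine Finset.sum_congr rfl fun s _ => ?_
    rw [map_mul, eval_rename, eval₂_mul, eval₂_C]
    congr 1
    have hwi : eval y (map φ (w i₀)) = 1 := by simp [w, hy]
    have hwj : ∀ j : {j // j ≠ i₀}, eval y (map φ (w j)) = coeffs p F (axisExponent hp1 i₀ j) :=
      fun j => by rw [h1 j j.2, ← hHφ, pderiv_map]; simp [w, j.2]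
    have hTφ : eval y (map φ T) = coeffs p F (axisExponent hp1 i₀ i₀) := by
      rw [h2, ← hHφ]; simp [T, pderiv_map]
    rw [hφ]
    simp only [G, mon, map_mul, map_prod, map_pow, hTφ, map_X, eval_X, hy, one_pow, mul_one]
    rw [Fintype.prod_eq_mul_prod_subtype_ne _ i₀, hwi, one_pow, one_mul]
    simp only [hwj]
  · intro h0
    -- Separating the coefficients that are divisible by `X i₀ ^ (p - 1)` from the rest shows the
    -- relation as a polynomial over `B` with coefficients `b s`.
    let ψ : MvPolynomial (Exponent k p) K →ₐ[K] MvPolynomial (Fin k) B :=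
      aeval fun m => if h : ∃ j, axisExponent hp1 i₀ j = m then X h.choose else C (X ⟨m, h⟩)
    have hψ : ∀ j, ψ (X (axisExponent hp1 i₀ j)) = X j := fun j => by
      have h : ∃ j', axisExponent hp1 i₀ j' = axisExponent hp1 i₀ j := ⟨j, rfl⟩
      rw [aeval_X, dif_pos h, axisExponent_injective hp1 i₀ h.choose_spec]
    have hψ' : ∀ c : B, ψ (rename Subtype.val c) = C c := fun c => by
      have : ψ.comp (rename Subtype.val) = (IsScalarTower.toAlgHom K B (MvPolynomial (Fin k) B)) := by
        ext1 m
        rw [AlgHom.comp_apply, rename_X, aeval_X, dif_neg m.2]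
        rfl
      exact DFunLike.congr_fun this c
    let ex : ι → Fin k →₀ ℕ := fun s => s.2.1.update i₀ s.1
    -- The exponent `s.2 i₀` is overwritten by `s.1` but can be recovered, since the total degree of
    -- `s.2` is `J`.
    have hex : Function.Injective ex := by
      rintro ⟨i, β, hβ⟩ ⟨i', β', hβ'⟩ h
      have h1 : ∀ j, j ≠ i₀ → β j = β' j := fun j hj => by
        simpa [ex, hj] using DFunLike.congr_fun h j
      have h2 : i = i' := by
        have := DFunLike.congr_fun h i₀
        simp only [ex, Finsupp.update_apply, if_true] at this
        exact Fin.ext this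
      have h3 : β i₀ = β' i₀ := by
        rw [Finsupp.degree_eq_sum, Fintype.sum_eq_add_sum_subtype_ne _ i₀] at hβ hβ'
        rw [Finset.sum_congr rfl fun j _ => h1 j.1 j.2] at hβ
        omega
      have h4 : β = β' := by
        ext j
        by_cases hj : j = i₀
        · rw [hj, h3]
        · exact h1 j hj
      subst h2 h4; rfl
    have hmon : ∀ s, ψ (mon s) = monomial (ex s) 1 := fun s => by
      rw [map_mul, map_prod, map_pow, hψ, monomial_eq, C_1, one_mul,
        Finsupp.prod_fintype _ _ (by simp), Fintype.prod_eq_mul_prod_subtype_ne _ i₀, mul_comm]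
      congr 1
      · simp [ex]
      · refine Finset.prod_congr rfl fun j _ => ?_
        rw [map_pow, hψ]; simp [ex, j.2]
    have h1 := congrArg ψ h0
    rw [map_zero, map_sum] at h1
    simp only [map_mul, hψ', hmon, C_mul_monomial, mul_one] at h1
    apply hb0
    funext s
    have h2 := congrArg (coeff (ex s)) h1
    rw [coeff_sum, coeff_zero, Finset.sum_eq_single s] at h2
    · rwa [coeff_monomial, if_pos rfl] at h2
    · intro s' _ hs'
      rw [coeff_monomial, if_neg fun h => hs' (hex h)]
    · simp
  · refine (degreeOf_sum_le _ _ _).trans (Finset.sup_le fun s _ => (degreeOf_mul_le _ _ _).trans ?_)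
    have h1 : degreeOf (axisExponent hp1 i₀ i₀) (rename Subtype.val (b s)) = 0 := by
      by_contra h
      obtain ⟨m, -, hm⟩ := mem_vars_rename _ _ (mem_vars_iff_degreeOf_ne_zero.2 h)
      exact m.2 ⟨i₀, hm.symm⟩
    have h2 : degreeOf (axisExponent hp1 i₀ i₀) (mon s) ≤ s.1 := by
      refine (degreeOf_mul_le _ _ _).trans ?_
      rw [degreeOf_X_self_pow, add_le_iff_nonpos_left]
      refine (degreeOf_prod_le _ _ _).trans (Finset.sum_nonpos fun j _ => ?_)
      rw [degreeOf_X_pow_of_ne _ fun h => j.2 (axisExponent_injective hp1 i₀ h).symm]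
    rw [h1, zero_add]
    exact h2.trans (Nat.lt_succ_iff.1 s.1.2)

end Relation

/-! ### The classical discriminant is closed -/

section Closed

variable {k p : ℕ}

/-- Only the component of `Q` in degree `s` can contribute in degree `s + t`. This lets the
coefficients of an ideal membership be truncated to a fixed degree. -/
lemma coeff_mul_eq_coeff_form_mul {R : Type*} [CommRing R] {s t : ℕ} (Q : MvPolynomial (Fin k) R)
    {G : MvPolynomial (Fin k) R} (hG : G.IsHomogeneous t) {m : Fin k →₀ ℕ} (hm : m.degree = s + t) :
    coeff m (Q * G) = coeff m (form (coeffs s Q) * G) := by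
  classical
  rw [coeff_mul, coeff_mul]
  refine Finset.sum_congr rfl fun x hx => ?_
  rw [Finset.HasAntidiagonal.mem_antidiagonal] at hx
  by_cases h2 : x.2.degree = t
  · have h1 : x.1.degree = s := by
      rw [← hx, map_add, h2] at hm
      exact add_right_cancel hm
    congr 1
    exact (congrFun (coeffs_form (coeffs s Q)) ⟨x.1, h1⟩).symm
  · rw [hG.coeff_eq_zero h2, mul_zero, mul_zero]

/-- The monomials of large degree are combinations of the partial derivatives of a form which
defines a smooth hypersurface. -/
lemma exists_monomial_eq_sum {L : Type*} [Field L] [CharZero L] (hp : 1 ≤ p) (hk : 0 < k)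
    {F : MvPolynomial (Fin k) L} (hF : F.IsHomogeneous p) (hs : IsSmoothForm F) :
    ∃ s : ℕ, ∀ m : Exponent k (s + (p - 1)), ∃ q : Fin k → Exponent k s → L,
      monomial m.1 1 = ∑ i, form (q i) * pderiv i F := by
  classical
  set I : Ideal (MvPolynomial (Fin k) L) := Ideal.span (Set.range fun i => pderiv i F) with hI
  -- By the Nullstellensatz: a common zero of the derivatives is also a zero of `F`, by Euler's
  -- formula in characteristic zero, so smoothness leaves only the origin.
  have hX : ∀ i, X i ∈ I.radical := by
    intro i
    rw [← vanishingIdeal_zeroLocus_eq_radical (K := AlgebraicClosure L), mem_vanishingIdeal_iff]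
    intro y hy
    have h1 : ∀ j, aeval y (pderiv j F) = 0 := fun j => hy _ (Ideal.subset_span ⟨j, rfl⟩)
    have h2 : aeval y F = 0 := by
      have h3 := congrArg (aeval y) hF.sum_X_mul_pderiv
      rw [map_sum, Finset.sum_eq_zero fun j _ => by rw [map_mul, h1, mul_zero], map_nsmul,
        nsmul_eq_mul, zero_eq_mul] at h3
      exact h3.resolve_left (Nat.cast_ne_zero.2 (by omega))
    have h0 : y = 0 := by
      by_contra h0
      exact hs y h0 ⟨h2, h1⟩
    rw [aeval_X, h0, Pi.zero_apply]
  choose n hn using hX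
  set N := ∑ i, n i
  have hN : ∀ i, X i ^ N ∈ I := fun i => by
    obtain ⟨c, hc⟩ := Nat.exists_eq_add_of_le
      (Finset.single_le_sum (f := n) (fun _ _ => Nat.zero_le _) (Finset.mem_univ i))
    rw [show N = n i + c from hc, pow_add]
    exact I.mul_mem_right _ (hn i)
  -- A monomial of degree at least `k * N` in `k` variables has some exponent at least `N`.
  refine ⟨k * N, fun m => ?_⟩
  obtain ⟨i, hi⟩ : ∃ i, N ≤ m.1 i := by
    by_contra! h
    have h1 : ∑ i, m.1 i < ∑ _i : Fin k, N :=
      Finset.sum_lt_sum_of_nonempty ⟨⟨0, hk⟩, Finset.mem_univ _⟩ fun i _ => h i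
    rw [← Finsupp.degree_eq_sum, m.2] at h1
    simp at h1
  have hmem : monomial m.1 (1 : L) ∈ I := by
    have : monomial m.1 (1 : L) = monomial (m.1 - Finsupp.single i N) 1 * X i ^ N := by
      rw [X_pow_eq_monomial, monomial_mul, mul_one,
        tsub_add_cancel_of_le (Finsupp.single_le_iff.2 hi)]
    rw [this]
    exact I.mul_mem_left _ (hN i)
  obtain ⟨q, hq⟩ := Ideal.mem_span_range_iff_exists_fun.1 hmem
  refine ⟨fun i => coeffs _ (q i), ?_⟩
  refine coeffs_injective (p := k * N + (p - 1)) (isHomogeneous_monomial _ m.2)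
    (IsHomogeneous.sum _ _ _ fun j _ => (isHomogeneous_form _).mul hF.pderiv) ?_
  funext m'
  rw [← hq]
  simp only [coeffs, coeff_sum]
  exact Finset.sum_congr rfl fun j _ => coeff_mul_eq_coeff_form_mul _ hF.pderiv m'.2

/-- The coefficients of the combinations of the partial derivatives of `F` with coefficients `q`. -/
def derivMatrix {A : Type*} [CommRing A] {s r : ℕ} (F : MvPolynomial (Fin k) A)
    (q : Exponent k r → Fin k → Exponent k s → A) : Matrix (Exponent k r) (Exponent k r) A :=
  Matrix.of fun m => coeffs r (∑ i, form (q m i) * pderiv i F)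

lemma map_derivMatrix {A B : Type*} [CommRing A] [CommRing B] {s r : ℕ} (φ : A →+* B)
    (F : MvPolynomial (Fin k) A) (q : Exponent k r → Fin k → Exponent k s → A) :
    φ.mapMatrix (derivMatrix F q) = derivMatrix (map φ F) fun m i n => φ (q m i n) := by
  ext m m'
  simp only [RingHom.mapMatrix_apply, Matrix.map_apply, derivMatrix, Matrix.of_apply]
  rw [← coeffs_map, map_sum]
  simp only [map_mul, map_form, pderiv_map]

/-- The vector of the values at `y` of all monomials is nonzero and lies in the kernel, because
every combination of the derivatives vanishes at `y`. -/
lemma det_derivMatrix_eq_zero {A : Type*} [CommRing A] [IsDomain A] {s : ℕ}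
    {F : MvPolynomial (Fin k) A} (hF : F.IsHomogeneous p) {y : Fin k → A} (hy : y ≠ 0)
    (h : ∀ i, eval y (pderiv i F) = 0)
    (q : Exponent k (s + (p - 1)) → Fin k → Exponent k s → A) : (derivMatrix F q).det = 0 := by
  classical
  refine Matrix.exists_mulVec_eq_zero_iff.1 ⟨fun m => ∏ i, y i ^ m.1 i, ?_, ?_⟩
  · obtain ⟨i, hi⟩ := Function.ne_iff.1 hy
    intro h0
    have := congrFun h0 ⟨Finsupp.single i (s + (p - 1)), Finsupp.degree_single _ _⟩
    simp only [Pi.zero_apply, Finset.prod_eq_zero_iff] at this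
    obtain ⟨j, -, hj⟩ := this
    by_cases hij : i = j
    · subst hij
      exact pow_ne_zero _ hi hj
    · simp [Finsupp.single_eq_of_ne' hij] at hj
  · funext m
    set P := ∑ i, form (q m i) * pderiv i F with hP
    have hPh : P.IsHomogeneous (s + (p - 1)) :=
      IsHomogeneous.sum _ _ _ fun i _ => (isHomogeneous_form _).mul hF.pderiv
    have h1 : eval y P = 0 := by
      rw [hP, map_sum]
      exact Finset.sum_eq_zero fun i _ => by rw [map_mul, h, mul_zero]
    rw [← form_coeffs hPh, form, map_sum] at h1
    rw [Pi.zero_apply, ← h1]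
    refine Finset.sum_congr rfl fun m' _ => ?_
    rw [eval_monomial, Finsupp.prod_fintype _ _ (by simp)]
    rfl

variable (k p) in
/-- The determinant of the matrix `derivMatrix` of the generic form. -/
def derivDet (K : Type*) [Field K] (s r : ℕ) :
    MvPolynomial (Exponent k r × Fin k × Exponent k s) (MvPolynomial (Exponent k p) K) :=
  (derivMatrix (form fun m => C (X m)) fun m i n => X (m, i, n) : Matrix (Exponent k r)
    (Exponent k r) (MvPolynomial (Exponent k r × Fin k × Exponent k s)
      (MvPolynomial (Exponent k p) K))).det

lemma map_derivDet {K : Type*} [Field K] (s r : ℕ) {S : Type*} [CommRing S] [Algebra K S]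
    {H : MvPolynomial (Fin k) S} (hH : H.IsHomogeneous p) :
    map ((aeval (coeffs p H) : _ →ₐ[K] S) : MvPolynomial (Exponent k p) K →+* S)
      (derivDet k p K s r) =
      (derivMatrix (map C H) fun m i n => X (m, i, n)).det := by
  rw [derivDet, RingHom.map_det, map_derivMatrix]
  congr 2
  · rw [map_form]
    conv_rhs => rw [← form_coeffs hH, map_form]
    congr 1; funext m
    rw [map_C]
    simp
  · funext m i n
    rw [map_X]

/-- The classical discriminant is defined, over any field, by polynomials over `K`. -/
lemma exists_mem_discriminantIdeal_aeval_ne_zero {K : Type*} [Field K] [IsAlgClosed K]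
    {L : Type*} [Field L] [CharZero L] [Algebra K L] (hp : 1 ≤ p) (hk : 0 < k)
    {F : MvPolynomial (Fin k) L} (hF : F.IsHomogeneous p) (hs : IsSmoothForm F) :
    ∃ D ∈ discriminantIdeal K k p, aeval (coeffs p F) D ≠ 0 := by
  classical
  obtain ⟨s, hsum⟩ := exists_monomial_eq_sum hp hk hF hs
  choose q hq using hsum
  let β := Exponent k (s + (p - 1)) × Fin k × Exponent k s
  let G := derivDet k p K s (s + (p - 1))
  have h1 : map ((aeval (coeffs p F) : _ →ₐ[K] L) : MvPolynomial (Exponent k p) K →+* L) G ≠ 0 := by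
    intro h0
    -- For the multipliers `q` that express the monomials through the derivatives of `F`, the matrix
    -- becomes the identity, so the determinant cannot vanish identically.
    have h2 := congrArg (eval fun x : β => q x.1 x.2.1 x.2.2) h0
    rw [map_derivDet s _ hF, map_zero, RingHom.map_det, map_derivMatrix] at h2
    have h3 : derivMatrix F q = 1 := by
      ext m m'
      rw [derivMatrix, Matrix.of_apply, ← hq m, coeffs, coeff_monomial, Matrix.one_apply]
      simp only [Subtype.val_inj]
    have h4 : map (eval fun x : β => q x.1 x.2.1 x.2.2) (map C F) = F := by
      rw [MvPolynomial.map_map]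
      convert MvPolynomial.map_id F
      ext; simp
    simp only [eval_X, h4] at h2
    rw [h3, Matrix.det_one] at h2
    exact one_ne_zero h2
  -- The determinant is a polynomial in the auxiliary multipliers. Each of its coefficients is a
  -- polynomial over `K` that vanishes at all singular forms, and one of them is nonzero at `F`.
  obtain ⟨d, hd⟩ := ne_zero_iff.1 h1
  refine ⟨coeff d G, ?_, by rwa [coeff_map] at hd⟩
  rw [mem_discriminantIdeal_iff]
  intro F₀ hF₀ y hy hs₀
  have h2 := congrArg (coeff d) (map_derivDet (K := K) s (s + (p - 1)) hF₀)
  rw [coeff_map, det_derivMatrix_eq_zero (hF₀.map C) (y := fun i => C (y i)), coeff_zero] at h2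
  · exact h2
  · intro h0
    apply hy
    funext i
    simpa using congrFun h0 i
  · exact fun i => ((hs₀.map C).2 i)

end Closed

/-! ### The equation of the classical discriminant -/

section Generator

variable {k p : ℕ} {K : Type v} [Field K]

/-- The action of a matrix on the functions on the space of forms, by linear substitution. -/
def substAct (A : Matrix (Fin k) (Fin k) K) :
    MvPolynomial (Exponent k p) K →ₐ[K] MvPolynomial (Exponent k p) K :=
  aeval (coeffs p (linSubst (A.map C) (form fun m => X m)))

lemma eval_substAct (A : Matrix (Fin k) (Fin k) K) {F : MvPolynomial (Fin k) K}
    (hF : F.IsHomogeneous p) (D : MvPolynomial (Exponent k p) K) :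
    eval (coeffs p F) (substAct A D) = eval (coeffs p (linSubst A F)) D := by
  let φ : MvPolynomial (Exponent k p) K →ₐ[K] K := aeval (coeffs p F)
  have h1 : (A.map C).map (φ : MvPolynomial (Exponent k p) K →+* K) = A := by
    ext i j
    exact φ.commutes (A i j)
  have h2 : form (fun m => (φ : MvPolynomial (Exponent k p) K →+* K) (X m)) = F := by
    conv_rhs => rw [← form_coeffs hF]
    congr 1
    funext m
    exact aeval_X _ _
  have h3 := algHom_aeval_coeffs φ (linSubst (A.map C) (form fun m => X m)) D
  rw [map_linSubst, map_form, h1, h2] at h3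
  exact h3

lemma funext_forms [Infinite K] {D D' : MvPolynomial (Exponent k p) K}
    (h : ∀ F : MvPolynomial (Fin k) K, F.IsHomogeneous p →
      eval (coeffs p F) D = eval (coeffs p F) D') : D = D' :=
  MvPolynomial.funext fun c => by simpa using h (form c) (isHomogeneous_form c)

lemma substAct_substAct [Infinite K] (A B : Matrix (Fin k) (Fin k) K)
    (D : MvPolynomial (Exponent k p) K) : substAct B (substAct A D) = substAct (B * A) D :=
  funext_forms fun F hF => by
    rw [eval_substAct B hF, eval_substAct A (isHomogeneous_linSubst hF B), linSubst_linSubst,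
      eval_substAct _ hF]

lemma substAct_one [Infinite K] (D : MvPolynomial (Exponent k p) K) : substAct 1 D = D :=
  funext_forms fun F hF => by rw [eval_substAct 1 hF, linSubst_one]

/-- `D` is an equation of the classical discriminant. -/
def IsDiscriminant (D : MvPolynomial (Exponent k p) K) : Prop :=
  D ≠ 0 ∧ discriminantIdeal K k p = Ideal.span {D}

variable {D : MvPolynomial (Exponent k p) K}

lemma IsDiscriminant.mem (hD : IsDiscriminant D) : D ∈ discriminantIdeal K k p :=
  hD.2 ▸ Ideal.mem_span_singleton_self D

lemma IsDiscriminant.dvd (hD : IsDiscriminant D) {E : MvPolynomial (Exponent k p) K}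
    (hE : E ∈ discriminantIdeal K k p) : D ∣ E := by
  rwa [hD.2, Ideal.mem_span_singleton] at hE

variable (k p K) in
/-- The form `∑ X i ^ p`. -/
def fermat : MvPolynomial (Fin k) K := ∑ i, X i ^ p

lemma isHomogeneous_fermat : (fermat k p K).IsHomogeneous p :=
  IsHomogeneous.sum _ _ _ fun i _ => isHomogeneous_X_pow i p

lemma isSmoothForm_fermat [CharZero K] (hp : 2 ≤ p) : IsSmoothForm (fermat k p K) := by
  intro y hy h
  apply hy
  funext i
  have h1 := h.2 i
  rw [fermat, map_sum, Finset.sum_eq_single i (fun j _ hj => by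
    rw [pderiv_pow, pderiv_X_of_ne hj, mul_zero]) (by simp), pderiv_pow, pderiv_X_self, mul_one,
    map_mul, map_natCast, map_pow, aeval_X, mul_eq_zero] at h1
  exact pow_eq_zero_iff (by omega) |>.1 (h1.resolve_left (by
    have : CharZero (AlgebraicClosure K) := charZero_of_injective_algebraMap
      (algebraMap K (AlgebraicClosure K)).injective
    exact Nat.cast_ne_zero.2 (by omega)))

variable [IsAlgClosed K]

/-- If `F` is singular at `y`, then `F ∘ A` is singular at `A⁻¹ y`. -/
lemma substAct_mem {A : Matrix (Fin k) (Fin k) K} (hA : A.det ≠ 0)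
    (hD : D ∈ discriminantIdeal K k p) :
    substAct A D ∈ discriminantIdeal K k p := by
  rw [mem_discriminantIdeal_iff] at hD ⊢
  intro F hF y hy hs
  have hA' : IsUnit A.det := isUnit_iff_ne_zero.2 hA
  have h1 : A.mulVec (A⁻¹.mulVec y) = y := by
    rw [Matrix.mulVec_mulVec, Matrix.mul_nonsing_inv _ hA', Matrix.one_mulVec]
  rw [eval_substAct A hF]
  refine hD _ (isHomogeneous_linSubst hF A) (A⁻¹.mulVec y) (fun h0 => hy ?_)
    (IsSingularAt.linSubst (by rwa [h1]))
  rw [← h1, h0, Matrix.mulVec_zero]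

/-- The ideal is prime and nonzero, and none of its nonzero elements is free of the coefficient of
`X i₀ ^ p`; `eq_span_of_degreeOf` applies with that coefficient as the distinguished variable. -/
lemma exists_isDiscriminant [CharZero K] (hp : 2 ≤ p) (hk : 0 < k) :
    ∃ D : MvPolynomial (Exponent k p) K, IsDiscriminant D := by
  let i₀ : Fin k := ⟨0, hk⟩
  have hp1 : 1 ≤ p := one_le_two.trans hp
  obtain ⟨E, hE, hE0, -⟩ := exists_mem_discriminantIdeal (K := K) hp i₀
  have hne : discriminantIdeal K k p ≠ ⊥ := fun h => hE0 (by rwa [h, Ideal.mem_bot] at hE)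
  have hprime := isPrime_discriminantIdeal (K := K) hp1 i₀
  obtain ⟨D, hD⟩ := eq_span_of_degreeOf (axisExponent hp1 i₀ i₀) (discriminantIdeal K k p) hne
    fun c hc h0 => eq_zero_of_discParam_eq_zero hp i₀
      ((mem_discriminantIdeal_iff_discParam hp1 i₀).1 hc) h0
  refine ⟨D, ?_, hD⟩
  rintro rfl
  exact hne (by rw [hD, Ideal.span_singleton_eq_bot])

lemma IsDiscriminant.degreeOf_le (hD : IsDiscriminant D) (hp : 2 ≤ p) (i : Fin k) :
    D.degreeOf (axisExponent (one_le_two.trans hp) i i) ≤ (p - 1) ^ (k - 1) := by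
  obtain ⟨E, hE, hE0, hdeg⟩ := exists_mem_discriminantIdeal (K := K) hp i
  obtain ⟨Q, rfl⟩ := hD.dvd hE
  rw [degreeOf_mul_eq (left_ne_zero_of_mul hE0) (right_ne_zero_of_mul hE0)] at hdeg
  exact (Nat.le_add_right _ _).trans hdeg

lemma IsDiscriminant.aeval_ne_zero (hD : IsDiscriminant D) {L : Type*} [Field L] [CharZero L]
    [Algebra K L] (hp : 1 ≤ p) (hk : 0 < k) {F : MvPolynomial (Fin k) L} (hF : F.IsHomogeneous p)
    (hs : IsSmoothForm F) : aeval (coeffs p F) D ≠ 0 := by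
  obtain ⟨E, hE, hE0⟩ := exists_mem_discriminantIdeal_aeval_ne_zero (K := K) hp hk hF hs
  obtain ⟨Q, rfl⟩ := hD.dvd hE
  rw [map_mul] at hE0
  exact left_ne_zero_of_mul hE0

/-- `D` divides its translates by `A` and by `A⁻¹`, so the quotients are units of a polynomial ring
over a field, that is, nonzero constants. -/
lemma IsDiscriminant.exists_character (hD : IsDiscriminant D) {A : Matrix (Fin k) (Fin k) K}
    (hA : A.det ≠ 0) : ∃ χ : K, χ ≠ 0 ∧ substAct A D = C χ * D := by
  have hA' : IsUnit A.det := isUnit_iff_ne_zero.2 hA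
  have hB : A⁻¹.det ≠ 0 := by
    rw [Matrix.det_nonsing_inv, Ring.inverse_eq_inv']; exact inv_ne_zero hA
  obtain ⟨Q, hQ⟩ := hD.dvd (substAct_mem hA hD.mem)
  obtain ⟨Q', hQ'⟩ := hD.dvd (substAct_mem hB hD.mem)
  have h1 : substAct A⁻¹ (substAct A D) = D := by
    rw [substAct_substAct, Matrix.nonsing_inv_mul _ hA', substAct_one]
  rw [hQ, map_mul, hQ', mul_assoc, mul_eq_left₀ hD.1] at h1
  have h2 : IsUnit (substAct A⁻¹ Q) := .of_mul_eq_one _ ((mul_comm _ _).trans h1)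
  have h3 := h2.map (substAct A)
  rw [substAct_substAct, Matrix.mul_nonsing_inv _ hA', substAct_one] at h3
  obtain ⟨χ, hχ, rfl⟩ := isUnit_iff_eq_C_of_isReduced.1 h3
  exact ⟨χ, hχ.ne_zero, by rw [hQ, mul_comm]⟩

omit [IsAlgClosed K] in
lemma substAct_diagonal (b : Fin k → K) (D : MvPolynomial (Exponent k p) K) :
    substAct (Matrix.diagonal b) D = aeval (fun m => C (∏ i, b i ^ m.1 i) * X m) D := by
  rw [substAct]
  congr 2
  funext m
  have h1 : (Matrix.diagonal b).map (C : K → MvPolynomial (Exponent k p) K) =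
      Matrix.diagonal fun i => C (b i) := by
    rw [Matrix.diagonal_map (map_zero C)]
  rw [h1, coeffs, coeff_linSubst_diagonal]
  change _ * coeffs p _ m = _
  rw [coeffs_form, map_prod]
  simp only [map_pow]

/-- The weight of a monomial in the coefficients of a form with respect to the `i`-th variable. -/
def coeffWeight (i : Fin k) (d : Exponent k p →₀ ℕ) : ℕ := ∑ m, d m * m.1 i

/-- Scaling the `i`-th variable by `2` multiplies each monomial of `D` by `2` to its weight, and `D`
as a whole by one constant. Distinct powers of `2` are distinct in characteristic zero. -/
lemma IsDiscriminant.exists_weight [CharZero K] (hD : IsDiscriminant D) (i : Fin k) :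
    ∃ N, ∀ d, coeff d D ≠ 0 → coeffWeight i d = N := by
  classical
  obtain ⟨χ, -, hχ⟩ := hD.exists_character (A := Matrix.diagonal (Pi.mulSingle i 2))
    (by rw [Matrix.det_diagonal, Finset.prod_pi_mulSingle' i 2]; simp)
  have h1 : ∀ d, coeff d D ≠ 0 → (2 : K) ^ coeffWeight i d = χ := by
    intro d hd
    have h2 := congrArg (coeff d) hχ
    rw [substAct_diagonal, coeff_aeval_C_mul_X, coeff_C_mul] at h2
    rw [← mul_right_cancel₀ hd h2, coeffWeight, ← Finset.prod_pow_eq_pow_sum]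
    refine Finset.prod_congr rfl fun m _ => ?_
    rw [Finset.prod_eq_single i (fun j _ hj => by simp [hj]) (by simp), Pi.mulSingle_eq_same,
      ← pow_mul, mul_comm]
  obtain ⟨d₀, hd₀⟩ := ne_zero_iff.1 hD.1
  refine ⟨coeffWeight i d₀, fun d hd => ?_⟩
  have h2 := (h1 d hd).trans (h1 d₀ hd₀).symm
  have h3 : (2 ^ coeffWeight i d : ℕ) = 2 ^ coeffWeight i d₀ := by exact_mod_cast h2
  exact Nat.pow_right_injective le_rfl h3

/-- Since the Fermat form is smooth, `D` does not vanish there, so some monomial of `D` contains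
only coefficients of pure powers. -/
lemma IsDiscriminant.exists_fermat_monomial [CharZero K] (hD : IsDiscriminant D) (hp : 2 ≤ p)
    (hk : 0 < k) : ∃ d, coeff d D ≠ 0 ∧
      ∀ i, coeffWeight i d = d (axisExponent (one_le_two.trans hp) i i) * p := by
  classical
  have hp1 : 1 ≤ p := one_le_two.trans hp
  have h1 := hD.aeval_ne_zero (L := K) hp1 hk isHomogeneous_fermat (isSmoothForm_fermat hp)
  rw [aeval_def, eval₂_eq'] at h1
  obtain ⟨d, hd, hd0⟩ := Finset.exists_ne_zero_of_sum_ne_zero h1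
  refine ⟨d, mem_support_iff.1 hd, fun i => ?_⟩
  have h2 : ∀ m, d m ≠ 0 → ∃ j, m = axisExponent hp1 j j := by
    intro m hm
    have h3 := right_ne_zero_of_mul hd0
    rw [Finset.prod_ne_zero_iff] at h3
    have h4 : coeffs p (fermat k p K) m ≠ 0 := fun h0 => h3 m (Finset.mem_univ _) (by
      rw [h0, zero_pow hm])
    rw [coeffs, fermat, coeff_sum] at h4
    obtain ⟨j, -, hj⟩ := Finset.exists_ne_zero_of_sum_ne_zero h4
    rw [coeff_X_pow] at hj
    refine ⟨j, Subtype.ext ?_⟩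
    rw [axisExponent_self]
    by_contra h
    exact hj (if_neg fun h' => h h'.symm)
  rw [coeffWeight, Finset.sum_eq_single (axisExponent hp1 i i)]
  · rw [axisExponent_self, Finsupp.single_eq_same]
  · intro m _ hm
    by_cases h0 : d m = 0
    · rw [h0, zero_mul]
    · obtain ⟨j, rfl⟩ := h2 m h0
      have hji : j ≠ i := fun h => hm (by rw [h])
      rw [axisExponent_self, Finsupp.single_eq_of_ne' hji, mul_zero]
  · simp

end Generator

/-! ### Lower bound by counting critical values; weights and degree of the discriminant -/

section Degree

variable {k p : ℕ} {K : Type v} [Field K]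

/-- A form with `(p - 1) ^ (k - 1)` critical points in the chart `X i = 1`, with indeterminate
coefficient of `X i ^ p`. -/
def criticalFamily (k p : ℕ) (K : Type v) [Field K] (i : Fin k) :
    MvPolynomial (Fin k) (Polynomial (MvPolynomial (Fin k) K)) :=
  C Polynomial.X * X i ^ p + ∑ j : {j // j ≠ i}, (X j.1 ^ p -
    C (Polynomial.C ((p : MvPolynomial (Fin k) K) * X j.1 ^ (p - 1))) * (X j.1 * X i ^ (p - 1)))

lemma isHomogeneous_criticalFamily (hp : 1 ≤ p) (i : Fin k) :
    (criticalFamily k p K i).IsHomogeneous p := by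
  refine (isHomogeneous_C_mul_X_pow _ _ _).add (IsHomogeneous.sum _ _ _ fun j _ =>
    (isHomogeneous_X_pow _ _).sub (IsHomogeneous.C_mul ?_ _))
  have := (isHomogeneous_X (Polynomial (MvPolynomial (Fin k) K)) j.1).mul
    (isHomogeneous_X_pow i (p - 1))
  rwa [Nat.add_sub_cancel' hp] at this

lemma natDegree_coeffs_criticalFamily_le (hp : 1 ≤ p) (i : Fin k) (m : Exponent k p) :
    (coeffs p (criticalFamily k p K i) m).natDegree ≤ if m = axisExponent hp i i then 1 else 0 := by
  classical
  have h1 : ∀ j : {j // j ≠ i}, coeff m.1 ((X j.1 ^ p -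
    C (Polynomial.C ((p : MvPolynomial (Fin k) K) * X j.1 ^ (p - 1))) * (X j.1 * X i ^ (p - 1))) :
      MvPolynomial (Fin k) (Polynomial (MvPolynomial (Fin k) K))) ∈
        (Polynomial.C : MvPolynomial (Fin k) K →+* _).range := fun j => by
    have h2 : (X j.1 * X i ^ (p - 1) : MvPolynomial (Fin k) (Polynomial (MvPolynomial (Fin k) K))) =
        monomial (axisExponent hp i j.1).1 1 := by
      rw [axisExponent, X_pow_eq_monomial, X, monomial_mul, mul_one]
    rw [coeff_sub, coeff_C_mul, coeff_X_pow, h2, coeff_monomial]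
    refine Subring.sub_mem _ ?_ (Subring.mul_mem _ ⟨_, rfl⟩ ?_)
    · split_ifs
      exacts [Subring.one_mem _, Subring.zero_mem _]
    · split_ifs
      exacts [Subring.one_mem _, Subring.zero_mem _]
  obtain ⟨c, hc⟩ := Subring.sum_mem _ fun (j : {j // j ≠ i}) (_ : j ∈ Finset.univ) => h1 j
  rw [coeffs, criticalFamily, coeff_add, coeff_sum, ← hc, Polynomial.natDegree_add_C, coeff_C_mul,
    coeff_X_pow]
  by_cases hm : m = axisExponent hp i i
  · rw [if_pos hm]
    split_ifs <;> simp
  · rw [if_neg hm, if_neg fun h => hm (Subtype.ext (by rw [axisExponent_self, h])), mul_zero,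
      Polynomial.natDegree_zero]

/-- The polynomial obtained by restricting `D` to the family `criticalFamily`. -/
def criticalPolynomial (i : Fin k) (D : MvPolynomial (Exponent k p) K) :
    Polynomial (MvPolynomial (Fin k) K) :=
  aeval (coeffs p (criticalFamily k p K i)) D

/-- Only the coefficient of `X i ^ p` involves the parameter, and `p` times its exponent is bounded
by the weight. -/
lemma natDegree_criticalPolynomial_le (hp : 1 ≤ p) (i : Fin k)
    {D : MvPolynomial (Exponent k p) K} {N : ℕ} (hN : ∀ d, coeff d D ≠ 0 → coeffWeight i d = N * p) :
    (criticalPolynomial i D).natDegree ≤ N := by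
  rw [criticalPolynomial, aeval_def, eval₂_eq']
  refine Polynomial.natDegree_sum_le_of_forall_le _ _ fun d hd => ?_
  refine (Polynomial.natDegree_mul_le).trans ?_
  have h0 : (algebraMap K (Polynomial (MvPolynomial (Fin k) K)) (coeff d D)).natDegree = 0 :=
    Polynomial.natDegree_C _
  rw [h0, zero_add]
  refine (Polynomial.natDegree_prod_le _ _).trans ?_
  have h1 : ∑ m, (coeffs p (criticalFamily k p K i) m ^ d m).natDegree ≤
      ∑ m, if m = axisExponent hp i i then d m else 0 := by
    refine Finset.sum_le_sum fun m _ => Polynomial.natDegree_pow_le.trans ?_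
    refine (Nat.mul_le_mul_left _ (natDegree_coeffs_criticalFamily_le hp i m)).trans ?_
    split_ifs <;> simp
  refine h1.trans ?_
  rw [Finset.sum_ite_eq' Finset.univ, if_pos (Finset.mem_univ _)]
  have h2 := hN d (mem_support_iff.1 hd)
  have h3 := Finset.single_le_sum (f := fun m : Exponent k p => d m * m.1 i)
    (fun _ _ => Nat.zero_le _) (Finset.mem_univ (axisExponent hp i i))
  simp only [axisExponent_self, Finsupp.single_eq_same] at h3
  rw [← coeffWeight, h2] at h3
  exact Nat.le_of_mul_le_mul_right h3 hp

variable [IsAlgClosed K] [CharZero K] {D : MvPolynomial (Exponent k p) K}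

/-- Setting the parameter to `1` and the other indeterminates to `0` specialises the family to the
smooth Fermat form. -/
lemma IsDiscriminant.criticalPolynomial_ne_zero (hD : IsDiscriminant D) (hp : 2 ≤ p)
    (i : Fin k) : criticalPolynomial i D ≠ 0 := by
  intro h0
  let φ : Polynomial (MvPolynomial (Fin k) K) →ₐ[K] K :=
    (aeval (0 : Fin k → K)).comp ((Polynomial.aeval (1 : MvPolynomial (Fin k) K)).restrictScalars K)
  have h1 := algHom_aeval_coeffs φ (criticalFamily k p K i) D
  rw [← criticalPolynomial, h0, map_zero] at h1
  have h2 : map (φ : Polynomial (MvPolynomial (Fin k) K) →+* K) (criticalFamily k p K i) =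
      fermat k p K := by
    rw [fermat, Fintype.sum_eq_add_sum_subtype_ne _ i, criticalFamily, map_add, map_sum]
    congr 1
    · simp [φ]
    · refine Finset.sum_congr rfl fun j _ => ?_
      have hp0 : p - 1 ≠ 0 := by omega
      simp [φ, hp0]
  rw [h2] at h1
  exact hD.aeval_ne_zero (L := K) (one_le_two.trans hp) i.pos isHomogeneous_fermat
    (isSmoothForm_fermat hp) h1.symm

omit [CharZero K] in
-- In the chart, the critical points are given by `y j ^ (p - 1) = X j ^ (p - 1)`, hence by `y j = ζ
-- j * X j`. The stated value of the parameter is minus the critical value of the remaining terms,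
-- so the form becomes singular there, over the polynomial ring.
lemma IsDiscriminant.isRoot_criticalPolynomial (hD : IsDiscriminant D) (hp : 2 ≤ p) (i : Fin k)
    (ζ : {j // j ≠ i} → K) (hζ : ∀ j, ζ j ^ (p - 1) = 1) : (criticalPolynomial i D).eval
      (∑ j, C ((p - 1) * ζ j) * X j.1 ^ p) = 0 := by
  classical
  have hp1 : 1 ≤ p := one_le_two.trans hp
  set T : MvPolynomial (Fin k) K := ∑ j, C ((p - 1) * ζ j) * X j.1 ^ p with hT
  clear_value T
  let φ : Polynomial (MvPolynomial (Fin k) K) →ₐ[K] MvPolynomial (Fin k) K :=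
    (Polynomial.aeval T).restrictScalars K
  have h1 := algHom_aeval_coeffs φ (criticalFamily k p K i) D
  rw [← criticalPolynomial] at h1
  refine (show _ = φ (criticalPolynomial i D) by simp [φ, Polynomial.coe_aeval_eq_eval]).trans
    (h1.trans ?_)
  have hζ' : ∀ j, ζ j ^ p = ζ j := fun j => by
    rw [← Nat.sub_add_cancel hp1, pow_succ, hζ, one_mul]
  have hmap : map (φ : Polynomial (MvPolynomial (Fin k) K) →+* MvPolynomial (Fin k) K)
      (criticalFamily k p K i) = C T * X i ^ p + ∑ j : {j // j ≠ i}, (X j.1 ^ p -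
        C ((p : MvPolynomial (Fin k) K) * X j.1 ^ (p - 1)) * (X j.1 * X i ^ (p - 1))) := by
    simp [criticalFamily, φ]
  let y : Fin k → MvPolynomial (Fin k) K := fun j => if h : j = i then 1 else C (ζ ⟨j, h⟩) * X j
  have hyi : y i = 1 := dif_pos rfl
  have hyj : ∀ j : {j // j ≠ i}, y j = C (ζ j) * X j.1 := fun j => dif_neg j.2
  refine aeval_eq_zero_of_singular hp1 hD.mem ((isHomogeneous_criticalFamily hp1 i).map _)
    hyi ?_ ?_
  · rw [hmap, map_add, map_sum, map_mul, map_pow, eval_C, eval_X, hyi, one_pow, mul_one, hT,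
      ← Finset.sum_add_distrib]
    refine Finset.sum_eq_zero fun j _ => ?_
    simp only [map_sub, map_mul, map_pow, eval_X, eval_C, hyi, hyj, one_pow, mul_one, map_one,
      map_natCast]
    rw [mul_pow, ← map_pow, hζ']
    have : (X j.1 ^ p : MvPolynomial (Fin k) K) = X j.1 ^ (p - 1) * X j.1 := by
      rw [← pow_succ, Nat.sub_add_cancel hp1]
    rw [this]
    ring
  · intro j hj
    rw [hmap, map_add, map_sum, pderiv_C_mul, pderiv_pow, pderiv_X_of_ne (Ne.symm hj), mul_zero,
      mul_zero, zero_add, Finset.sum_eq_single (⟨j, hj⟩ : {j // j ≠ i})]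
    · rw [map_sub, pderiv_C_mul, pderiv_mul, pderiv_pow, pderiv_pow, pderiv_X_self,
        pderiv_X_of_ne (Ne.symm hj)]
      simp only [map_sub, map_mul, map_pow, eval_X, eval_C, hyi, hyj ⟨j, hj⟩, one_pow, mul_one,
        map_natCast, mul_zero, add_zero]
      rw [mul_pow, ← map_pow, hζ, map_one, map_one, one_mul, mul_one, sub_self]
    · rintro l - hl
      have hl' : l.1 ≠ j := fun h => hl (Subtype.ext h)
      rw [map_sub, pderiv_C_mul, pderiv_mul, pderiv_pow, pderiv_pow, pderiv_X_of_ne hl',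
        pderiv_X_of_ne (Ne.symm hj)]
      simp
    · simp

/-- The `k - 1` independent choices among the `p - 1` roots of unity give pairwise distinct roots,
as the coefficients of the indeterminates `X j ^ p` show which choice was made. -/
lemma IsDiscriminant.pow_le_natDegree (hD : IsDiscriminant D) (hp : 2 ≤ p) (i : Fin k) :
    (p - 1) ^ (k - 1) ≤ (criticalPolynomial i D).natDegree := by
  classical
  have : NeZero (p - 1) := ⟨by omega⟩
  obtain ⟨z, hz⟩ := HasEnoughRootsOfUnity.exists_primitiveRoot K (p - 1)
  let T : ({j // j ≠ i} → Fin (p - 1)) → MvPolynomial (Fin k) K := fun a =>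
    ∑ j, C (((p : K) - 1) * z ^ (a j : ℕ)) * X j.1 ^ p
  have hT : Function.Injective T := by
    intro a b hab
    funext j
    have hcoeff : ∀ a, coeff (Finsupp.single j.1 p) (T a) = ((p : K) - 1) * z ^ (a j : ℕ) := by
      intro a
      rw [coeff_sum, Finset.sum_eq_single j]
      · rw [coeff_C_mul, coeff_X_pow, if_pos rfl, mul_one]
      · intro l _ hl
        rw [coeff_C_mul, coeff_X_pow, if_neg, mul_zero]
        intro h
        exact hl (Subtype.ext (Finsupp.single_left_injective (by omega) h))
      · simp
    have h1 := (hcoeff a).symm.trans ((congrArg _ hab).trans (hcoeff b))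
    have h2 : ((p : K) - 1) ≠ 0 := by
      rw [sub_ne_zero]; exact_mod_cast (by omega : p ≠ 1)
    exact Fin.ext (hz.pow_inj (a j).2 (b j).2 (mul_left_cancel₀ h2 h1))
  have hroot : ∀ a, T a ∈ (criticalPolynomial i D).roots.toFinset := fun a => by
    rw [Multiset.mem_toFinset, Polynomial.mem_roots (hD.criticalPolynomial_ne_zero hp i)]
    refine hD.isRoot_criticalPolynomial hp i (fun j => z ^ (a j : ℕ)) fun j => ?_
    rw [← pow_mul, mul_comm, pow_mul, hz.pow_eq_one, one_pow]
  have h1 := Finset.card_le_card_of_injOn (s := Finset.univ) T (fun a _ => hroot a) hT.injOn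
  rw [Finset.card_univ, Fintype.card_fun, Fintype.card_fin, Fintype.card_subtype_compl,
    Fintype.card_fin, Fintype.card_subtype_eq] at h1
  exact h1.trans ((Multiset.toFinset_card_le _).trans (Polynomial.card_roots' _))

/-- The weights of the discriminant. -/
lemma IsDiscriminant.coeffWeight_eq (hD : IsDiscriminant D) (hp : 2 ≤ p) (i : Fin k)
    {d : Exponent k p →₀ ℕ} (hd : coeff d D ≠ 0) : coeffWeight i d = (p - 1) ^ (k - 1) * p := by
  obtain ⟨N, hN⟩ := hD.exists_weight i
  obtain ⟨d₀, hd₀, h⟩ := hD.exists_fermat_monomial hp i.pos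
  -- The common weight is read off from the monomial seen by the Fermat form; the exponent there is
  -- squeezed between the two bounds.
  have h1 : N = d₀ (axisExponent (one_le_two.trans hp) i i) * p := (hN _ hd₀).symm.trans (h i)
  have h2 := (degreeOf_le_iff.1 (hD.degreeOf_le hp i)) d₀ (mem_support_iff.2 hd₀)
  have h3 := (hD.pow_le_natDegree hp i).trans (natDegree_criticalPolynomial_le
    (one_le_two.trans hp) i fun d hd => (hN d hd).trans h1)
  rw [hN d hd, h1, le_antisymm h2 h3]

/-- The degree of the discriminant. -/
lemma IsDiscriminant.sum_eq (hD : IsDiscriminant D) (hp : 2 ≤ p)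
    {d : Exponent k p →₀ ℕ} (hd : coeff d D ≠ 0) : ∑ m, d m = k * (p - 1) ^ (k - 1) := by
  -- Every coefficient has total weight `p`, so the sum of the weights over all variables is `p`
  -- times the degree.
  have h1 : ∑ i, coeffWeight i d = k * ((p - 1) ^ (k - 1) * p) := by
    simp [hD.coeffWeight_eq hp _ hd]
  simp only [coeffWeight] at h1
  rw [Finset.sum_comm] at h1
  have h2 : ∀ m : Exponent k p, ∑ i, d m * m.1 i = d m * p := fun m => by
    rw [← Finset.mul_sum, ← Finsupp.degree_eq_sum, m.2]
  simp only [h2] at h1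
  rw [← Finset.sum_mul, ← mul_assoc] at h1
  exact Nat.eq_of_mul_eq_mul_right (by omega) h1

end Degree

/-! ### Covariance of the discriminant under linear substitutions over any base -/

section Covariance

variable {k p : ℕ} {K : Type v} [Field K] [IsAlgClosed K] [CharZero K]
  {D : MvPolynomial (Exponent k p) K}

lemma IsDiscriminant.substAct_diagonal (hD : IsDiscriminant D) (hp : 2 ≤ p) (b : Fin k → K) :
    substAct (Matrix.diagonal b) D =
      C ((Matrix.diagonal b).det ^ ((p - 1) ^ (k - 1) * p)) * D := by
  rw [TransDisc.substAct_diagonal]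
  ext d
  rw [coeff_aeval_C_mul_X, coeff_C_mul]
  by_cases hd : coeff d D = 0
  · rw [hd, mul_zero, mul_zero]
  congr 1
  simp only [← Finset.prod_pow, ← pow_mul]
  rw [Finset.prod_comm, Matrix.det_diagonal, ← Finset.prod_pow]
  refine Finset.prod_congr rfl fun i _ => ?_
  rw [← hD.coeffWeight_eq hp i hd, coeffWeight, Finset.prod_pow_eq_pow_sum]
  simp only [mul_comm]

/-- Along the one-parameter family of transvections, the character times the nonzero value of `D` at
the Fermat form is a polynomial in `c` without roots. Over an algebraically closed field it is
constant, and at `c = 0` the character is `1`. -/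
lemma IsDiscriminant.substAct_transvection (hD : IsDiscriminant D) (hp : 2 ≤ p) {i j : Fin k}
    (hij : i ≠ j) (c : K) : substAct (Matrix.transvection i j c) D = D := by
  have hp1 : 1 ≤ p := one_le_two.trans hp
  let q : Polynomial K := aeval (coeffs p (linSubst (Matrix.transvection i j Polynomial.X)
    (map (Polynomial.C : K →+* Polynomial K) (fermat k p K)))) D
  have hdet : ∀ c : K, (Matrix.transvection i j c).det ≠ 0 := fun c => by
    rw [Matrix.det_transvection_of_ne _ _ hij]; exact one_ne_zero
  choose χ hχ hχD using fun c => hD.exists_character (hdet c)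
  have hF0 : MvPolynomial.eval (coeffs p (fermat k p K)) D ≠ 0 :=
    hD.aeval_ne_zero (L := K) hp1 i.pos isHomogeneous_fermat (isSmoothForm_fermat hp)
  have hq : ∀ c, q.eval c = χ c * MvPolynomial.eval (coeffs p (fermat k p K)) D := by
    intro c
    have h1 := algHom_aeval_coeffs (Polynomial.aeval c : Polynomial K →ₐ[K] K)
      (linSubst (Matrix.transvection i j Polynomial.X)
        (map (Polynomial.C : K →+* Polynomial K) (fermat k p K))) D
    have h2 := congrArg (MvPolynomial.eval (coeffs p (fermat k p K))) (hχD c)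
    rw [eval_substAct _ isHomogeneous_fermat, map_mul, eval_C] at h2
    rw [← h2]
    refine (show _ = Polynomial.aeval c q by simp [Polynomial.coe_aeval_eq_eval]).trans
      (h1.trans ?_)
    rw [map_linSubst, transvection_map, map_map]
    have h3 : ((Polynomial.aeval c : Polynomial K →ₐ[K] K) : Polynomial K →+* K).comp
        Polynomial.C = RingHom.id K := by ext; simp
    rw [h3, map_id]
    simp only [RingHom.coe_coe, Polynomial.aeval_X]
    rfl
  have hdeg : q.degree = 0 := by
    by_contra h
    obtain ⟨c, hc⟩ := IsAlgClosed.exists_root q h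
    rw [Polynomial.IsRoot, hq] at hc
    exact mul_ne_zero (hχ c) hF0 hc
  have h1 : ∀ c, χ c = χ 0 := by
    intro c
    refine mul_right_cancel₀ hF0 ?_
    rw [← hq, ← hq, Polynomial.eq_C_of_degree_eq_zero hdeg, Polynomial.eval_C, Polynomial.eval_C]
  have h2 : C (χ 0) * D = D := by
    rw [← hχD, Matrix.transvection_zero, substAct_one]
  rw [hχD, h1, h2]

/-- The discriminant is a relative invariant of weight `(p - 1) ^ (k - 1) * p`. -/
lemma IsDiscriminant.substAct_eq (hD : IsDiscriminant D) (hp : 2 ≤ p)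
    {A : Matrix (Fin k) (Fin k) K} (hA : A.det ≠ 0) :
    substAct A D = C (A.det ^ ((p - 1) ^ (k - 1) * p)) * D := by
  refine Matrix.diagonal_transvection_induction_of_det_ne_zero
    (fun A => substAct A D = C (A.det ^ ((p - 1) ^ (k - 1) * p)) * D) A hA
    (fun b _ => hD.substAct_diagonal hp b) (fun t => ?_) fun A B hA' hB' ihA ihB => ?_
  · rw [t.det, one_pow, map_one, one_mul]
    exact hD.substAct_transvection hp t.hij t.c
  · rw [← substAct_substAct, ihB, ← algebraMap_eq, ← Algebra.smul_def, map_smul, ihA,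
      ← algebraMap_eq, ← Algebra.smul_def, smul_smul, Matrix.det_mul, mul_pow, mul_comm,
      Algebra.smul_def]

variable (k p K) in
/-- The universal form, over the polynomial ring in its coefficients and the entries of a
matrix. -/
def universalForm : MvPolynomial (Fin k) (MvPolynomial (Exponent k p ⊕ Fin k × Fin k) K) :=
  form fun m => X (Sum.inl m)

variable (k p K) in
/-- The universal matrix, over the polynomial ring in the coefficients of a form and its entries. -/
def universalMatrix : Matrix (Fin k) (Fin k) (MvPolynomial (Exponent k p ⊕ Fin k × Fin k) K) :=
  Matrix.of fun i j => X (Sum.inr (i, j))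

section

variable {R : Type*} [CommRing R] [Algebra K R] {F : MvPolynomial (Fin k) R}

variable (p) in
/-- The specialization of the universal form and matrix. -/
def universalEval (F : MvPolynomial (Fin k) R) (A : Matrix (Fin k) (Fin k) R) :
    MvPolynomial (Exponent k p ⊕ Fin k × Fin k) K →ₐ[K] R :=
  aeval (Sum.elim (coeffs p F) fun a => A a.1 a.2)

omit [IsAlgClosed K] [CharZero K] in
lemma map_universalForm (hF : F.IsHomogeneous p) (A : Matrix (Fin k) (Fin k) R) :
    map ((universalEval p F A : _ →ₐ[K] R) : _ →+* R)
      (universalForm k p K) = F := by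
  rw [universalForm, map_form]
  simpa [universalEval] using form_coeffs hF

omit [IsAlgClosed K] [CharZero K] in
lemma map_universalMatrix (A : Matrix (Fin k) (Fin k) R) :
    (universalMatrix k p K).map
      ((universalEval p F A : _ →ₐ[K] R) : _ →+* R) = A := by
  ext i j
  simp [universalMatrix, universalEval]

end

/-- A polynomial identity need only be tested at points of `K`. Proving it for the universal form
and matrix makes it available over every `K`-algebra, in particular for matrices over stalks. -/
lemma IsDiscriminant.aeval_universal (hD : IsDiscriminant D) (hp : 2 ≤ p) :
    aeval (coeffs p (linSubst (universalMatrix k p K) (universalForm k p K))) D =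
      (universalMatrix k p K).det ^ ((p - 1) ^ (k - 1) * p) *
        aeval (coeffs p (universalForm k p K)) D := by
  have hdet : (universalMatrix k p K).det ≠ 0 := by
    intro h
    have h1 := congrArg (universalEval p (0 : MvPolynomial (Fin k) K) 1 : _ →ₐ[K] K) h
    rw [AlgHom.map_det, AlgHom.mapMatrix_apply, map_zero] at h1
    have h2 := map_universalMatrix (p := p) (K := K) (F := 0) (1 : Matrix (Fin k) (Fin k) K)
    exact one_ne_zero (Matrix.det_one.symm.trans ((congrArg Matrix.det h2).symm.trans h1))
  -- The extra factor `det` makes the identity trivial at singular matrices, where `substAct_eq`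
  -- says nothing.
  refine mul_left_cancel₀ hdet (MvPolynomial.funext fun c => ?_)
  let F : MvPolynomial (Fin k) K := form fun m => c (Sum.inl m)
  let A : Matrix (Fin k) (Fin k) K := Matrix.of fun i j => c (Sum.inr (i, j))
  have hF : F.IsHomogeneous p := isHomogeneous_form _
  have hc : Sum.elim (coeffs p F) (fun a => A a.1 a.2) = c := by
    rw [show coeffs p F = _ from coeffs_form _]
    ext (a | a) <;> rfl
  have hUF := map_universalForm (K := K) hF A
  have hUA := map_universalMatrix (p := p) (K := K) (F := F) A
  rw [universalEval, hc] at hUF hUA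
  have h1 : MvPolynomial.eval c (universalMatrix k p K).det = A.det := by
    rw [RingHom.map_det]; exact congrArg _ hUA
  change _ = (aeval c : _ →ₐ[K] K) _
  rw [map_mul, map_mul, map_mul, map_pow]
  change (aeval c : _ →ₐ[K] K) _ * (aeval c : _ →ₐ[K] K) _ = _
  rw [algHom_aeval_coeffs, algHom_aeval_coeffs, map_linSubst, hUF, hUA]
  change MvPolynomial.eval c _ * _ = MvPolynomial.eval c _ * (MvPolynomial.eval c _ ^ _ * _)
  rw [h1]
  by_cases hA : A.det = 0
  · rw [hA, zero_mul, zero_mul]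
  · have h2 := congrArg (MvPolynomial.eval (coeffs p F)) (hD.substAct_eq hp hA)
    rw [eval_substAct _ hF, map_mul, eval_C] at h2
    exact congrArg _ h2

section

variable {R : Type*} [CommRing R] {F : MvPolynomial (Fin k) R}

lemma IsDiscriminant.aeval_linSubst [Algebra K R] (hD : IsDiscriminant D) (hp : 2 ≤ p)
    (hF : F.IsHomogeneous p) (A : Matrix (Fin k) (Fin k) R) :
    aeval (coeffs p (linSubst A F)) D =
      A.det ^ ((p - 1) ^ (k - 1) * p) * aeval (coeffs p F) D := by
  let φ : MvPolynomial (Exponent k p ⊕ Fin k × Fin k) K →ₐ[K] R :=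
    universalEval p F A
  have h1 := congrArg φ (hD.aeval_universal hp)
  have h2 : φ (universalMatrix k p K).det = A.det := by
    rw [AlgHom.map_det]; exact congrArg _ (map_universalMatrix A)
  rw [algHom_aeval_coeffs, map_linSubst, map_universalForm hF, map_universalMatrix, map_mul,
    map_pow, h2, algHom_aeval_coeffs, map_universalForm hF] at h1
  exact h1

lemma IsDiscriminant.aeval_C_mul [Algebra K R] (hD : IsDiscriminant D) (hp : 2 ≤ p) (u : R) :
    aeval (coeffs p (C u * F)) D = u ^ (k * (p - 1) ^ (k - 1)) * aeval (coeffs p F) D := by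
  rw [aeval_def, aeval_def, eval₂_eq', eval₂_eq', Finset.mul_sum]
  refine Finset.sum_congr rfl fun d hd => ?_
  rw [← hD.sum_eq hp (mem_support_iff.1 hd), ← Finset.prod_pow_eq_pow_sum, mul_left_comm,
    ← Finset.prod_mul_distrib]
  congr 2
  funext m
  rw [coeffs, coeff_C_mul, mul_pow]
  rfl

lemma IsDiscriminant.eval₂_linSubst (hD : IsDiscriminant D) (hp : 2 ≤ p) (φ : K →+* R)
    (hF : F.IsHomogeneous p) (A : Matrix (Fin k) (Fin k) R) :
    eval₂ φ (coeffs p (linSubst A F)) D =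
      A.det ^ ((p - 1) ^ (k - 1) * p) * eval₂ φ (coeffs p F) D :=
  let := φ.toAlgebra
  hD.aeval_linSubst hp hF A

lemma IsDiscriminant.eval₂_C_mul (hD : IsDiscriminant D) (hp : 2 ≤ p) (φ : K →+* R) (u : R) :
    eval₂ φ (coeffs p (C u * F)) D =
      u ^ (k * (p - 1) ^ (k - 1)) * eval₂ φ (coeffs p F) D :=
  let := φ.toAlgebra
  hD.aeval_C_mul hp u

lemma IsDiscriminant.eval₂_ne_zero {L : Type*} [Field L] {F : MvPolynomial (Fin k) L}
    (hD : IsDiscriminant D) (hp : 1 ≤ p) (hk : 0 < k) (φ : K →+* L) (hF : F.IsHomogeneous p)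
    (hs : IsSmoothForm F) : eval₂ φ (coeffs p F) D ≠ 0 := by
  let := φ.toAlgebra
  have : CharZero L := charZero_of_injective_ringHom φ.injective
  exact hD.aeval_ne_zero hp hk hF hs

end

end Covariance

/-! ### Regular sequences are quasi-regular -/

section QuasiRegular

variable {R : Type*} [CommRing R] {I : Ideal R}

lemma map_mk_eq_zero_iff {σ : Type*} {F : MvPolynomial σ R} :
    map (Ideal.Quotient.mk I) F = 0 ↔ ∀ m, coeff m F ∈ I := by
  simp [MvPolynomial.ext_iff, coeff_map, Ideal.Quotient.eq_zero_iff_mem]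

lemma eval_mem_span_pow {σ : Type*} (g : σ → R) {F : MvPolynomial σ R} {n : ℕ}
    (hF : F.IsHomogeneous n) : MvPolynomial.eval g F ∈ Ideal.span (Set.range g) ^ n :=
  (Ideal.mem_span_pow_iff_exists_isHomogeneous g _).2 ⟨F, hF, rfl⟩

lemma eval_mem_mul_of_coeff_mem {σ : Type*} (g : σ → R) {F : MvPolynomial σ R} {n : ℕ}
    (hF : F.IsHomogeneous n) (h : map (Ideal.Quotient.mk I) F = 0) :
    MvPolynomial.eval g F ∈ I * Ideal.span (Set.range g) ^ n := by
  rw [eval_eq]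
  refine Ideal.sum_mem _ fun m hm => Ideal.mul_mem_mul (map_mk_eq_zero_iff.1 h m) ?_
  have h1 := eval_mem_span_pow g (isHomogeneous_monomial (1 : R)
    (by rw [Finsupp.degree_eq_weight_one]; exact hF (mem_support_iff.1 hm) : m.degree = n))
  rwa [eval_monomial, one_mul] at h1

lemma exists_coeff_mem_of_mem_mul {σ : Type*} (g : σ → R) {n : ℕ} {x : R}
    (hx : x ∈ I * Ideal.span (Set.range g) ^ n) :
    ∃ F : MvPolynomial σ R, F.IsHomogeneous n ∧ map (Ideal.Quotient.mk I) F = 0 ∧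
      MvPolynomial.eval g F = x := by
  refine Submodule.mul_induction_on hx (fun a ha b hb => ?_) ?_
  · obtain ⟨P, hP, rfl⟩ := (Ideal.mem_span_pow_iff_exists_isHomogeneous g _).1 hb
    exact ⟨C a * P, hP.C_mul a, by simp [Ideal.Quotient.eq_zero_iff_mem.2 ha], by simp⟩
  · rintro _ _ ⟨P, hP, hP0, rfl⟩ ⟨Q, hQ, hQ0, rfl⟩
    exact ⟨P + Q, hP.add hQ, by rw [map_add, hP0, hQ0, add_zero], by rw [map_add]⟩

/-- The elements `g i` are quasi-regular: the coefficients of a homogeneous relation between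
them lie in the ideal which they generate. -/
def IsQuasiRegular {σ : Type*} (g : σ → R) : Prop :=
  ∀ (n : ℕ) (F : MvPolynomial σ R), F.IsHomogeneous n → MvPolynomial.eval g F = 0 →
    map (Ideal.Quotient.mk (Ideal.span (Set.range g))) F = 0

lemma IsQuasiRegular.of_eval_mem {σ : Type*} {g : σ → R} (hg : IsQuasiRegular g) {n : ℕ}
    {F : MvPolynomial σ R} (hF : F.IsHomogeneous n)
    (h : MvPolynomial.eval g F ∈ Ideal.span (Set.range g) ^ (n + 1)) :
    map (Ideal.Quotient.mk (Ideal.span (Set.range g))) F = 0 := by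
  rw [pow_succ'] at h
  obtain ⟨P, hP, hP0, hPF⟩ := exists_coeff_mem_of_mem_mul g h
  have h1 := hg n (F - P) (hF.sub hP) (by rw [map_sub, hPF, sub_self])
  rwa [map_sub, hP0, sub_zero] at h1

/-- A non-zero-divisor modulo `I` remains one modulo `I ^ n`: if `x = G(g)` with `G` of degree `n`
and `a * x` lies in `I ^ (n + 1)`, quasi-regularity puts `a` times each coefficient of `G` into `I`,
hence the coefficients themselves. -/
lemma IsQuasiRegular.mem_pow {σ : Type*} {g : σ → R} (hg : IsQuasiRegular g) {a : R}
    (ha : ∀ x, a * x ∈ Ideal.span (Set.range g) → x ∈ Ideal.span (Set.range g)) (n : ℕ) :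
    ∀ x, a * x ∈ Ideal.span (Set.range g) ^ n → x ∈ Ideal.span (Set.range g) ^ n := by
  induction n with
  | zero => simp
  | succ n ih =>
    intro x hx
    obtain ⟨G, hG, rfl⟩ := (Ideal.mem_span_pow_iff_exists_isHomogeneous g x).1
      (ih x (Ideal.pow_le_pow_right n.le_succ hx))
    rw [pow_succ']
    refine eval_mem_mul_of_coeff_mem g hG (map_mk_eq_zero_iff.2 fun m => ha _ ?_)
    have h1 := hg.of_eval_mem (hG.C_mul a) (by rwa [map_mul, eval_C])
    have h2 := map_mk_eq_zero_iff.1 h1 m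
    rwa [coeff_C_mul] at h2

lemma exists_eq_rename_add {n : ℕ} (F : MvPolynomial (Fin (n + 1)) R) :
    ∃ (G : MvPolynomial (Fin n) R) (H : MvPolynomial (Fin (n + 1)) R),
      F = rename Fin.castSucc G + X (Fin.last n) * H := by
  induction F using MvPolynomial.induction_on with
  | C a => exact ⟨C a, 0, by simp⟩
  | add F F' hF hF' =>
    obtain ⟨G, H, rfl⟩ := hF
    obtain ⟨G', H', rfl⟩ := hF'
    exact ⟨G + G', H + H', by rw [map_add]; ring⟩
  | mul_X F i hF =>
    obtain ⟨G, H, rfl⟩ := hF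
    refine Fin.lastCases ⟨0, rename Fin.castSucc G + X (Fin.last n) * H, ?_⟩ (fun j => ?_) i
    · rw [map_zero]; ring
    · exact ⟨G * X j, H * X j.castSucc, by rw [map_mul, rename_X]; ring⟩

lemma exists_eq_rename_add_of_isHomogeneous {n d : ℕ} {F : MvPolynomial (Fin (n + 1)) R}
    (hF : F.IsHomogeneous (d + 1)) :
    ∃ (G : MvPolynomial (Fin n) R) (H : MvPolynomial (Fin (n + 1)) R),
      G.IsHomogeneous (d + 1) ∧ H.IsHomogeneous d ∧
        F = rename Fin.castSucc G + X (Fin.last n) * H := by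
  obtain ⟨G, H, h⟩ := exists_eq_rename_add F
  -- Setting the last variable to zero recovers `G` from `F`, so `G` inherits homogeneity, and then
  -- so does `H`.
  let φ : MvPolynomial (Fin (n + 1)) R →ₐ[R] MvPolynomial (Fin n) R :=
    aeval (Fin.lastCases (0 : MvPolynomial (Fin n) R) X)
  have hG : φ F = G := by
    have h1 : φ (rename Fin.castSucc G) = G := by
      simp only [φ, aeval_rename]
      have : (Fin.lastCases (0 : MvPolynomial (Fin n) R) X : Fin (n + 1) → _) ∘ Fin.castSucc = X := by
        funext j; simp
      rw [this, aeval_X_left_apply]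
    rw [h, map_add, h1, map_mul]
    simp [φ]
  have hGh : G.IsHomogeneous (d + 1) := by
    have h1 := hF.aeval (n := 1) (Fin.lastCases (0 : MvPolynomial (Fin n) R) X) fun i => by
      refine Fin.lastCases ?_ (fun j => ?_) i
      · simpa using isHomogeneous_zero _ _ _
      · simpa using isHomogeneous_X R j
    rw [one_mul] at h1
    exact hG ▸ h1
  refine ⟨G, H, hGh, fun m hm => ?_, h⟩
  have h2 : (X (Fin.last n) * H).IsHomogeneous (d + 1) := by
    rw [eq_sub_iff_add_eq'.2 h.symm]
    exact hF.sub hGh.rename_isHomogeneous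
  have h3 := h2 (d := Finsupp.single (Fin.last n) 1 + m) (by rwa [coeff_X_mul])
  rw [map_add, Finsupp.weight_single] at h3
  simp at h3
  omega

/-- A weakly regular sequence is quasi-regular. -/
lemma isQuasiRegular_of_isWeaklyRegular {n : ℕ} {g : Fin n → R}
    (hg : RingTheory.Sequence.IsWeaklyRegular R (List.ofFn g)) : IsQuasiRegular g := by
  induction n with
  | zero =>
    intro d F hF h0
    rw [eq_C_of_isEmpty F] at h0 ⊢
    rw [eval_C] at h0
    rw [h0, map_zero, map_zero]
  | succ n ih =>
    set J := Ideal.span (Set.range fun j : Fin n => g j.castSucc) with hJ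
    have hlist : Ideal.ofList (List.ofFn fun j : Fin n => g j.castSucc) = J := by
      rw [hJ, Ideal.ofList]
      congr 1
      ext r
      simp [List.mem_ofFn]
    rw [List.ofFn_succ_last, RingTheory.Sequence.isWeaklyRegular_append_iff,
      RingTheory.Sequence.isWeaklyRegular_singleton_iff, hlist, smul_eq_mul, Ideal.mul_top] at hg
    have hJle : J ≤ Ideal.span (Set.range g) := Ideal.span_mono (by
      rintro _ ⟨j, rfl⟩; exact ⟨j.castSucc, rfl⟩)
    have hJq := ih hg.1
    have hreg := hJq.mem_pow fun x hx => mem_of_isSMulRegular_quotient_of_smul_mem hg.2 hx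
    intro d
    induction d with
    | zero =>
      intro F hF h0
      rw [totalDegree_eq_zero_iff_eq_C.1 ((totalDegree_zero_iff_isHomogeneous _).2 hF)] at h0 ⊢
      rw [eval_C] at h0
      rw [h0, map_zero, map_zero]
    | succ d ihd =>
      intro F hF h0
      obtain ⟨G, H, hG, hH, rfl⟩ := exists_eq_rename_add_of_isHomogeneous hF
      rw [map_add, eval_rename, map_mul, eval_X] at h0
      -- The relation says that `g (Fin.last n) * H(g)` lies in `J ^ (d + 1)`, and the last element
      -- is regular modulo powers of `J`.
      have h1 : MvPolynomial.eval g H ∈ J ^ (d + 1) := by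
        refine hreg _ _ ?_
        rw [← neg_eq_of_add_eq_zero_right h0]
        exact Submodule.neg_mem _ (eval_mem_span_pow _ hG)
      obtain ⟨h, hh, hhH⟩ := (Ideal.mem_span_pow_iff_exists_isHomogeneous _ _).1 h1
      have h2 : map (Ideal.Quotient.mk (Ideal.span (Set.range g))) H = 0 := by
        have h3 := Ideal.pow_right_mono hJle (d + 1) h1
        rw [pow_succ'] at h3
        obtain ⟨P, hP, hP0, hPH⟩ := exists_coeff_mem_of_mem_mul g h3
        have h4 := ihd (H - P) (hH.sub hP) (by rw [map_sub, hPH, sub_self])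
        rwa [map_sub, hP0, sub_zero] at h4
      -- Rewriting `H(g)` as a form `h` in the first `n` elements eliminates the last variable, so
      -- the induction on the length applies; the added term has coefficients in the ideal.
      have h3 := hJq (d + 1) (G + C (g (Fin.last n)) * h) (hG.add (hh.C_mul _)) (by
        rw [map_add, map_mul, eval_C, hhH]; exact h0)
      have h4 : map (Ideal.Quotient.mk (Ideal.span (Set.range g))) G = 0 := by
        refine map_mk_eq_zero_iff.2 fun m => ?_
        have h5 := hJle (map_mk_eq_zero_iff.1 h3 m)
        rw [coeff_add, coeff_C_mul] at h5
        exact (Ideal.add_mem_iff_left _ (Ideal.mul_mem_right _ _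
          (Ideal.subset_span (Set.mem_range_self _)))).1 h5
      rw [map_add, map_mul, h2, mul_zero, add_zero, map_rename, h4, map_zero]

end QuasiRegular

/-! ### Change of the discriminant with the equations -/

section Compare

variable {R : Type*} [CommRing R] {k p : ℕ} {I : Ideal R}

lemma hom_eval {S σ : Type*} [CommRing S] (φ : R →+* S) (g : σ → R) (F : MvPolynomial σ R) :
    φ (MvPolynomial.eval g F) = MvPolynomial.eval (fun i => φ (g i)) (map φ F) := by
  rw [MvPolynomial.eval_map]
  exact hom_eval₂ _ _ _ _ |>.trans (by simp)

/-- A matrix expressing `g` through `g'` also exists; the product of the two takes `g` to itself, so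
its determinant is `1` modulo `I` by uniqueness. -/
lemma isUnit_det_of_mulVec {g g' : Fin k → R} (hI : Ideal.span (Set.range g) = I)
    (hI' : Ideal.span (Set.range g') = I)
    (hg : RingTheory.Sequence.IsWeaklyRegular R (List.ofFn g)) {A : Matrix (Fin k) (Fin k) R}
    (hA : g' = A.mulVec g) : IsUnit (Ideal.Quotient.mk I A.det) := by
  obtain ⟨a, ha⟩ := DetRel.exists hI hI'
  exact IsUnit.of_mul_eq_one_right _ (DetRel.unique hI hg (ha.mul ⟨A, hA, rfl⟩) DetRel.refl)

/-- The discriminants of two expansions `f = F(g)` and `u f = F'(A g)`. -/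
lemma IsDiscriminant.compare {K : Type*} [Field K] [IsAlgClosed K] [CharZero K]
    {D : MvPolynomial (Exponent k p) K} (hD : IsDiscriminant D) (hp : 2 ≤ p) (φ : K →+* R)
    {g g' : Fin k → R} (hI : Ideal.span (Set.range g) = I)
    (hg : RingTheory.Sequence.IsWeaklyRegular R (List.ofFn g)) {A : Matrix (Fin k) (Fin k) R}
    (hA : g' = A.mulVec g) {F F' : MvPolynomial (Fin k) R} (hF : F.IsHomogeneous p)
    (hF' : F'.IsHomogeneous p) {u : R}
    (hu : MvPolynomial.eval g' F' = u * MvPolynomial.eval g F) :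
    Ideal.Quotient.mk I A.det ^ ((p - 1) ^ (k - 1) * p) *
        Ideal.Quotient.mk I (eval₂ φ (coeffs p F') D) =
      Ideal.Quotient.mk I u ^ (k * (p - 1) ^ (k - 1)) *
        Ideal.Quotient.mk I (eval₂ φ (coeffs p F) D) := by
  -- `F' ∘ A` and `u F` have the same value at `g`, so by quasi-regularity they agree modulo `I`;
  -- only then can the covariance of `D` be applied.
  have h1 : map (Ideal.Quotient.mk I) (linSubst A F' - C u * F) = 0 := by
    subst hI
    exact isQuasiRegular_of_isWeaklyRegular hg p _
      ((isHomogeneous_linSubst hF' A).sub (hF.C_mul u))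
      (by rw [map_sub, eval_linSubst, ← hA, hu, map_mul, eval_C, sub_self])
  rw [map_sub, sub_eq_zero, map_mul, map_C, map_linSubst] at h1
  have h2 : ∀ G : MvPolynomial (Fin k) R, Ideal.Quotient.mk I (eval₂ φ (coeffs p G) D) =
      eval₂ ((Ideal.Quotient.mk I).comp φ) (coeffs p (map (Ideal.Quotient.mk I) G)) D := by
    intro G
    rw [hom_eval₂]
    rfl
  rw [h2, h2, ← hD.eval₂_C_mul hp, ← h1, hD.eval₂_linSubst hp _ (hF'.map _), RingHom.map_det]
  rfl

end Compare

/-! ### From generic points to all points of `Z` -/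

section Generic

variable {M : LocallyRingedSpace.{u}} {X Z : Set M} {k p : ℕ}

lemma idealAt_le_maximalIdeal {z : M} (hz : z ∈ Z) :
    idealAt M Z z ≤ IsLocalRing.maximalIdeal (M.presheaf.stalk z) := by
  rintro _ ⟨U, hU, t, rfl, h⟩
  exact h z hU hz

lemma mem_closure_inter {V W : Opens M} (hV : Z ⊆ closure (Z ∩ V)) {w : M} (hw : w ∈ Z)
    (hwW : w ∈ W) : ∃ y ∈ Z, y ∈ V ∧ y ∈ W := by
  obtain ⟨y, hyW, hyZ, hyV⟩ := mem_closure_iff.1 (hV hw) W W.isOpen hwW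
  exact ⟨y, hyZ, hyV, hyW⟩

/-- A function which vanishes at the generic points of `Z` vanishes on `Z`. -/
lemma mem_idealAt_of_generically {V : Opens M} (hV : Z ⊆ closure (Z ∩ V)) {W : Opens M}
    (s : M.presheaf.obj (op W))
    (h : ∀ y ∈ Z, y ∈ V → ∀ hy : y ∈ W,
      M.presheaf.germ W y hy s ∈ IsLocalRing.maximalIdeal (M.presheaf.stalk y))
    {z : M} (hz : z ∈ W) : M.presheaf.germ W z hz s ∈ idealAt M Z z := by
  refine ⟨W, hz, s, rfl, fun w hw hwZ => ?_⟩
  -- The locus where `s` is a unit is open; if it contained a point of `Z`, it would contain a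
  -- generic one.
  by_contra hu
  rw [IsLocalRing.mem_maximalIdeal, mem_nonunits_iff, not_not] at hu
  obtain ⟨y, hyZ, hyV, hyW⟩ := mem_closure_inter hV hwZ
    ((M.toRingedSpace.mem_basicOpen s w hw).2 hu)
  have hy := M.toRingedSpace.basicOpen_le s hyW
  exact (IsLocalRing.mem_maximalIdeal _).1 (h y hyZ hyV hy)
    ((M.toRingedSpace.mem_basicOpen s y hy).1 hyW)

/-- Finitely many germs are induced by functions on a common neighbourhood. -/
lemma exists_sections {σ : Type*} [Fintype σ] {W : Opens M} {z : M} (hz : z ∈ W)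
    (c : σ → M.presheaf.stalk z) :
    ∃ (V : Opens M) (hV : z ∈ V) (_ : V ≤ W) (t : σ → M.presheaf.obj (op V)),
      ∀ m, M.presheaf.germ V z hV (t m) = c m := by
  classical
  choose V hV t ht using fun m => M.presheaf.exists_germ_eq (c m)
  have hmem : ∀ s : Finset σ, z ∈ s.inf V := by
    intro s
    have : z ∈ ((s.inf V : Opens M) : Set M) := by
      rw [Opens.coe_finset_inf, Finset.inf_set_eq_iInter]
      simpa using fun m _ => hV m
    exact this
  have hle : ∀ m, Finset.univ.inf V ⊓ W ≤ V m := fun m =>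
    inf_le_left.trans (Finset.inf_le (Finset.mem_univ m))
  refine ⟨Finset.univ.inf V ⊓ W, Opens.mem_inf.2 ⟨hmem _, hz⟩, inf_le_right,
    fun m => M.presheaf.map (homOfLE (hle m)).op (t m), fun m => ?_⟩
  rw [TopCat.Presheaf.germ_res_apply, ht]

/-- A polynomial relation between germs holds near the point. -/
lemma exists_sections_expansion {U : Opens M} {z : M} (hz : z ∈ U) (f : M.presheaf.obj (op U))
    (g : Fin k → M.presheaf.obj (op U)) {F : MvPolynomial (Fin k) (M.presheaf.stalk z)} {n : ℕ}
    (hF : F.IsHomogeneous n)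
    (h : M.presheaf.germ U z hz f =
      MvPolynomial.eval (fun i => M.presheaf.germ U z hz (g i)) F) :
    ∃ (V : Opens M) (hV : z ∈ V) (hVU : V ≤ U) (a : Exponent k n → M.presheaf.obj (op V)),
      (∀ m, M.presheaf.germ V z hV (a m) = coeffs n F m) ∧
      ∀ (y : M) (hy : y ∈ V), M.presheaf.germ U y (hVU hy) f =
        MvPolynomial.eval (fun i => M.presheaf.germ U y (hVU hy) (g i))
          (form fun m => M.presheaf.germ V y hy (a m)) := by
  obtain ⟨V, hV, hVU, a, ha⟩ := exists_sections hz (coeffs n F)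
  have hev : ∀ (y : M) (hy : y ∈ V), M.presheaf.germ V y hy (MvPolynomial.eval
      (fun i => M.presheaf.map (homOfLE hVU).op (g i)) (form a)) =
        MvPolynomial.eval (fun i => M.presheaf.germ U y (hVU hy) (g i))
          (form fun m => M.presheaf.germ V y hy (a m)) := by
    intro y hy
    refine (hom_eval (M.presheaf.germ V y hy).hom _ _).trans ?_
    rw [map_form]
    congr 2
    funext i
    exact TopCat.Presheaf.germ_res_apply _ _ _ _ _
  obtain ⟨W, hW, e⟩ := germ_eq_near hz hV f _ (by
    rw [hev z hV, h]
    simp only [ha]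
    rw [form_coeffs hF])
  refine ⟨W ⊓ V, Opens.mem_inf.2 ⟨hW, hV⟩, inf_le_right.trans hVU,
    fun m => M.presheaf.map (homOfLE inf_le_right).op (a m), fun m => ?_, fun y hy => ?_⟩
  · rw [TopCat.Presheaf.germ_res_apply, ha]
  · rw [e y hy.1 (hVU hy.2) hy.2, hev]
    simp only [TopCat.Presheaf.germ_res_apply]

/-- The equation of `X` lies in `I_Z ^ p` if it does so generically. -/
lemma idealAt_le_pow (hZ : IsLCI M Z k) {V : Opens M} (hV : Z ⊆ closure (Z ∩ V))
    (h : ∀ y ∈ Z, y ∈ V → idealAt M X y ≤ idealAt M Z y ^ p) {n : ℕ} (hn : n ≤ p) {z : M}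
    (hz : z ∈ Z) : idealAt M X z ≤ idealAt M Z z ^ n := by
  induction n with
  | zero => simp
  | succ n ih =>
    intro s hs
    obtain ⟨U₀, hU₀, g, hg⟩ := hZ z hz
    obtain ⟨U₁, hU₁, f, rfl⟩ := M.presheaf.exists_germ_eq s
    obtain ⟨U₂, hU₂, hf⟩ := mem_idealAt_near hU₁ f hs
    let U : Opens M := U₀ ⊓ (U₁ ⊓ U₂)
    have hzU : z ∈ U := Opens.mem_inf.2 ⟨hU₀, Opens.mem_inf.2 ⟨hU₁, hU₂⟩⟩
    have i₀ : U ≤ U₀ := inf_le_left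
    have i₁ : U ≤ U₁ := inf_le_right.trans inf_le_left
    have i₂ : U ≤ U₂ := inf_le_right.trans inf_le_right
    have h1 := ih (n.le_succ.trans hn) hs
    rw [← (hg z hU₀).1, Ideal.mem_span_pow_iff_exists_isHomogeneous] at h1
    obtain ⟨F, hF, hFs⟩ := h1
    obtain ⟨W, hW, hWU, a, ha, hexp⟩ := exists_sections_expansion hzU
      (M.presheaf.map (homOfLE i₁).op f) (fun i => M.presheaf.map (homOfLE i₀).op (g i)) hF (by
        simp only [TopCat.Presheaf.germ_res_apply]
        exact hFs.symm)
    simp only [TopCat.Presheaf.germ_res_apply] at hexp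
    -- At generic points `f` lies in `I_Z ^ p`, hence in `I_Z ^ (n + 1)`, and quasi-regularity makes
    -- the coefficients of its degree `n` expansion vanish there; since `Z` is reduced, they vanish
    -- on `Z`. This raises the exponent at `z` by one.
    have hcoef : ∀ m, coeffs n F m ∈ idealAt M Z z := by
      intro m
      rw [← ha]
      refine mem_idealAt_of_generically hV (a m) (fun y hyZ hyV hyW => ?_) hW
      have h2 := Ideal.pow_le_pow_right hn (h y hyZ hyV (hf y (i₂ (hWU hyW)) (i₁ (hWU hyW))))
      rw [hexp y hyW, ← (hg y (i₀ (hWU hyW))).1] at h2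
      have h3 := (isQuasiRegular_of_isWeaklyRegular ((hg y (i₀ (hWU hyW))).2 hyZ)).of_eval_mem
        (isHomogeneous_form _) h2
      have h4 := map_mk_eq_zero_iff.1 h3 m.1
      rw [(hg y (i₀ (hWU hyW))).1] at h4
      have h5 := congrFun (coeffs_form fun m => M.presheaf.germ W y hyW (a m)) m
      rw [← h5]
      exact idealAt_le_maximalIdeal hyZ h4
    have h6 := eval_mem_mul_of_coeff_mem (I := idealAt M Z z)
      (fun i => M.presheaf.germ U₀ z hU₀ (g i)) hF (map_mk_eq_zero_iff.2 fun m => by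
        by_cases hm : m.degree = n
        · exact hcoef ⟨m, hm⟩
        · rw [hF.coeff_eq_zero hm]; exact zero_mem _)
    rw [hFs, (hg z hU₀).1, ← pow_succ'] at h6
    exact h6

end Generic

/-! ### Local expansions and the local equation of the transversal discriminant -/

section LocalExpansion

variable {M : LocallyRingedSpace.{u}} {X Z : Set M} {k p : ℕ}

lemma Setting.nonempty (h : Setting M X Z k p) : Z.Nonempty := by
  obtain ⟨z, hz, rfl⟩ := h.component
  exact ⟨z, mem_connectedComponentIn hz⟩

lemma Setting.subset_singularLocus (h : Setting M X Z k p) : Z ⊆ singularLocus M X := by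
  obtain ⟨z, hz, rfl⟩ := h.component
  exact connectedComponentIn_subset _ _

/-- All points of `Z` are singular on `X`, so the equation lies in `𝔪 ^ 2`, which excludes generic
multiplicity below `2`. -/
lemma Setting.two_le (h : Setting M X Z k p) : 2 ≤ p := by
  obtain ⟨z, hz⟩ := h.nonempty
  obtain ⟨V, hV, hm⟩ := h.multiplicity
  obtain ⟨y, hyZ, hyV, -⟩ := mem_closure_inter (W := ⊤) hV hz trivial
  by_contra hp
  exact (hm y hyZ hyV).2 ((h.subset_singularLocus hyZ).2.trans
    (Ideal.pow_le_pow_right (by omega)))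

lemma Setting.idealAt_le_pow (h : Setting M X Z k p) {z : M} (hz : z ∈ Z) :
    idealAt M X z ≤ idealAt M Z z ^ p := by
  obtain ⟨V, hV, ho⟩ := h.ordinary
  refine TransDisc.idealAt_le_pow h.lci hV (fun y hyZ hyV => ?_) le_rfl hz
  obtain ⟨f, g, F, hF, -⟩ := ho y hyZ hyV
  rw [← hF.span_f, ← hF.span_g, Ideal.span_singleton_le_iff_mem, hF.expansion]
  exact eval_mem_span_pow g hF.homogeneous

/-- For `k = 0` the ideal of `Z` would be zero, and so would the equation of `X`, which is a
non-zero-divisor. -/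
lemma Setting.pos (h : Setting M X Z k p) : 0 < k := by
  obtain ⟨z, hz⟩ := h.nonempty
  obtain ⟨U, hU, f, hf⟩ := h.hypersurface.2 z
  obtain ⟨U', hU', g, hg⟩ := h.lci z hz
  by_contra hk
  obtain rfl : k = 0 := by omega
  have h1 := h.idealAt_le_pow hz
  rw [← (hf z hU).1, ← (hg z hU').1, Set.range_eq_empty, Ideal.span_empty,
    Ideal.bot_pow (by have := h.two_le; omega), Ideal.span_singleton_le_iff_mem,
    Ideal.mem_bot] at h1
  exact nonZeroDivisors.ne_zero (hf z hU).2 h1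

/-- Local equations `f` of `X` and `g` of `Z` on an open set, with an expansion
`f = ∑_{|m| = p} a_m g^m`. -/
structure IsLocalExpansion (X Z : Set M) {U : Opens M} (f : M.presheaf.obj (op U))
    (g : Fin k → M.presheaf.obj (op U)) (a : Exponent k p → M.presheaf.obj (op U)) : Prop where
  span_f : ∀ (y : M) (hy : y ∈ U), Ideal.span {M.presheaf.germ U y hy f} = idealAt M X y
  mem_nonZeroDivisors : ∀ (y : M) (hy : y ∈ U),
    M.presheaf.germ U y hy f ∈ nonZeroDivisors (M.presheaf.stalk y)
  span_g : ∀ (y : M) (hy : y ∈ U),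
    Ideal.span (Set.range fun i => M.presheaf.germ U y hy (g i)) = idealAt M Z y
  isWeaklyRegular : ∀ (y : M) (hy : y ∈ U), y ∈ Z →
    RingTheory.Sequence.IsWeaklyRegular (M.presheaf.stalk y)
      (List.ofFn fun i => M.presheaf.germ U y hy (g i))
  expansion : ∀ (y : M) (hy : y ∈ U), M.presheaf.germ U y hy f =
    MvPolynomial.eval (fun i => M.presheaf.germ U y hy (g i))
      (form fun m => M.presheaf.germ U y hy (a m))

lemma Setting.exists_isLocalExpansion (h : Setting M X Z k p) {z : M} (hz : z ∈ Z) :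
    ∃ (U : Opens M) (_ : z ∈ U) (f : M.presheaf.obj (op U)) (g : Fin k → M.presheaf.obj (op U))
      (a : Exponent k p → M.presheaf.obj (op U)), IsLocalExpansion X Z f g a := by
  obtain ⟨U₀, hU₀, f, hf⟩ := h.hypersurface.2 z
  obtain ⟨U₁, hU₁, g, hg⟩ := h.lci z hz
  have hzU : z ∈ U₀ ⊓ U₁ := Opens.mem_inf.2 ⟨hU₀, hU₁⟩
  have h1 : M.presheaf.germ U₀ z hU₀ f ∈ idealAt M Z z ^ p :=
    h.idealAt_le_pow hz ((hf z hU₀).1 ▸ Ideal.mem_span_singleton_self _)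
  rw [← (hg z hU₁).1, Ideal.mem_span_pow_iff_exists_isHomogeneous] at h1
  obtain ⟨F, hF, hFf⟩ := h1
  obtain ⟨V, hV, hVU, a, -, ha⟩ := exists_sections_expansion hzU
    (M.presheaf.map (homOfLE inf_le_left).op f)
    (fun i => M.presheaf.map (homOfLE inf_le_right).op (g i)) hF (by
      simp only [TopCat.Presheaf.germ_res_apply]
      exact hFf.symm)
  simp only [TopCat.Presheaf.germ_res_apply] at ha
  refine ⟨V, hV, M.presheaf.map (homOfLE (hVU.trans inf_le_left)).op f,
    fun i => M.presheaf.map (homOfLE (hVU.trans inf_le_right)).op (g i), a, ?_, ?_, ?_, ?_, ?_⟩ <;>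
  simp only [TopCat.Presheaf.germ_res_apply]
  · exact fun y hy => (hf y (hVU hy).1).1
  · exact fun y hy => (hf y (hVU hy).1).2
  · exact fun y hy => (hg y (hVU hy).2).1
  · exact fun y hy => (hg y (hVU hy).2).2
  · exact ha

variable (M) in
/-- The structure map `K → 𝒪_{M,x}` of a locally ringed space over `K`. -/
def germConst {K : Type v} [Field K] (ι : K →+* M.presheaf.obj (op ⊤)) (x : M) :
    K →+* M.presheaf.stalk x :=
  (M.presheaf.germ ⊤ x trivial).hom.comp ι

variable {K : Type v} [Field K] (ι : K →+* M.presheaf.obj (op ⊤))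
  {D : MvPolynomial (Exponent k p) K}

lemma eval₂_toStalk (z : M) (c : Exponent k p → M.presheaf.stalk z)
    (E : MvPolynomial (Exponent k p) K) :
    eval₂ (toStalk M ι Z z) (fun m => Ideal.Quotient.mk (idealAt M Z z) (c m)) E =
      Ideal.Quotient.mk (idealAt M Z z) (eval₂ (germConst M ι z) c E) := by
  rw [hom_eval₂]
  rfl

/-- The discriminant of a family of forms. -/
def localDiscriminant (D : MvPolynomial (Exponent k p) K) {U : Opens M}
    (a : Exponent k p → M.presheaf.obj (op U)) : M.presheaf.obj (op U) :=
  eval₂ ((M.presheaf.map (homOfLE le_top).op).hom.comp ι) a D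

lemma germ_localDiscriminant {U : Opens M} (a : Exponent k p → M.presheaf.obj (op U)) {y : M}
    (hy : y ∈ U) : M.presheaf.germ U y hy (localDiscriminant ι D a) =
      eval₂ (germConst M ι y) (coeffs p (form fun m => M.presheaf.germ U y hy (a m))) D := by
  rw [coeffs_form]
  refine (hom_eval₂ _ _ (M.presheaf.germ U y hy).hom _).trans ?_
  congr 1
  ext c
  exact TopCat.Presheaf.germ_res_apply M.presheaf (homOfLE le_top) y hy (ι c)

variable [IsAlgClosed K] [CharZero K] {U : Opens M} {f : M.presheaf.obj (op U)}
  {g : Fin k → M.presheaf.obj (op U)} {a : Exponent k p → M.presheaf.obj (op U)}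

/-- In the comparison formula both the unit relating the equations of `X` and the determinant
relating the generators are units on `Z`. Hence the ideal of `Δ^⊥` can be computed from a single
expansion. -/
lemma IsLocalExpansion.exists_isUnit (h : IsLocalExpansion X Z f g a) (hD : IsDiscriminant D)
    (hp : 2 ≤ p) {y : M} (hyZ : y ∈ Z) (hy : y ∈ U) {f' : M.presheaf.stalk y}
    {g' : Fin k → M.presheaf.stalk y} {F' : MvPolynomial (Fin k) (M.presheaf.stalk y)}
    (h' : IsExpansion M X Z p y f' g' F') :
    ∃ v : (Stalk M Z y)ˣ, Ideal.Quotient.mk (idealAt M Z y)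
      (M.presheaf.germ U y hy (localDiscriminant ι D a)) =
        v * Ideal.Quotient.mk (idealAt M Z y) (eval₂ (germConst M ι y) (coeffs p F') D) := by
  obtain ⟨u, hu⟩ := exists_unit_ratio (h.mem_nonZeroDivisors y hy)
    ((h.span_f y hy).trans h'.span_f.symm)
  obtain ⟨-, A, hA, -⟩ := DetRel.exists h'.span_g (h.span_g y hy)
  have h1 := hD.compare hp (germConst M ι y) (h.span_g y hy) (h.isWeaklyRegular y hy hyZ) hA
    (isHomogeneous_form _) h'.homogeneous (u := ((u⁻¹ : _ˣ) : M.presheaf.stalk y)) (by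
      rw [← h.expansion y hy, hu, Units.inv_mul_cancel_left, h'.expansion])
  obtain ⟨α, hα⟩ := isUnit_det_of_mulVec (h.span_g y hy) h'.span_g (h.isWeaklyRegular y hy hyZ) hA
  obtain ⟨β, hβ⟩ := u⁻¹.isUnit.map (Ideal.Quotient.mk (idealAt M Z y))
  refine ⟨(β ^ (k * (p - 1) ^ (k - 1)))⁻¹ * α ^ ((p - 1) ^ (k - 1) * p), ?_⟩
  rw [germ_localDiscriminant, Units.val_mul, mul_assoc, Units.eq_inv_mul_iff_mul_eq,
    Units.val_pow_eq_pow_val, Units.val_pow_eq_pow_val, hα, hβ, h1]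

lemma IsLocalExpansion.span_localDiscriminant (h : IsLocalExpansion X Z f g a)
    (hD : IsDiscriminant D) (hp : 2 ≤ p) {y : M} (hyZ : y ∈ Z) (hy : y ∈ U) :
    Ideal.span {Ideal.Quotient.mk (idealAt M Z y)
      (M.presheaf.germ U y hy (localDiscriminant ι D a))} =
        transversalDiscriminant M ι X Z k p y := by
  refine le_antisymm ?_ (Ideal.span_le.2 ?_)
  · rw [Ideal.span_singleton_le_iff_mem]
    refine Ideal.subset_span ⟨_, _, _, ⟨h.span_f y hy, h.span_g y hy, isHomogeneous_form _,
      h.expansion y hy⟩, D, hD.mem, ?_⟩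
    rw [eval₂_toStalk, germ_localDiscriminant]
  · rintro _ ⟨f', g', F', h', E, hE, rfl⟩
    obtain ⟨Q, rfl⟩ := hD.dvd hE
    obtain ⟨v, hv⟩ := h.exists_isUnit ι hD hp hyZ hy h'
    rw [eval₂_toStalk, eval₂_mul, map_mul, SetLike.mem_coe, hv,
      Ideal.span_singleton_mul_left_unit v.isUnit]
    exact Ideal.mul_mem_right _ _ (Ideal.mem_span_singleton_self _)

/-- The discriminant of the ordinary expansion is nonzero in the residue field, which may be larger
than `K`; this is where non-vanishing of `D` over extension fields is needed. -/
lemma IsLocalExpansion.isUnit_localDiscriminant (h : IsLocalExpansion X Z f g a)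
    (hD : IsDiscriminant D) (hp : 2 ≤ p) (hk : 0 < k) {y : M} (hyZ : y ∈ Z) (hy : y ∈ U)
    (ho : IsOrdinaryAt M X Z k p y) : IsUnit (Ideal.Quotient.mk (idealAt M Z y)
      (M.presheaf.germ U y hy (localDiscriminant ι D a))) := by
  obtain ⟨f', g', F', h', hs⟩ := ho
  obtain ⟨v, hv⟩ := h.exists_isUnit ι hD hp hyZ hy h'
  rw [hv]
  refine v.isUnit.mul (IsUnit.map _ ?_)
  by_contra hu
  have h1 := hD.eval₂_ne_zero (one_le_two.trans hp) hk
    ((IsLocalRing.residue (M.presheaf.stalk y)).comp (germConst M ι y)) (h'.homogeneous.map _) hs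
  refine h1 (Eq.trans ?_ ((IsLocalRing.residue_eq_zero_iff _).2
    ((IsLocalRing.mem_maximalIdeal _).2 hu)))
  rw [hom_eval₂]
  rfl

/-- A function annihilated by the discriminant on `Z` vanishes at nearby ordinary points of `Z`,
where the discriminant is a unit. These are dense, so it vanishes on the reduced `Z`. -/
lemma IsLocalExpansion.localDiscriminant_mem_nonZeroDivisors (h : IsLocalExpansion X Z f g a)
    (hD : IsDiscriminant D) (hs : Setting M X Z k p) {z : M} (hzU : z ∈ U) :
    Ideal.Quotient.mk (idealAt M Z z) (M.presheaf.germ U z hzU (localDiscriminant ι D a)) ∈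
      nonZeroDivisors (Stalk M Z z) := by
  obtain ⟨V, hV, ho⟩ := hs.ordinary
  refine mem_nonZeroDivisors_iff_right.2 fun b hb => ?_
  obtain ⟨b, rfl⟩ := Ideal.Quotient.mk_surjective b
  obtain ⟨W, hW, s, rfl⟩ := M.presheaf.exists_germ_eq b
  have hWU : z ∈ W ⊓ U := Opens.mem_inf.2 ⟨hW, hzU⟩
  obtain ⟨N, hN, hmem⟩ := mem_idealAt_near (Z := Z) hWU
    (M.presheaf.map (homOfLE inf_le_left).op s *
      M.presheaf.map (homOfLE inf_le_right).op (localDiscriminant ι D a)) (by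
        rw [map_mul, TopCat.Presheaf.germ_res_apply, TopCat.Presheaf.germ_res_apply,
          ← Ideal.Quotient.eq_zero_iff_mem, map_mul, hb])
  have hNle : N ⊓ (W ⊓ U) ≤ W := inf_le_right.trans inf_le_left
  rw [Ideal.Quotient.eq_zero_iff_mem, ← TopCat.Presheaf.germ_res_apply M.presheaf (homOfLE hNle) z
    (Opens.mem_inf.2 ⟨hN, hWU⟩)]
  refine mem_idealAt_of_generically hV _ (fun y hyZ hyV hy => ?_) _
  rw [TopCat.Presheaf.germ_res_apply]
  refine idealAt_le_maximalIdeal hyZ ?_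
  have h1 := hmem y hy.1 hy.2
  rw [map_mul, TopCat.Presheaf.germ_res_apply, TopCat.Presheaf.germ_res_apply,
    ← Ideal.Quotient.eq_zero_iff_mem, map_mul] at h1
  rw [← Ideal.Quotient.eq_zero_iff_mem]
  exact ((h.isUnit_localDiscriminant ι hD hs.two_le hs.pos hyZ hy.2.2
    (ho y hyZ hyV)).mul_left_eq_zero).1 h1

end LocalExpansion

/-! ### Powers of line bundles and induced sections -/

section Picard

variable {M : LocallyRingedSpace.{u}} {Z : Set M}

lemma IsSection.pow {U : Opens M} {s : ∀ z : Z, Stalk M Z z} (hs : IsSection M Z U s) (n : ℕ) :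
    IsSection M Z U (fun z => s z ^ n) := by
  induction n with
  | zero => simpa using IsSection.one U
  | succ n ih => simpa only [pow_succ] using ih.mul hs

lemma IsUnitSection.pow {U : Opens M} {s : ∀ z : Z, (Stalk M Z z)ˣ} (hs : IsUnitSection M Z U s)
    (n : ℕ) : IsUnitSection M Z U (fun z => s z ^ n) :=
  ⟨by simpa using hs.1.pow n, by simpa [← inv_pow] using hs.2.pow n⟩

/-- The tensor powers of a line bundle. -/
def Cocycle.pow (c : Cocycle M Z) (n : ℕ) : Cocycle M Z where
  U := c.U
  mem := c.mem
  u x y z := c.u x y z ^ n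
  isUnitSection x y := (c.isUnitSection x y).pow n
  cocycle x y w z hx hy hw := by rw [← mul_pow, c.cocycle x y w z hx hy hw]

/-- The class of a line bundle given by transition functions. -/
def Cocycle.toPic (c : Cocycle M Z) : Pic M Z := Quotient.mk _ c

lemma FrameBundle.toPic_eq_toPic_cocycle (L : FrameBundle M Z) (U : Z → Opens M)
    (mem : ∀ x : Z, x.1 ∈ U x) (φ : ∀ x z : Z, z.1 ∈ U x → L.Frame z)
    (hφ : ∀ x, L.IsFrame (U x) (φ x)) : L.toPic = (L.cocycle U mem φ hφ).toPic :=
  L.toPic_eq U mem φ hφ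

lemma Cocycle.nsmul_toPic (n : ℕ) (c : Cocycle M Z) : n • c.toPic = (c.pow n).toPic := by
  induction n with
  | zero =>
    rw [zero_nsmul]
    exact Quotient.sound (Cocycle.iso_of_eq _ _ fun x y z _ _ _ _ => (pow_zero _).symm)
  | succ n ih =>
    rw [succ_nsmul, ih]
    exact Quotient.sound (Cocycle.iso_of_eq _ _ fun x y z _ _ _ _ => (pow_succ _ _).symm)

/-- The section of `𝒪_Z` induced by a function on an open subset of `M`, extended by zero. -/
def toSection (Z : Set M) {U : Opens M} (t : M.presheaf.obj (op U)) (z : Z) : Stalk M Z z :=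
  open Classical in
  if h : z.1 ∈ U then Ideal.Quotient.mk _ (M.presheaf.germ U z.1 h t) else 0

lemma toSection_eq {U : Opens M} (t : M.presheaf.obj (op U)) {z : Z} (h : z.1 ∈ U) :
    toSection Z t z = Ideal.Quotient.mk _ (M.presheaf.germ U z.1 h t) := dif_pos h

lemma isSection_toSection {U : Opens M} (t : M.presheaf.obj (op U)) :
    IsSection M Z U (toSection Z t) :=
  fun _ hz => ⟨U, hz, t, fun _ hw _ => toSection_eq t hw⟩

end Picard

/-! ### The Cartier divisor and its class -/

section Main

variable {M : LocallyRingedSpace.{u}} {X Z : Set M} {k p : ℕ} {K : Type v} [Field K]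
  [IsAlgClosed K] [CharZero K] (ι : K →+* M.presheaf.obj (op ⊤))

lemma Setting.isEffectiveCartier (h : Setting M X Z k p) :
    IsEffectiveCartier fun z : Z => transversalDiscriminant M ι X Z k p z := by
  obtain ⟨D, hD⟩ := exists_isDiscriminant (K := K) h.two_le h.pos
  intro x
  obtain ⟨U, hU, f, g, a, hfga⟩ := h.exists_isLocalExpansion x.2
  refine ⟨U, hU, toSection Z (localDiscriminant ι D a), isSection_toSection _, fun z hz => ?_⟩
  rw [toSection_eq _ hz]
  exact ⟨hfga.span_localDiscriminant ι hD h.two_le z.2 hz,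
    hfga.localDiscriminant_mem_nonZeroDivisors ι hD h hz⟩

lemma idealBundle_ratio (hX : IsHypersurface M X) (z : Z) (a b : (idealBundle M Z X hX).Frame z) :
    ∃ u : (M.presheaf.stalk z.1)ˣ, a.1 = u * b.1 ∧ (idealBundle M Z X hX).ratio z a b =
      Units.map (Ideal.Quotient.mk (idealAt M Z z)).toMonoidHom u :=
  ⟨_, (exists_unit_ratio a.2.2 (a.2.1.trans b.2.1.symm)).choose_spec, rfl⟩

lemma conormalDetBundle_ratio (hZ : IsLCI M Z k) (z : Z)
    (a b : (conormalDetBundle M Z k hZ).Frame z) :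
    DetRel (idealAt M Z z) a.1 b.1 ((conormalDetBundle M Z k hZ).ratio z a b : Stalk M Z z) :=
  (DetRel.exists_unit a.2.1 b.2.1 a.2.2).choose_spec

lemma divisorBundle_ratio {J : ∀ z : Z, Ideal (Stalk M Z z)} (hJ : IsEffectiveCartier J) (z : Z)
    (a b : (divisorBundle J hJ).Frame z) :
    a.1 = ((divisorBundle J hJ).ratio z a b : Stalk M Z z) * b.1 :=
  (exists_unit_ratio a.2.2 (a.2.1.trans b.2.1.symm)).choose_spec

/-- The heart of the class formula: `IsDiscriminant.compare` relates the two local discriminants,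
and the second one, a non-zero-divisor, is cancelled to leave a relation between transition
functions. -/
lemma IsLocalExpansion.ratio_eq {D : MvPolynomial (Exponent k p) K} {U U' : Opens M}
    {f : M.presheaf.obj (op U)} {g : Fin k → M.presheaf.obj (op U)}
    {a : Exponent k p → M.presheaf.obj (op U)} {f' : M.presheaf.obj (op U')}
    {g' : Fin k → M.presheaf.obj (op U')} {a' : Exponent k p → M.presheaf.obj (op U')}
    (h : IsLocalExpansion X Z f g a) (h' : IsLocalExpansion X Z f' g' a')
    (hs : Setting M X Z k p) (hD : IsDiscriminant D) {z : M} (hzZ : z ∈ Z) (hz : z ∈ U)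
    (hz' : z ∈ U') {u : M.presheaf.stalk z} {r t : Stalk M Z z}
    (hu : M.presheaf.germ U z hz f = u * M.presheaf.germ U' z hz' f')
    (ht : DetRel (idealAt M Z z) (fun i => M.presheaf.germ U z hz (g i))
      (fun i => M.presheaf.germ U' z hz' (g' i)) t)
    (hr : Ideal.Quotient.mk (idealAt M Z z) (M.presheaf.germ U z hz (localDiscriminant ι D a)) =
      r * Ideal.Quotient.mk (idealAt M Z z)
        (M.presheaf.germ U' z hz' (localDiscriminant ι D a'))) :
    r * t ^ ((p - 1) ^ (k - 1) * p) =
      Ideal.Quotient.mk (idealAt M Z z) u ^ (k * (p - 1) ^ (k - 1)) := by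
  obtain ⟨A, hA, rfl⟩ := ht
  rw [h.expansion z hz, h'.expansion z hz'] at hu
  have h1 := hD.compare hs.two_le (germConst M ι z) (h'.span_g z hz')
    (h'.isWeaklyRegular z hz' hzZ) hA (isHomogeneous_form _) (isHomogeneous_form _) hu
  rw [← germ_localDiscriminant, ← germ_localDiscriminant, hr] at h1
  refine eq_of_mul_eq (h'.localDiscriminant_mem_nonZeroDivisors ι hD hs hz') ?_
  rw [← h1]
  ring

lemma Setting.divisorBundle_toPic_add (h : Setting M X Z k p) :
    (divisorBundle _ (h.isEffectiveCartier ι)).toPic +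
        ((p - 1) ^ (k - 1) * p) • (conormalDetBundle M Z k h.lci).toPic =
      (k * (p - 1) ^ (k - 1)) • (idealBundle M Z X h.hypersurface).toPic := by
  obtain ⟨D, hD⟩ := exists_isDiscriminant (K := K) h.two_le h.pos
  choose U hU f g a hfga using fun x : Z => h.exists_isLocalExpansion x.2
  -- All three classes are computed with frames from the same local expansions, so that their
  -- cocycles live on one covering and can be compared pointwise.
  rw [FrameBundle.toPic_eq_toPic_cocycle (idealBundle M Z X h.hypersurface) U hU
      (fun x z hz => ⟨M.presheaf.germ (U x) z.1 hz (f x), (hfga x).span_f z.1 hz,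
        (hfga x).mem_nonZeroDivisors z.1 hz⟩) (fun x => ⟨f x, fun _ _ => rfl⟩),
    FrameBundle.toPic_eq_toPic_cocycle (conormalDetBundle M Z k h.lci) U hU
      (fun x z hz => ⟨fun i => M.presheaf.germ (U x) z.1 hz (g x i), (hfga x).span_g z.1 hz,
        (hfga x).isWeaklyRegular z.1 hz z.2⟩) (fun x => ⟨g x, fun _ _ => rfl⟩),
    FrameBundle.toPic_eq_toPic_cocycle (divisorBundle _ (h.isEffectiveCartier ι)) U hU
      (fun x z hz => ⟨Ideal.Quotient.mk _ (M.presheaf.germ (U x) z.1 hz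
        (localDiscriminant ι D (a x))), (hfga x).span_localDiscriminant ι hD h.two_le z.2 hz,
          (hfga x).localDiscriminant_mem_nonZeroDivisors ι hD h hz⟩)
      (fun x => ⟨toSection Z (localDiscriminant ι D (a x)), isSection_toSection _,
        fun z hz => (toSection_eq _ hz).symm⟩), Cocycle.nsmul_toPic, Cocycle.nsmul_toPic]
  refine Quotient.sound (Cocycle.iso_of_eq _ _ fun x y z hx hy _ _ => ?_)
  replace hx : z.1 ∈ U x := hx.1
  replace hy : z.1 ∈ U y := hy.1
  refine (congrArg₂ (fun r t => r * t ^ ((p - 1) ^ (k - 1) * p))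
    (FrameBundle.ratioExt_eq _ _ _ z hx hy) (FrameBundle.ratioExt_eq _ _ _ z hx hy)).trans
      (Eq.trans ?_ (congrArg (fun u => u ^ (k * (p - 1) ^ (k - 1)))
        (FrameBundle.ratioExt_eq _ _ _ z hx hy)).symm)
  obtain ⟨u, hu, hu'⟩ := idealBundle_ratio (Z := Z) h.hypersurface z
    ⟨_, (hfga x).span_f z.1 hx, (hfga x).mem_nonZeroDivisors z.1 hx⟩
    ⟨_, (hfga y).span_f z.1 hy, (hfga y).mem_nonZeroDivisors z.1 hy⟩
  rw [hu']
  refine Units.ext ?_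
  exact (hfga x).ratio_eq ι (hfga y) h hD z.2 hx hy hu
    (conormalDetBundle_ratio h.lci z
      ⟨_, (hfga x).span_g z.1 hx, (hfga x).isWeaklyRegular z.1 hx z.2⟩
      ⟨_, (hfga y).span_g z.1 hy, (hfga y).isWeaklyRegular z.1 hy z.2⟩)
    (divisorBundle_ratio (h.isEffectiveCartier ι) z
      ⟨_, (hfga x).span_localDiscriminant ι hD h.two_le z.2 hx,
        (hfga x).localDiscriminant_mem_nonZeroDivisors ι hD h hx⟩
      ⟨_, (hfga y).span_localDiscriminant ι hD h.two_le z.2 hy,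
        (hfga y).localDiscriminant_mem_nonZeroDivisors ι hD h hy⟩)

/-- The three classes are negatives of those of the bundles of equations and of conormal frames, so
the formula is `Setting.divisorBundle_toPic_add` with signs reversed. -/
theorem Setting.exists_divisorClass_eq (h : Setting M X Z k p) :
    ∃ hΔ : IsEffectiveCartier fun z : Z => transversalDiscriminant M ι X Z k p z,
      divisorClass _ hΔ = (p - 1) ^ (k - 1) • (k • hypersurfaceClass M Z X h.hypersurface -
        p • normalDetClass M Z k h.lci) := by
  refine ⟨h.isEffectiveCartier ι, ?_⟩
  have h1 := h.divisorBundle_toPic_add ι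
  rw [divisorClass, eq_sub_of_add_eq h1, hypersurfaceClass, normalDetClass, smul_neg, smul_neg,
    sub_neg_eq_add, smul_add, smul_neg, smul_smul, smul_smul, neg_sub, mul_comm k]
  abel

end Main

end TransDisc

end

theorem mainTheorem1 :
    -- `M` is a smooth variety over an algebraically closed field `K` of characteristic zero
    (∀ (K : Type u) [Field K] [IsAlgClosed K] [CharZero K] (M : Scheme.{u})
      (s : M ⟶ Spec (.of K)) [Smooth s] [IsSeparated s] [QuasiCompact s]
      (X Z : Set M.toLocallyRingedSpace) (k p : ℕ)
      (h : TransDisc.Setting M.toLocallyRingedSpace X Z k p),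
      ∃ hΔ : TransDisc.IsEffectiveCartier fun z : Z =>
          TransDisc.transversalDiscriminant M.toLocallyRingedSpace
            (TransDisc.schemeConst s) X Z k p z,
        TransDisc.divisorClass _ hΔ =
          (p - 1) ^ (k - 1) • (k • TransDisc.hypersurfaceClass _ Z X h.hypersurface -
            p • TransDisc.normalDetClass _ Z k h.lci)) ∧
    -- `M` is a complex manifold
    (∀ (E : Type v) [NormedAddCommGroup E] [NormedSpace ℂ E] [FiniteDimensional ℂ E]
      (M : Type) [TopologicalSpace M] [T2Space M] [SecondCountableTopology M]
      [ChartedSpace E M] [IsManifold 𝓘(ℂ, E) ∞ M]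
      (X Z : Set (TransDisc.manifoldSpace E M)) (k p : ℕ)
      (h : TransDisc.Setting (TransDisc.manifoldSpace E M) X Z k p),
      ∃ hΔ : TransDisc.IsEffectiveCartier fun z : Z =>
          TransDisc.transversalDiscriminant (TransDisc.manifoldSpace E M)
            (TransDisc.manifoldConst E M) X Z k p z,
        TransDisc.divisorClass _ hΔ =
          (p - 1) ^ (k - 1) • (k • TransDisc.hypersurfaceClass _ Z X h.hypersurface -
            p • TransDisc.normalDetClass _ Z k h.lci)) :=
  ⟨fun _ _ _ _ _ s _ _ _ _ _ _ _ h => h.exists_divisorClass_eq (TransDisc.schemeConst s),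
    fun E _ _ _ M _ _ _ _ _ _ _ _ _ h =>
      h.exists_divisorClass_eq (TransDisc.manifoldConst E M)⟩
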